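/- **Proposition 4.5 (minimizing resolution in the class $B_{s2\infty}$).** *Setting.* Let $d\ge 2$, $s>0$, and let $f$ be a compactly supported probability density on $\mathbb R^d$ which is (a.e.) the product of its marginals and belongs to $B_{s2\infty}(\mathbb R^d)$, i.e. $f\in L_2$ and $\sup_{t>0}t^{-s}\sup_{|h|\le t}\|\Delta_h^{k}f\|_2<\infty$ with $k=\lfloor s\rfloor+1$. For an invertible matrix $A$ let $f_A(x)=|\det A^{-1}|\,f(A^{-1}x)$, and for a density $p$ on $\mathbb R^d$ let $p^{\star\ell}$ be its $\ell$-th marginal. Let $\varphi:\mathbb R\to\mathbb R$ be a compactly supported scaling function of class $C^r$, $r\in\mathbb N$, $r>s$, of a multiresolution analysis of $L_2(\mathbb R)$ (orthonormal integer translates; $V_j\subset V_{j+1}$ for $j\in\mathbb Z$; $\bigcup_{j\ge0}V_j$ dense, where $V_j$ is the closed span of $\varphi_{jm}=2^{j/2}\varphi(2^j\cdot-m)$, $m\in\mathbb Z$). Put $\Phi_{jk}(x)=\prod_{\ell}\varphi_{jk^\ell}(x^\ell)$ for $k\in\mathbb Z^d$, $$C_j(p)=\sum_{k\in\mathbb Z^d}\Big(\int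 p\,\Phi_{jk}-\prod_{\ell=1}^d\int p^{\star\ell}\varphi_{jk^\ell}\Big)^2,\qquad \hat C_j=\sum_{k\in\mathbb Z^d}\Big(\frac1n\sum_{i=1}^n\Phi_{jk}(X_i)-\prod_{\ell=1}^d\frac1n\sum_{i=1}^n\varphi_{jk^\ell}(X_i^\ell)\Big)^2,$$ where $X_1,\dots,X_n$ are i.i.d. with density $f_A$, and let $E^n_{f_A}$ be the expectation. Write $C_j=C_j(f_A)$, $K_\star=\big\|f_A-\prod_\ell f_A^{\star\ell}\big\|_2$ and $Q(a,b)=-4a^3+6a^2b-4ab^2+b^3$. *Claim.* Below $n\ge1$ and $j\ge0$ are integers, and "uniformly in $A$" means that, for each $M$, the constant can be chosen the same for all invertible $A$ such that the entries of $A$ and $A^{-1}$ are bounded by $M$ in absolute value. 1. (Risk bounds.) $\hat C_j$ is square integrable for all $n,j$, and there is a constant $K$, uniformly in $A$, such that, whenever $2^{jd}\le n$, $$E^n_{f_A}(\hat C_j-C_j)^2\le K\,\frac{2^{jd}}n,\qquad E^n_{f_A}\hat C_j^2+K_\star\,Q\big(C_j^{1/2},K_\star\big)\le K\Big(2^{-4js}+\frac{2^{jd}}n\Big).$$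 2. (Minimizing resolution.) For all constants $a,b>0$ and every $n$, the bound $j\mapsto a2^{-4js}+b2^{jd}/n$ has a minimizer over the integers $j\ge0$, and there are $c_1,c_2>0$, depending only on $a,b,s,d$, such that every minimizer $j$ satisfies $c_1n^{1/(4s+d)}\le2^j\le c_2n^{1/(4s+d)}$. 3. (Rate.) For all $c_1,c_2>0$ there is a constant $K$, uniformly in $A$, such that, whenever $c_1n^{1/(4s+d)}\le2^j\le c_2n^{1/(4s+d)}$, $$E^n_{f_A}(\hat C_j-C_j)^2\le K n^{-\frac{4s}{4s+d}},\qquad E^n_{f_A}\hat C_j^2+K_\star\,Q\big(C_j^{1/2},K_\star\big)\le K n^{-\frac{4s}{4s+d}},$$ and, if $f_A$ is a.e. the product of its marginals (independence), $E^n_{f_A}\hat C_j^2\le K n^{-\frac{4s}{4s+d}}$. 4. This rate is faster than the rate $n^{-2s/(2s+d)}$ (the minimax rate of the underlying density estimation): $n^{-4s/(4s+d)}=o\big(n^{-2s/(2s+d)}\big)$ as $n\to\infty$. -/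

import Mathlib

open MeasureTheory Filter Asymptotics
open scoped ENNReal

noncomputable section

namespace WaveletICA

/-! ### Densities, marginals, mixing -/

/-- A (measurable) probability density with respect to Lebesgue measure on `ℝ^d`. -/
structure IsDensity {d : ℕ} (f : (Fin d → ℝ) → ℝ) : Prop where
  measurable : Measurable f
  nonneg : ∀ x, 0 ≤ f x
  integrable : Integrable f volume
  integral_eq_one : ∫ x, f x = 1

/-- The `ℓ`-th marginal of `f`: the coordinate `x^ℓ = t` is kept, all the others are
integrated out. -/
def marginal {d : ℕ} (f : (Fin d → ℝ) → ℝ) (ℓ : Fin d) (t : ℝ) : ℝ :=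
  ∫ y : ({i : Fin d // i ≠ ℓ} → ℝ), f (fun i => if h : i = ℓ then t else y ⟨i, h⟩)

/-- The product of the marginals of `f`, as a function on `ℝ^d`. -/
def marginalProd {d : ℕ} (f : (Fin d → ℝ) → ℝ) (x : Fin d → ℝ) : ℝ :=
  ∏ ℓ, marginal f ℓ (x ℓ)

/-- `f` is (almost everywhere) the product of its marginals: for a density, this says that the
components are independent. -/
def Factorizes {d : ℕ} (f : (Fin d → ℝ) → ℝ) : Prop :=
  ∀ᵐ x : Fin d → ℝ, f x = marginalProd f x

/-- The mixed density `f_A(x) = |det A⁻¹| f(A⁻¹ x)`, i.e. the density of `A S` when `S` has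
density `f`. -/
def mixed {d : ℕ} (A : Matrix (Fin d) (Fin d) ℝ) (f : (Fin d → ℝ) → ℝ) (x : Fin d → ℝ) : ℝ :=
  |A⁻¹.det| * f (A⁻¹.mulVec x)

/-- `A` is invertible and the entries of `A` and of `A⁻¹` are at most `M` in absolute value.
Every invertible matrix satisfies this for some `M`. -/
def InvertibleBoundedBy {d : ℕ} (M : ℝ) (A : Matrix (Fin d) (Fin d) ℝ) : Prop :=
  A.det ≠ 0 ∧ ∀ i j, |A i j| ≤ M ∧ |A⁻¹ i j| ≤ M

/-! ### The Besov class `B_{s2∞}(ℝ^d)` through moduli of continuity -/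

/-- The `L_2` modulus of continuity of order `k`,
`Ω^k(f,δ)_2 = sup_{|h| ≤ δ} ‖Δ_h^k f‖_2`, with `|h|` the Euclidean norm. -/
def modulus {d : ℕ} (k : ℕ) (f : (Fin d → ℝ) → ℝ) (δ : ℝ) : ℝ≥0∞ :=
  ⨆ (h : Fin d → ℝ) (_ : ‖WithLp.toLp 2 h‖ ≤ δ), eLpNorm ((fwdDiff h)^[k] f) 2 volume

/-- The semi-norm `sup_{t > 0} t^{-s} Ω^k(f,t)_2` with the admissible order `k = [s] + 1 > s`. -/
def besovSeminorm {d : ℕ} (s : ℝ) (f : (Fin d → ℝ) → ℝ) : ℝ≥0∞ :=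
  ⨆ (t : ℝ) (_ : 0 < t), ENNReal.ofReal (t ^ (-s)) * modulus (⌊s⌋₊ + 1) f t

/-- Membership in the (inhomogeneous) Besov space `B_{s2∞}(ℝ^d)`, for `s > 0`. -/
def MemBesov {d : ℕ} (s : ℝ) (f : (Fin d → ℝ) → ℝ) : Prop :=
  MemLp f 2 volume ∧ besovSeminorm s f < ∞

/-! ### Multiresolution analysis -/

/-- `φ_{jk}(x) = 2^{j/2} φ(2^j x - k)`. -/
def scaled (φ : ℝ → ℝ) (j k : ℤ) (x : ℝ) : ℝ :=
  (2 : ℝ) ^ ((j : ℝ) / 2) * φ ((2 : ℝ) ^ j * x - k)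

/-- `V_j`, the closed linear span in `L_2(ℝ)` of the functions `φ_{jk}`, `k ∈ ℤ`. -/
def approxSpace (φ : ℝ → ℝ) (j : ℤ) : Submodule ℝ (Lp ℝ 2 (volume : Measure ℝ)) :=
  (Submodule.span ℝ
    {u : Lp ℝ 2 (volume : Measure ℝ) | ∃ k : ℤ, u =ᵐ[volume] scaled φ j k}).topologicalClosure

/-- `φ` is a compactly supported scaling function of class `C^r` of a multiresolution analysis
of `L_2(ℝ)`: its integer translates are orthonormal, `V_j ⊆ V_{j+1}` for all `j`, and the union
of the `V_j`, `j ≥ 0`, is dense. -/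
structure IsRegularScalingFunction (r : ℕ) (φ : ℝ → ℝ) : Prop where
  contDiff : ContDiff ℝ r φ
  hasCompactSupport : HasCompactSupport φ
  orthonormal : ∀ k l : ℤ, ∫ x : ℝ, φ (x - k) * φ (x - l) = if k = l then 1 else 0
  nested : ∀ j : ℤ, approxSpace φ j ≤ approxSpace φ (j + 1)
  dense : Dense (⋃ j : ℕ, (approxSpace φ j : Set (Lp ℝ 2 (volume : Measure ℝ))))

/-- `Φ_{jk}(x) = φ_{jk^1}(x^1) ⋯ φ_{jk^d}(x^d)`. -/
def tensorScaled {d : ℕ} (φ : ℝ → ℝ) (j : ℤ) (k : Fin d → ℤ) (x : Fin d → ℝ) : ℝ :=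
  ∏ ℓ, scaled φ j (k ℓ) (x ℓ)

/-! ### The wavelet contrast and its estimator -/

/-- `α_{jk} = ∫ f Φ_{jk}`. -/
def coeff {d : ℕ} (φ : ℝ → ℝ) (f : (Fin d → ℝ) → ℝ) (j : ℤ) (k : Fin d → ℤ) : ℝ :=
  ∫ x, f x * tensorScaled φ j k x

/-- `α_{jk^ℓ} = ∫ f^{⋆ℓ} φ_{jk^ℓ}`, with `f^{⋆ℓ}` the `ℓ`-th marginal. -/
def marginalCoeff {d : ℕ} (φ : ℝ → ℝ) (f : (Fin d → ℝ) → ℝ) (j : ℤ) (ℓ : Fin d) (m : ℤ) : ℝ :=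
  ∫ t, marginal f ℓ t * scaled φ j m t

/-- The wavelet contrast `C_j(f) = ∑_k (α_{jk} - α_{jk^1} ⋯ α_{jk^d})^2`. -/
def contrast {d : ℕ} (φ : ℝ → ℝ) (f : (Fin d → ℝ) → ℝ) (j : ℤ) : ℝ :=
  ∑' k : Fin d → ℤ, (coeff φ f j k - ∏ ℓ, marginalCoeff φ f j ℓ (k ℓ)) ^ 2

/-- `\hat α_{jk} = n⁻¹ ∑_i Φ_{jk}(X_i)`. -/
def empCoeff {d n : ℕ} (φ : ℝ → ℝ) (j : ℤ) (k : Fin d → ℤ) (X : Fin n → Fin d → ℝ) : ℝ :=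
  (n : ℝ)⁻¹ * ∑ i, tensorScaled φ j k (X i)

/-- `\hat α_{jk^ℓ} = n⁻¹ ∑_i φ_{jk^ℓ}(X_i^ℓ)`. -/
def empMarginalCoeff {d n : ℕ} (φ : ℝ → ℝ) (j : ℤ) (ℓ : Fin d) (m : ℤ)
    (X : Fin n → Fin d → ℝ) : ℝ :=
  (n : ℝ)⁻¹ * ∑ i, scaled φ j m (X i ℓ)

/-- The linear wavelet contrast estimator
`\hat C_j(X) = ∑_k (\hat α_{jk} - \hat α_{jk^1} ⋯ \hat α_{jk^d})^2`. -/
def contrastEst {d n : ℕ} (φ : ℝ → ℝ) (j : ℤ) (X : Fin n → Fin d → ℝ) : ℝ :=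
  ∑' k : Fin d → ℤ, (empCoeff φ j k X - ∏ ℓ, empMarginalCoeff φ j ℓ (k ℓ) X) ^ 2

/-- The joint law of an i.i.d. sample of size `n` from the density `p` on `ℝ^d`. -/
def sampleLaw {d : ℕ} (n : ℕ) (p : (Fin d → ℝ) → ℝ) : Measure (Fin n → Fin d → ℝ) :=
  Measure.pi fun _ => volume.withDensity fun x => ENNReal.ofReal (p x)

/-- The quadratic risk `E (\hat C_j - c)^2` about the value `c`, for an i.i.d. sample of size `n`
from the density `p`. -/
def quadRisk {d : ℕ} (φ : ℝ → ℝ) (n : ℕ) (p : (Fin d → ℝ) → ℝ) (j : ℤ) (c : ℝ) : ℝ :=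
  ∫ X, (contrastEst φ j X - c) ^ 2 ∂(sampleLaw n p)

/-- `K_⋆ = ‖p - p^{⋆1} ⋯ p^{⋆d}‖_2`, the true `L_2` distance of `p` to the product of its
marginals. -/
def depNorm {d : ℕ} (p : (Fin d → ℝ) → ℝ) : ℝ :=
  (eLpNorm (fun x => p x - marginalProd p x) 2 volume).toReal

/-- `Q(a,b) = -4a³ + 6a²b - 4ab² + b³`, so that `(b - a)⁴ = a⁴ + b Q(a,b)`. -/
def quarticQ (a b : ℝ) : ℝ := -4 * a ^ 3 + 6 * a ^ 2 * b - 4 * a * b ^ 2 + b ^ 3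

/-- The bias/variance bound `a 2^{-4js} + b 2^{jd} / n`. -/
def riskBound (a b s : ℝ) (d n j : ℕ) : ℝ :=
  a * (2 : ℝ) ^ (-(4 * j * s)) + b * (2 : ℝ) ^ (j * d) / n

/-- The resolution `j ≥ 0` minimizes the bound `a 2^{-4js} + b 2^{jd} / n`. -/
def IsMinimizingResolution (a b s : ℝ) (d n j : ℕ) : Prop :=
  ∀ i : ℕ, riskBound a b s d n j ≤ riskBound a b s d n i

end WaveletICA

end

open WaveletICA

/-!
The estimator `Ĉ_j` and the contrast `C_j` are squared norms, of random and deterministic vectors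
`T` and `θ` in a finite-dimensional Euclidean space: for densities supported in a fixed cube only
finitely many indices `k` contribute (`exists_contrast_eq_norm_sq`). With `v(x) = (Φ_{jk}(x))_k`,
the vector `T` is the mean of `v` over the sample minus its mean over all points that take their
coordinates from arbitrary sample points (`empDiff`), and `‖v‖² ≤ C 2^{jd}` since boundedly many
translates of `φ` overlap.

*Variance.* Replacing one sample point moves `T` by at most a constant times `2^{jd/2} / n`, so a
bounded differences argument in Hilbert space (`bounded_differences_moments`) controls the second
and fourth moments of `T - E T`. The bias `E T - θ` only comes from noninjective choices of sample
points and is at most a constant times `2^{jd/2} / n`. Expanding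
`‖T‖² - ‖θ‖² = ‖T - θ‖² + 2 ⟪θ, T - θ⟫` gives, with `u = 2^{jd} / n`, that `E (Ĉ_j - C_j)²` and
`E Ĉ_j - C_j` are at most constant multiples of `u + u²` and `u` (`empDiff_norm_sq_moments`).

*Bias.* Write `g` for the density minus the product of its marginals. Then `C_j` is the squared norm
of the projection of `g` on the tensor product space `V_j ⊗ ⋯ ⊗ V_j`, so `C_j ≤ K_⋆²`, and
`K_⋆² - C_j` is the squared approximation error of `g`. To bound it without constructing wavelets,
the resolution is refined one coordinate at a time. The component of `φ_{1π}` orthogonal to `V_0` is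
a finite combination of the `φ_{1n}`; it is orthogonal to all dilates of `φ`, and this together with
`∫ φ ≠ 0` forces its coefficient sequence to factor through the difference `Δ^N` for all `N ≤ r`
(`exists_detail`). Hence one refinement step in one coordinate captures at most a constant times
the squared norm of the `N`-th difference of `g` in that coordinate
(`exists_norm_sq_step_le`), and summing a geometric series yields `K_⋆² - C_j ≤ K 2^{-2js}`
(`exists_approximation_error_le`, `exists_contrast_bias_le`). The differences of `g` are controlled
by those of the density, because taking marginals commutes with differences along the
axes and is bounded in `L_2` on functions supported in a cube.

*Conclusion.* Since `b Q(a, b) + a⁴ = (b - a)⁴`, the quantity `E Ĉ_j² + K_⋆ Q(C_j^{1/2}, K_⋆)` is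
`E (Ĉ_j - C_j)² + 2 C_j (E Ĉ_j - C_j) + (K_⋆ - C_j^{1/2})⁴`, whose last term is at most
`(K_⋆² - C_j)²` (`exists_risk_le`). All constants depend on the density only through a bound on its
support, its `L_2` norm and the `L_2` norms of its differences, and these are bounded uniformly in
the mixing matrix (`exists_inSmoothClass_mixed`). At `2^j ≈ n^{1/(4s+d)}` the terms `2^{-4js}` and
`2^{jd} / n` are of the same order, which gives the minimizing resolution and the rate.
-/

/-! ### Moments of functions with bounded differences in a Hilbert space -/

section BoundedDifferences

variable {H : Type*} [NormedAddCommGroup H] [InnerProductSpace ℝ H] [CompleteSpace H]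
variable {Ω : Type*} [MeasurableSpace Ω]

/-- Adding a centred increment of norm at most `c`: the linear term has mean zero. -/
lemma integral_norm_add_sq_le (μ : Measure Ω) [IsProbabilityMeasure μ] {ξ : Ω → H} {c : ℝ}
    (hξm : StronglyMeasurable ξ) (hξ : ∀ x, ‖ξ x‖ ≤ c) (h0 : ∫ x, ξ x ∂μ = 0) (u : H) :
    ∫ x, ‖u + ξ x‖ ^ 2 ∂μ ≤ ‖u‖ ^ 2 + c ^ 2 := by
  have hi : Integrable ξ μ := Integrable.of_bound hξm.aestronglyMeasurable c (ae_of_all _ hξ)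
  have hin : ∫ x, inner ℝ u (ξ x) ∂μ = 0 := by
    rw [integral_inner hi, h0, inner_zero_right]
  have hii : Integrable (fun x => inner ℝ u (ξ x)) μ := hi.const_inner u
  have hb : ∀ x, ‖u + ξ x‖ ^ 2 ≤ (‖u‖ ^ 2 + c ^ 2) + 2 * inner ℝ u (ξ x) := by
    intro x
    rw [norm_add_sq_real]
    have := pow_le_pow_left₀ (norm_nonneg _) (hξ x) 2
    linarith
  calc ∫ x, ‖u + ξ x‖ ^ 2 ∂μ ≤ ∫ x, ((‖u‖ ^ 2 + c ^ 2) + 2 * inner ℝ u (ξ x)) ∂μ :=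
        integral_mono_of_nonneg (ae_of_all _ fun x => by positivity)
          ((integrable_const _).add (hii.const_mul 2)) (ae_of_all _ hb)
    _ = _ := by
        rw [integral_add (integrable_const _) (hii.const_mul 2), integral_const_mul, hin]
        simp

lemma integral_norm_add_pow_four_le (μ : Measure Ω) [IsProbabilityMeasure μ] {ξ : Ω → H} {c : ℝ}
    (hξm : StronglyMeasurable ξ) (hξ : ∀ x, ‖ξ x‖ ≤ c) (h0 : ∫ x, ξ x ∂μ = 0) (u : H) :
    ∫ x, ‖u + ξ x‖ ^ 4 ∂μ ≤ ‖u‖ ^ 4 + 8 * c ^ 2 * ‖u‖ ^ 2 + 3 * c ^ 4 := by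
  have hi : Integrable ξ μ := Integrable.of_bound hξm.aestronglyMeasurable c (ae_of_all _ hξ)
  have hin : ∫ x, inner ℝ u (ξ x) ∂μ = 0 := by
    rw [integral_inner hi, h0, inner_zero_right]
  have hii : Integrable (fun x => inner ℝ u (ξ x)) μ := hi.const_inner u
  have hb : ∀ x, ‖u + ξ x‖ ^ 4 ≤ (‖u‖ ^ 4 + 8 * c ^ 2 * ‖u‖ ^ 2 + 3 * c ^ 4)
      + 4 * ‖u‖ ^ 2 * inner ℝ u (ξ x) := by
    intro x
    have h4 : ‖u + ξ x‖ ^ 4 = (‖u‖ ^ 2 + 2 * inner ℝ u (ξ x) + ‖ξ x‖ ^ 2) ^ 2 := by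
      rw [← norm_add_sq_real]; ring
    rw [h4]
    have hc := hξ x
    have hn := norm_nonneg (ξ x)
    have hu := norm_nonneg u
    have hcs : |inner ℝ u (ξ x)| ≤ ‖u‖ * c :=
      (abs_real_inner_le_norm u (ξ x)).trans (mul_le_mul_of_nonneg_left hc hu)
    set t := inner ℝ u (ξ x)
    set v := ‖ξ x‖
    set w := ‖u‖
    have hc0 : 0 ≤ c := hn.trans hc
    have hv2 : v ^ 2 ≤ c ^ 2 := pow_le_pow_left₀ hn hc 2
    have hv4 : v ^ 4 ≤ c ^ 4 := pow_le_pow_left₀ hn hc 4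
    have ht2 : t ^ 2 ≤ w ^ 2 * c ^ 2 := by
      rw [← sq_abs t, ← mul_pow]; exact pow_le_pow_left₀ (abs_nonneg _) hcs 2
    have ht3 : t * v ^ 2 ≤ (w * c) * c ^ 2 :=
      (mul_le_mul_of_nonneg_right ((le_abs_self t).trans hcs) (sq_nonneg v)).trans
        (mul_le_mul_of_nonneg_left hv2 (by positivity))
    have hw : w ^ 2 * v ^ 2 ≤ w ^ 2 * c ^ 2 := mul_le_mul_of_nonneg_left hv2 (sq_nonneg w)
    have hwc : 4 * ((w * c) * c ^ 2) ≤ 2 * w ^ 2 * c ^ 2 + 2 * c ^ 4 := by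
      nlinarith [mul_nonneg (sq_nonneg c) (sq_nonneg (w - c))]
    nlinarith
  calc ∫ x, ‖u + ξ x‖ ^ 4 ∂μ
      ≤ ∫ x, ((‖u‖ ^ 4 + 8 * c ^ 2 * ‖u‖ ^ 2 + 3 * c ^ 4)
        + 4 * ‖u‖ ^ 2 * inner ℝ u (ξ x)) ∂μ :=
        integral_mono_of_nonneg (ae_of_all _ fun x => by positivity)
          ((integrable_const _).add (hii.const_mul _)) (ae_of_all _ hb)
    _ = _ := by
        rw [integral_add (integrable_const _) (hii.const_mul _), integral_const_mul, hin]
        simp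

/-- Fubini on a power of a probability space, splitting off the first coordinate. -/
lemma integral_pi_succ {E : Type*} [NormedAddCommGroup E] [NormedSpace ℝ E]
    (μ : Measure Ω) [IsProbabilityMeasure μ] {n : ℕ} {F : (Fin (n + 1) → Ω) → E}
    (hF : StronglyMeasurable F) {B : ℝ} (hB : ∀ x, ‖F x‖ ≤ B) :
    ∫ x, F x ∂(Measure.pi fun _ : Fin (n + 1) => μ)
      = ∫ x', ∫ x₀, F (Fin.cons x₀ x') ∂μ ∂(Measure.pi fun _ : Fin n => μ) := by
  have hmp := (measurePreserving_piFinSuccAbove (fun _ : Fin (n + 1) => μ) 0).symm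
  rw [← hmp.integral_comp']
  rw [integral_prod_symm]
  · simp only [MeasurableEquiv.piFinSuccAbove_symm_apply, Fin.insertNthEquiv_zero]
    rfl
  · refine Integrable.of_bound (hF.comp_measurable
      (MeasurableEquiv.measurable _)).aestronglyMeasurable B (ae_of_all _ fun x => hB _)

lemma measurable_fin_cons {n : ℕ} :
    Measurable fun q : (Fin n → Ω) × Ω => (Fin.cons q.2 q.1 : Fin (n + 1) → Ω) := by
  refine measurable_pi_lambda _ fun i => ?_
  refine Fin.cases ?_ (fun i => ?_) i
  · simpa using measurable_snd
  · simpa using (measurable_pi_apply (X := fun _ : Fin n => Ω) i).fun_comp measurable_fst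

/-- Second and fourth central moments of a function of `n` independent variables with values in a
Hilbert space that moves by at most `c` when one variable changes. Integrating out the first
variable splits off a bounded centred increment, and induction on `n` applies to the rest. -/
theorem bounded_differences_moments (μ : Measure Ω) [IsProbabilityMeasure μ] {c : ℝ} (n : ℕ) :
    ∀ {F : (Fin n → Ω) → H} {B : ℝ}, StronglyMeasurable F → (∀ x, ‖F x‖ ≤ B) →
    (∀ x i y, ‖F (Function.update x i y) - F x‖ ≤ c) →
    (∫ x, ‖F x - ∫ z, F z ∂(Measure.pi fun _ => μ)‖ ^ 2 ∂(Measure.pi fun _ => μ) ≤ n * c ^ 2) ∧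
    (∫ x, ‖F x - ∫ z, F z ∂(Measure.pi fun _ => μ)‖ ^ 4 ∂(Measure.pi fun _ => μ)
      ≤ 7 * n ^ 2 * c ^ 4) := by
  induction n with
  | zero =>
    intro F B hF hB hc
    have : ∀ x, F x = F default := fun x => by rw [Subsingleton.elim x default]
    simp [this]
  | succ n ih =>
    intro F B hF hB hc
    have hFcons : StronglyMeasurable fun q : (Fin n → Ω) × Ω => F (Fin.cons q.2 q.1) :=
      hF.comp_measurable measurable_fin_cons
    set G : (Fin n → Ω) → H := fun x' => ∫ x₀, F (Fin.cons x₀ x') ∂μ with hG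
    have hGm : StronglyMeasurable G := hFcons.integral_prod_right
    have hint : ∀ x', Integrable (fun x₀ => F (Fin.cons x₀ x')) μ := fun x' =>
      Integrable.of_bound (hFcons.comp_measurable measurable_prodMk_left).aestronglyMeasurable B
        (ae_of_all _ fun _ => hB _)
    have hGB : ∀ x, ‖G x‖ ≤ B := fun x' => by
      simpa using norm_integral_le_of_norm_le_const (μ := μ) (ae_of_all _ fun x₀ =>
        hB (Fin.cons x₀ x'))
    have hGc : ∀ x i y, ‖G (Function.update x i y) - G x‖ ≤ c := fun x' i y => by
      rw [hG]
      simp only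
      rw [← integral_sub (hint _) (hint _)]
      refine (norm_integral_le_of_norm_le_const (C := c) (ae_of_all _ fun x₀ => ?_)).trans
        (by simp)
      rw [Fin.cons_update]
      exact hc _ _ _
    obtain ⟨ih2, ih4⟩ := ih hGm hGB hGc
    have hmean : ∫ z, F z ∂(Measure.pi fun _ => μ) = ∫ z, G z ∂(Measure.pi fun _ => μ) :=
      integral_pi_succ μ hF hB
    rw [hmean]
    set m := ∫ z, G z ∂(Measure.pi fun _ => μ) with hm
    have hmB : ‖m‖ ≤ B := by
      simpa using norm_integral_le_of_norm_le_const (μ := Measure.pi fun _ : Fin n => μ)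
        (ae_of_all _ hGB)
    have hξ : ∀ x₀ x', ‖F (Fin.cons x₀ x') - G x'‖ ≤ c := fun x₀ x' => by
      have : F (Fin.cons x₀ x') - G x' = ∫ y, (F (Fin.cons x₀ x') - F (Fin.cons y x')) ∂μ := by
        rw [integral_sub (integrable_const _) (hint _)]; simp [hG]
      rw [this]
      refine (norm_integral_le_of_norm_le_const (C := c) (ae_of_all _ fun y => ?_)).trans (by simp)
      have := hc (Fin.cons y x' : Fin (n + 1) → Ω) 0 x₀
      rwa [Fin.update_cons_zero] at this
    have hξm : ∀ x', StronglyMeasurable fun x₀ => F (Fin.cons x₀ x') - G x' := fun x' =>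
      (hFcons.comp_measurable measurable_prodMk_left).sub stronglyMeasurable_const
    have hξ0 : ∀ x', ∫ x₀, (F (Fin.cons x₀ x') - G x') ∂μ = 0 := fun x' => by
      rw [integral_sub (hint _) (integrable_const _)]; simp [hG]
    have hsplit : ∀ x₀ x', F (Fin.cons x₀ x') - m
        = (G x' - m) + (F (Fin.cons x₀ x') - G x') := fun _ _ => by abel
    have hFm : StronglyMeasurable fun x => F x - m := hF.sub stronglyMeasurable_const
    have hGm' : StronglyMeasurable fun x => G x - m := hGm.sub stronglyMeasurable_const
    have hFmB : ∀ x, ‖F x - m‖ ≤ 2 * B := fun x =>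
      (norm_sub_le _ _).trans (by linarith [hB x])
    have hGmB : ∀ x, ‖G x - m‖ ≤ 2 * B := fun x =>
      (norm_sub_le _ _).trans (by linarith [hGB x])
    have hGpow : ∀ k, Integrable (fun x => ‖G x - m‖ ^ k) (Measure.pi fun _ : Fin n => μ) :=
      fun k => Integrable.of_bound (hGm'.norm.pow k).aestronglyMeasurable ((2 * B) ^ k)
        (ae_of_all _ fun x => by
          rw [norm_pow, norm_norm]; exact pow_le_pow_left₀ (norm_nonneg _) (hGmB x) k)
    have hfub : ∀ k, ∫ x, ‖F x - m‖ ^ k ∂(Measure.pi fun _ => μ)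
        = ∫ x', ∫ x₀, ‖(G x' - m) + (F (Fin.cons x₀ x') - G x')‖ ^ k ∂μ
          ∂(Measure.pi fun _ => μ) := fun k => by
      have h := integral_pi_succ μ (F := fun x => ‖F x - m‖ ^ k) (hFm.norm.pow k)
        (B := (2 * B) ^ k) fun x => by
          rw [norm_pow, norm_norm]
          exact pow_le_pow_left₀ (norm_nonneg _) (hFmB x) k
      rw [h]
      simp only [hsplit]
    constructor
    · rw [hfub]
      refine (integral_mono_of_nonneg (g := fun x' => ‖G x' - m‖ ^ 2 + c ^ 2)
        (ae_of_all _ fun x' => integral_nonneg fun _ => by positivity)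
        ((hGpow 2).add (integrable_const _))
        (ae_of_all _ fun x' => integral_norm_add_sq_le μ (hξm x') (fun x₀ => hξ x₀ x')
          (hξ0 x') _)).trans ?_
      rw [integral_add (hGpow 2) (integrable_const _)]
      simp only [integral_const, probReal_univ, smul_eq_mul, one_mul]
      push_cast
      linarith
    · rw [hfub]
      refine (integral_mono_of_nonneg
        (g := fun x' => ‖G x' - m‖ ^ 4 + 8 * c ^ 2 * ‖G x' - m‖ ^ 2 + 3 * c ^ 4)
        (ae_of_all _ fun x' => integral_nonneg fun _ => by positivity)
        (((hGpow 4).add ((hGpow 2).const_mul _)).add (integrable_const _))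
        (ae_of_all _ fun x' => integral_norm_add_pow_four_le μ (hξm x') (fun x₀ => hξ x₀ x')
          (hξ0 x') _)).trans ?_
      rw [integral_add (f := fun x' => ‖G x' - m‖ ^ 4 + 8 * c ^ 2 * ‖G x' - m‖ ^ 2)
          ((hGpow 4).add ((hGpow 2).const_mul _)) (integrable_const _),
        integral_add (hGpow 4) ((hGpow 2).const_mul _), integral_const_mul]
      simp only [integral_const, probReal_univ, smul_eq_mul, one_mul]
      push_cast
      have h8 : 8 * c ^ 2 * ∫ x, ‖G x - m‖ ^ 2 ∂(Measure.pi fun _ => μ)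
          ≤ 8 * c ^ 2 * (n * c ^ 2) := mul_le_mul_of_nonneg_left ih2 (by positivity)
      have : 0 ≤ (n : ℝ) * c ^ 4 := by positivity
      nlinarith [sq_nonneg (c ^ 2)]

end BoundedDifferences

/-! ### Empirical means against products of empirical means -/

section Empirical

/-- A set of index maps that are determined by their values away from `a` has at most `n^{d-1}`
elements. -/
lemma card_mul_le_pow {d n : ℕ} (a : Fin d) (S : Finset (Fin d → Fin n))
    (hS : ∀ ι ∈ S, ∀ κ ∈ S, (∀ b, b ≠ a → ι b = κ b) → ι = κ) :
    n * S.card ≤ n ^ d := by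
  classical
  have h : ((Finset.univ : Finset (Fin n)) ×ˢ S).card
      ≤ (Finset.univ : Finset (Fin d → Fin n)).card := by
    refine Finset.card_le_card_of_injOn (fun q => Function.update q.2 a q.1)
      (fun _ _ => Finset.mem_coe.2 (Finset.mem_univ _)) ?_
    rintro ⟨i, ι⟩ hι ⟨j, κ⟩ hκ h
    simp only [Finset.coe_product, Set.mem_prod, Finset.mem_coe] at hι hκ
    have hi : i = j := by simpa using congrFun h a
    refine Prod.ext hi (hS _ hι.2 _ hκ.2 fun b hb => ?_)
    simpa [hb] using congrFun h b
  simpa [Finset.card_product] using h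

lemma card_hitting_le {d n : ℕ} (i : Fin n) :
    n * (Finset.univ.filter fun ι : Fin d → Fin n => ∃ a, ι a = i).card ≤ d * n ^ d := by
  classical
  have : (Finset.univ.filter fun ι : Fin d → Fin n => ∃ a, ι a = i)
      ⊆ Finset.univ.biUnion fun a : Fin d => Finset.univ.filter fun ι : Fin d → Fin n => ι a = i := by
    intro ι; simp
  calc n * (Finset.univ.filter fun ι : Fin d → Fin n => ∃ a, ι a = i).card
      ≤ n * ∑ a : Fin d, (Finset.univ.filter fun ι : Fin d → Fin n => ι a = i).card :=
        Nat.mul_le_mul_left _ ((Finset.card_le_card this).trans Finset.card_biUnion_le)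
    _ = ∑ a : Fin d, n * (Finset.univ.filter fun ι : Fin d → Fin n => ι a = i).card := by
        rw [Finset.mul_sum]
    _ ≤ ∑ _a : Fin d, n ^ d := by
        refine Finset.sum_le_sum fun a _ => card_mul_le_pow a _ fun ι hι κ hκ h => ?_
        simp only [Finset.mem_filter, Finset.mem_univ, true_and] at hι hκ
        funext b
        by_cases hb : b = a
        · rw [hb, hι, hκ]
        · exact h b hb
    _ = d * n ^ d := by simp

lemma card_not_injective_le {d n : ℕ} :
    n * (Finset.univ.filter fun ι : Fin d → Fin n => ¬ Function.Injective ι).card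
      ≤ d ^ 2 * n ^ d := by
  classical
  have : (Finset.univ.filter fun ι : Fin d → Fin n => ¬ Function.Injective ι)
      ⊆ Finset.univ.biUnion fun q : Fin d × Fin d =>
        Finset.univ.filter fun ι : Fin d → Fin n => q.1 ≠ q.2 ∧ ι q.1 = ι q.2 := by
    intro ι hι
    have hι' := (Finset.mem_filter.1 hι).2
    simp only [Function.Injective] at hι'
    push Not at hι'
    obtain ⟨a, b, h, hab⟩ := hι'
    simp only [Finset.mem_filter, Finset.mem_univ, true_and, Finset.mem_biUnion, Prod.exists]
    exact ⟨a, b, hab, h⟩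
  calc n * (Finset.univ.filter fun ι : Fin d → Fin n => ¬ Function.Injective ι).card
      ≤ n * ∑ q : Fin d × Fin d,
          (Finset.univ.filter fun ι : Fin d → Fin n => q.1 ≠ q.2 ∧ ι q.1 = ι q.2).card :=
        Nat.mul_le_mul_left _ ((Finset.card_le_card this).trans Finset.card_biUnion_le)
    _ = ∑ q : Fin d × Fin d,
          n * (Finset.univ.filter fun ι : Fin d → Fin n => q.1 ≠ q.2 ∧ ι q.1 = ι q.2).card := by
        rw [Finset.mul_sum]
    _ ≤ ∑ _q : Fin d × Fin d, n ^ d := by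
        refine Finset.sum_le_sum fun q _ => card_mul_le_pow q.1 _ fun ι hι κ hκ h => ?_
        simp only [Finset.mem_filter, Finset.mem_univ, true_and] at hι hκ
        funext b
        by_cases hb : b = q.1
        · rw [hb, hι.2, hκ.2, h _ hι.1.symm]
        · exact h b hb
    _ = d ^ 2 * n ^ d := by simp [sq]

variable {H : Type*} [NormedAddCommGroup H] [InnerProductSpace ℝ H]

/-- The mean of `v` over the sample minus its mean over all points that take their coordinates from
arbitrary, possibly different, sample points. With `v` a vector of tensor products, the second
mean is the vector of the products of the coordinatewise empirical means. -/
noncomputable def empDiff {d n : ℕ} (v : (Fin d → ℝ) → H) (X : Fin n → Fin d → ℝ) : H :=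
  (n : ℝ)⁻¹ • ∑ i, v (X i) - ((n : ℝ) ^ d)⁻¹ • ∑ ι : Fin d → Fin n, v fun ℓ => X (ι ℓ) ℓ

/-- The population version of `empDiff`: the coordinates in the second term come from
independent copies. -/
noncomputable def popDiff {d : ℕ} (μ : Measure (Fin d → ℝ)) (v : (Fin d → ℝ) → H) : H :=
  ∫ x, v x ∂μ - ∫ Y : Fin d → Fin d → ℝ, v (fun ℓ => Y ℓ ℓ) ∂(Measure.pi fun _ => μ)

lemma measurable_mix {d n : ℕ} (ι : Fin d → Fin n) :
    Measurable fun X : Fin n → Fin d → ℝ => fun ℓ => X (ι ℓ) ℓ :=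
  measurable_pi_lambda _ fun ℓ => (measurable_pi_apply ℓ).comp (measurable_pi_apply (ι ℓ))

lemma stronglyMeasurable_empDiff {d n : ℕ} {v : (Fin d → ℝ) → H} (hv : StronglyMeasurable v) :
    StronglyMeasurable (empDiff (n := n) v) := by
  unfold empDiff
  refine ((Finset.stronglyMeasurable_fun_sum _ fun i _ =>
    hv.comp_measurable (measurable_pi_apply i)).const_smul _).sub
    ((Finset.stronglyMeasurable_fun_sum _ fun ι _ =>
    hv.comp_measurable (measurable_mix ι)).const_smul _)

/-- Replacing one sample point affects a proportion at most `d / n` of the index maps. -/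
lemma norm_empDiff_update_le {d n : ℕ} {v : (Fin d → ℝ) → H} {c : ℝ} (hc : ∀ x, ‖v x‖ ≤ c)
    (X : Fin n → Fin d → ℝ) (i : Fin n) (y : Fin d → ℝ) :
    ‖empDiff v (Function.update X i y) - empDiff v X‖ ≤ 2 * (d + 1) * c / n := by
  classical
  have hn : 0 < (n : ℝ) := Nat.cast_pos.2 i.pos
  have hc0 : 0 ≤ c := (norm_nonneg _).trans (hc 0)
  set X' := Function.update X i y
  have h2 : ∀ x z, ‖v x - v z‖ ≤ 2 * c := fun x z =>
    (norm_sub_le _ _).trans (by linarith [hc x, hc z])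
  have e : empDiff v X' - empDiff v X
      = (n : ℝ)⁻¹ • ∑ k, (v (X' k) - v (X k))
        - ((n : ℝ) ^ d)⁻¹ • ∑ ι : Fin d → Fin n,
            (v (fun ℓ => X' (ι ℓ) ℓ) - v fun ℓ => X (ι ℓ) ℓ) := by
    unfold empDiff
    simp only [Finset.sum_sub_distrib, smul_sub]
    abel
  have h1 : ‖∑ k, (v (X' k) - v (X k))‖ ≤ 2 * c := by
    rw [Finset.sum_eq_single i]
    · exact h2 _ _
    · intro k _ hk; simp [X', hk]
    · simp
  have h3 : ‖∑ ι : Fin d → Fin n, (v (fun ℓ => X' (ι ℓ) ℓ) - v fun ℓ => X (ι ℓ) ℓ)‖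
      ≤ (Finset.univ.filter fun ι : Fin d → Fin n => ∃ a, ι a = i).card * (2 * c) := by
    rw [← Finset.sum_filter_of_ne (p := fun ι : Fin d → Fin n => ∃ a, ι a = i)]
    · refine (norm_sum_le_of_le _ fun ι _ => h2 _ _).trans (by simp)
    · intro ι _ hne
      by_contra hno
      push Not at hno
      exact hne (by simp [X', hno])
  have hcard : ((Finset.univ.filter fun ι : Fin d → Fin n => ∃ a, ι a = i).card : ℝ)
      ≤ d * (n : ℝ) ^ d / n := by
    rw [le_div_iff₀ hn, mul_comm]
    exact_mod_cast card_hitting_le i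
  rw [e]
  refine (norm_sub_le _ _).trans ?_
  rw [norm_smul, norm_smul, Real.norm_of_nonneg (by positivity), Real.norm_of_nonneg (by positivity)]
  have h3' := h3.trans (mul_le_mul_of_nonneg_right hcard (by positivity))
  calc (n : ℝ)⁻¹ * _ + ((n : ℝ) ^ d)⁻¹ * _
      ≤ (n : ℝ)⁻¹ * (2 * c) + ((n : ℝ) ^ d)⁻¹ * (d * (n : ℝ) ^ d / n * (2 * c)) := by gcongr
    _ = 2 * (d + 1) * c / n := by field_simp; ring

/-- Distinct members of an i.i.d. sample form an i.i.d. sample. -/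
lemma measurePreserving_comp_injective {Ω : Type*} [MeasurableSpace Ω] (μ : Measure Ω)
    [IsProbabilityMeasure μ] {d n : ℕ} {ι : Fin d → Fin n} (hι : Function.Injective ι) :
    MeasurePreserving (fun X : Fin n → Ω => fun ℓ => X (ι ℓ))
      (Measure.pi fun _ => μ) (Measure.pi fun _ => μ) := by
  refine ⟨measurable_pi_lambda _ fun ℓ => measurable_pi_apply _, ?_⟩
  have h := ProbabilityTheory.iIndepFun_pi (μ := fun _ : Fin n => μ)
    (X := fun _ => (id : Ω → Ω)) (fun _ => aemeasurable_id)
  have h2 := (ProbabilityTheory.iIndepFun_iff_map_fun_eq_pi_map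
    (f := fun (ℓ : Fin d) (ω : Fin n → Ω) => id (ω (ι ℓ)))
    (fun ℓ => (measurable_pi_apply (ι ℓ)).aemeasurable)).1 (h.precomp hι)
  simp only [id] at h2
  rw [h2]
  congr 1
  funext ℓ
  exact (measurePreserving_eval (fun _ : Fin n => μ) (ι ℓ)).map_eq

/-- The bias of `empDiff`: injective index maps contribute the population value exactly, and a
proportion at most `d² / n` of the index maps is not injective. -/
lemma norm_integral_empDiff_sub_popDiff_le [CompleteSpace H] {d n : ℕ} (hn : 1 ≤ n) (μ : Measure (Fin d → ℝ))
    [IsProbabilityMeasure μ] {v : (Fin d → ℝ) → H} {c : ℝ} (hv : StronglyMeasurable v)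
    (hc : ∀ x, ‖v x‖ ≤ c) :
    ‖∫ X, empDiff (n := n) v X ∂(Measure.pi fun _ => μ) - popDiff μ v‖ ≤ 2 * d ^ 2 * c / n := by
  classical
  have hn' : 0 < (n : ℝ) := Nat.cast_pos.2 hn
  have hc0 : 0 ≤ c := (norm_nonneg _).trans (hc 0)
  have hi1 : ∀ i : Fin n, Integrable (fun X : Fin n → Fin d → ℝ => v (X i))
      (Measure.pi fun _ => μ) := fun i =>
    Integrable.of_bound (hv.comp_measurable (measurable_pi_apply i)).aestronglyMeasurable c
      (ae_of_all _ fun _ => hc _)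
  have hi2 : ∀ ι : Fin d → Fin n, Integrable
      (fun X : Fin n → Fin d → ℝ => v fun ℓ => X (ι ℓ) ℓ) (Measure.pi fun _ => μ) := fun ι =>
    Integrable.of_bound (hv.comp_measurable (measurable_mix ι)).aestronglyMeasurable c
      (ae_of_all _ fun _ => hc _)
  set θ : H := ∫ Y : Fin d → Fin d → ℝ, v (fun ℓ => Y ℓ ℓ) ∂(Measure.pi fun _ => μ)
  have hθ : ‖θ‖ ≤ c := by
    simpa using norm_integral_le_of_norm_le_const (μ := Measure.pi fun _ : Fin d => μ)
        (ae_of_all _ fun Y : Fin d → Fin d → ℝ => hc fun ℓ => Y ℓ ℓ)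
  have e1 : ∀ i : Fin n, ∫ X : Fin n → Fin d → ℝ, v (X i) ∂(Measure.pi fun _ => μ)
      = ∫ x, v x ∂μ := fun i => by
    have hmp := measurePreserving_eval (fun _ : Fin n => μ) i
    have h := integral_map (μ := Measure.pi fun _ : Fin n => μ) hmp.measurable.aemeasurable
      (hv.aestronglyMeasurable (μ := (Measure.pi fun _ : Fin n => μ).map (Function.eval i)))
    rw [hmp.map_eq] at h
    exact h.symm
  set t : (Fin d → Fin n) → H := fun ι =>
    ∫ X : Fin n → Fin d → ℝ, v (fun ℓ => X (ι ℓ) ℓ) ∂(Measure.pi fun _ => μ)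
  have ht : ∀ ι, ‖t ι‖ ≤ c := fun ι => by
    simpa using norm_integral_le_of_norm_le_const (μ := Measure.pi fun _ : Fin n => μ)
        (ae_of_all _ fun X : Fin n → Fin d → ℝ => hc fun ℓ => X (ι ℓ) ℓ)
  have htinj : ∀ ι, Function.Injective ι → t ι = θ := fun ι hι => by
    have hmp := measurePreserving_comp_injective μ hι
    have h := integral_map (μ := Measure.pi fun _ : Fin n => μ)
      (f := fun Y : Fin d → Fin d → ℝ => v fun ℓ => Y ℓ ℓ) hmp.measurable.aemeasurable
      (hv.comp_measurable (measurable_mix (fun ℓ : Fin d => ℓ))).aestronglyMeasurable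
    rw [hmp.map_eq] at h
    exact h.symm
  have hE : ∫ X, empDiff (n := n) v X ∂(Measure.pi fun _ => μ) - popDiff μ v
      = -(((n : ℝ) ^ d)⁻¹ • ∑ ι : Fin d → Fin n, (t ι - θ)) := by
    unfold empDiff popDiff
    rw [integral_sub (f := fun X : Fin n → Fin d → ℝ => (n : ℝ)⁻¹ • ∑ i, v (X i))
      (g := fun X : Fin n → Fin d → ℝ =>
        ((n : ℝ) ^ d)⁻¹ • ∑ ι : Fin d → Fin n, v fun ℓ => X (ι ℓ) ℓ)
      ((integrable_finsetSum _ fun i _ => hi1 i).smul _)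
      ((integrable_finsetSum _ fun ι _ => hi2 ι).smul _), integral_smul, integral_smul,
      integral_finsetSum _ fun i _ => hi1 i, integral_finsetSum _ fun ι _ => hi2 ι]
    simp only [e1, Finset.sum_const, Finset.card_univ, Fintype.card_fin, Finset.sum_sub_distrib,
      Fintype.card_fun, smul_sub]
    rw [← Nat.cast_smul_eq_nsmul ℝ, smul_smul, inv_mul_cancel₀ hn'.ne', one_smul,
      ← Nat.cast_smul_eq_nsmul ℝ, smul_smul, Nat.cast_pow,
      inv_mul_cancel₀ (pow_ne_zero _ hn'.ne'), one_smul]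
    abel
  rw [hE, norm_neg, norm_smul, Real.norm_of_nonneg (by positivity)]
  have hsum : ‖∑ ι : Fin d → Fin n, (t ι - θ)‖
      ≤ (Finset.univ.filter fun ι : Fin d → Fin n => ¬ Function.Injective ι).card * (2 * c) := by
    rw [← Finset.sum_filter_of_ne (p := fun ι : Fin d → Fin n => ¬ Function.Injective ι)]
    · refine (norm_sum_le_of_le _ fun ι _ => (norm_sub_le _ _).trans
        (by linarith [ht ι] : _ ≤ 2 * c)).trans (by simp)
    · intro ι _ hne hinj
      exact hne (by rw [htinj ι hinj, sub_self])
  have hcard : ((Finset.univ.filter fun ι : Fin d → Fin n => ¬ Function.Injective ι).card : ℝ)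
      ≤ d ^ 2 * (n : ℝ) ^ d / n := by
    rw [le_div_iff₀ hn', mul_comm]
    exact_mod_cast card_not_injective_le (d := d) (n := n)
  have h' := hsum.trans (mul_le_mul_of_nonneg_right hcard (by positivity))
  calc ((n : ℝ) ^ d)⁻¹ * _ ≤ ((n : ℝ) ^ d)⁻¹ * (d ^ 2 * (n : ℝ) ^ d / n * (2 * c)) := by gcongr
    _ = 2 * d ^ 2 * c / n := by field_simp

lemma norm_empDiff_le {d n : ℕ} {v : (Fin d → ℝ) → H} {c : ℝ} (hc : ∀ x, ‖v x‖ ≤ c)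
    (X : Fin n → Fin d → ℝ) : ‖empDiff v X‖ ≤ 2 * c := by
  have hc0 : 0 ≤ c := (norm_nonneg _).trans (hc 0)
  unfold empDiff
  refine (norm_sub_le _ _).trans ?_
  rw [norm_smul, norm_smul, Real.norm_of_nonneg (by positivity), Real.norm_of_nonneg (by positivity)]
  have h1 : ‖∑ i, v (X i)‖ ≤ n * c := (norm_sum_le_of_le _ fun i _ => hc _).trans (by simp)
  have h2 : ‖∑ ι : Fin d → Fin n, v fun ℓ => X (ι ℓ) ℓ‖ ≤ (n : ℝ) ^ d * c :=
    (norm_sum_le_of_le _ fun i _ => hc _).trans (by simp)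
  have h1' : (n : ℝ)⁻¹ * ‖∑ i, v (X i)‖ ≤ c := by
    refine (mul_le_mul_of_nonneg_left h1 (by positivity)).trans ?_
    rw [← mul_assoc]
    exact mul_le_of_le_one_left hc0 inv_mul_le_one
  have h2' : ((n : ℝ) ^ d)⁻¹ * ‖∑ ι : Fin d → Fin n, v fun ℓ => X (ι ℓ) ℓ‖ ≤ c := by
    refine (mul_le_mul_of_nonneg_left h2 (by positivity)).trans ?_
    rw [← mul_assoc]
    exact mul_le_of_le_one_left hc0 inv_mul_le_one
  linarith

/-- Second and fourth moments of the deviation of `empDiff` from `popDiff`, for a vector function `v`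
bounded by `c`: they are of the order of `(c / √n)²` and `(c / √n)⁴`, as the bias is of the smaller
order `c / n`. -/
theorem empDiff_moments [CompleteSpace H] {d n : ℕ} (hn : 1 ≤ n) (μ : Measure (Fin d → ℝ))
    [IsProbabilityMeasure μ] {v : (Fin d → ℝ) → H} {c : ℝ} (hv : StronglyMeasurable v)
    (hc : ∀ x, ‖v x‖ ≤ c) :
    (∫ X, ‖empDiff (n := n) v X - popDiff μ v‖ ^ 2 ∂(Measure.pi fun _ => μ)
      ≤ 16 * (d + 1) ^ 4 * c ^ 2 / n) ∧
    (∫ X, ‖empDiff (n := n) v X - popDiff μ v‖ ^ 4 ∂(Measure.pi fun _ => μ)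
      ≤ 1024 * (d + 1) ^ 8 * c ^ 4 / n ^ 2) := by
  have hn1 : (1 : ℝ) ≤ n := Nat.one_le_cast.2 hn
  have hn' : 0 < (n : ℝ) := Nat.cast_pos.2 hn
  have hc0 : 0 ≤ c := (norm_nonneg _).trans (hc 0)
  have hTm := stronglyMeasurable_empDiff (n := n) hv
  obtain ⟨h2, h4⟩ := bounded_differences_moments μ n hTm (norm_empDiff_le hc)
    (norm_empDiff_update_le hc)
  have hb := norm_integral_empDiff_sub_popDiff_le hn μ hv hc
  set m := ∫ X, empDiff (n := n) v X ∂(Measure.pi fun _ => μ)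
  set θ := popDiff μ v
  have hmB : ‖m‖ ≤ 2 * c := by
      simpa using norm_integral_le_of_norm_le_const (μ := Measure.pi fun _ : Fin n => μ)
        (ae_of_all _ fun X => norm_empDiff_le (n := n) hc X)
  have hi : ∀ k, Integrable (fun X => ‖empDiff v X - m‖ ^ k) (Measure.pi fun _ : Fin n => μ) :=
    fun k => Integrable.of_bound ((hTm.sub stronglyMeasurable_const).norm.pow k).aestronglyMeasurable
      ((4 * c) ^ k) (ae_of_all _ fun X => by
        rw [norm_pow, norm_norm]
        exact pow_le_pow_left₀ (norm_nonneg _)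
          ((norm_sub_le _ _).trans (by linarith [norm_empDiff_le hc X])) k)
  have ht : ∀ X : Fin n → Fin d → ℝ, ‖empDiff v X - θ‖ ≤ ‖empDiff v X - m‖ + ‖m - θ‖ :=
    fun X => norm_sub_le_norm_sub_add_norm_sub _ _ _
  have hd : (0 : ℝ) ≤ d := Nat.cast_nonneg d
  set b := 2 * (d : ℝ) ^ 2 * c / n with hbdef
  have hb0 : 0 ≤ b := by positivity
  have e2 : ∀ x y : ℝ, (x + y) ^ 2 ≤ 2 * x ^ 2 + 2 * y ^ 2 := fun x y => by
    nlinarith [sq_nonneg (x - y)]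
  have e4 : ∀ x y : ℝ, (x + y) ^ 4 ≤ 8 * x ^ 4 + 8 * y ^ 4 := fun x y => by
    nlinarith [e2 x y, e2 (x ^ 2) (y ^ 2), sq_nonneg (x + y),
      pow_le_pow_left₀ (sq_nonneg (x + y)) (e2 x y) 2]
  constructor
  · have hle : ∀ X : Fin n → Fin d → ℝ, ‖empDiff v X - θ‖ ^ 2
        ≤ 2 * ‖empDiff v X - m‖ ^ 2 + 2 * b ^ 2 := fun X => by
      refine (pow_le_pow_left₀ (norm_nonneg _) (ht X) 2).trans ((e2 _ _).trans ?_)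
      have := pow_le_pow_left₀ (norm_nonneg _) hb 2
      linarith
    refine (integral_mono_of_nonneg (ae_of_all _ fun _ => by positivity)
      (((hi 2).const_mul 2).add (integrable_const (2 * b ^ 2))) (ae_of_all _ hle)).trans ?_
    simp only [Pi.add_apply]
    rw [integral_add ((hi 2).const_mul 2) (integrable_const _), integral_const_mul]
    simp only [integral_const, probReal_univ, smul_eq_mul, one_mul]
    have hb2 : b ^ 2 ≤ 4 * (d : ℝ) ^ 4 * c ^ 2 / n := by
      rw [hbdef, div_pow, div_le_div_iff₀ (by positivity) hn']
      have : (n : ℝ) ≤ n ^ 2 := by nlinarith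
      nlinarith [mul_le_mul_of_nonneg_left this (by positivity : 0 ≤ 4 * (d : ℝ) ^ 4 * c ^ 2)]
    have h2' : (n : ℝ) * (2 * (d + 1) * c / n) ^ 2 = 4 * (d + 1) ^ 2 * c ^ 2 / n := by
      field_simp; ring
    rw [h2'] at h2
    have : 2 * (4 * (d + 1) ^ 2 * c ^ 2 / n) + 2 * (4 * (d : ℝ) ^ 4 * c ^ 2 / n)
        = (8 * (d + 1) ^ 2 + 8 * (d : ℝ) ^ 4) * c ^ 2 / n := by ring
    have hcoef : 8 * ((d : ℝ) + 1) ^ 2 + 8 * (d : ℝ) ^ 4 ≤ 16 * ((d : ℝ) + 1) ^ 4 := by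
      have h1 : ((d : ℝ) + 1) ^ 2 ≤ ((d : ℝ) + 1) ^ 4 :=
        pow_le_pow_right₀ (by linarith) (by norm_num)
      have h3 : (d : ℝ) ^ 4 ≤ ((d : ℝ) + 1) ^ 4 := pow_le_pow_left₀ hd (by linarith) 4
      linarith
    calc _ ≤ (8 * ((d : ℝ) + 1) ^ 2 + 8 * (d : ℝ) ^ 4) * c ^ 2 / n := by linarith
      _ ≤ _ := by gcongr
  · have hle : ∀ X : Fin n → Fin d → ℝ, ‖empDiff v X - θ‖ ^ 4
        ≤ 8 * ‖empDiff v X - m‖ ^ 4 + 8 * b ^ 4 := fun X => by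
      refine (pow_le_pow_left₀ (norm_nonneg _) (ht X) 4).trans ((e4 _ _).trans ?_)
      have := pow_le_pow_left₀ (norm_nonneg _) hb 4
      linarith
    refine (integral_mono_of_nonneg (ae_of_all _ fun _ => by positivity)
      (((hi 4).const_mul 8).add (integrable_const (8 * b ^ 4))) (ae_of_all _ hle)).trans ?_
    simp only [Pi.add_apply]
    rw [integral_add ((hi 4).const_mul 8) (integrable_const _), integral_const_mul]
    simp only [integral_const, probReal_univ, smul_eq_mul, one_mul]
    have hb2 : b ^ 4 ≤ 16 * (d : ℝ) ^ 8 * c ^ 4 / n ^ 2 := by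
      rw [hbdef, div_pow, div_le_div_iff₀ (by positivity) (by positivity)]
      have : (n : ℝ) ^ 2 ≤ n ^ 4 := pow_le_pow_right₀ hn1 (by norm_num)
      nlinarith [mul_le_mul_of_nonneg_left this (by positivity : 0 ≤ 16 * (d : ℝ) ^ 8 * c ^ 4)]
    have h4' : 7 * (n : ℝ) ^ 2 * (2 * (d + 1) * c / n) ^ 4 = 112 * (d + 1) ^ 4 * c ^ 4 / n ^ 2 := by
      field_simp; ring
    rw [h4'] at h4
    have : 8 * (112 * (d + 1) ^ 4 * c ^ 4 / n ^ 2) + 8 * (16 * (d : ℝ) ^ 8 * c ^ 4 / n ^ 2)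
        = (896 * (d + 1) ^ 4 + 128 * (d : ℝ) ^ 8) * c ^ 4 / n ^ 2 := by ring
    have hcoef : 896 * ((d : ℝ) + 1) ^ 4 + 128 * (d : ℝ) ^ 8 ≤ 1024 * ((d : ℝ) + 1) ^ 8 := by
      have h1 : ((d : ℝ) + 1) ^ 4 ≤ ((d : ℝ) + 1) ^ 8 :=
        pow_le_pow_right₀ (by linarith) (by norm_num)
      have h3 : (d : ℝ) ^ 8 ≤ ((d : ℝ) + 1) ^ 8 := pow_le_pow_left₀ hd (by linarith) 8
      linarith
    calc _ ≤ (896 * ((d : ℝ) + 1) ^ 4 + 128 * (d : ℝ) ^ 8) * c ^ 4 / n ^ 2 := by linarith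
      _ ≤ _ := by gcongr

end Empirical

/-! ### Finite orthonormal expansions -/

section HilbertGeneral

variable {E : Type*} [NormedAddCommGroup E] [InnerProductSpace ℝ E]

lemma inner_eq_zero_of_mem_topologicalClosure {S : Set E} {u w : E}
    (hw : w ∈ (Submodule.span ℝ S).topologicalClosure) (hu : ∀ e ∈ S, inner ℝ e u = 0) :
    inner ℝ w u = 0 := by
  have hle : (Submodule.span ℝ S).topologicalClosure ≤ (Submodule.span ℝ {u})ᗮ := by
    refine Submodule.topologicalClosure_minimal _ (Submodule.span_le.2 fun e he => ?_)
      (Submodule.isClosed_orthogonal _)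
    rw [SetLike.mem_coe, Submodule.mem_orthogonal_singleton_iff_inner_right, real_inner_comm]
    exact hu e he
  have := hle hw
  rw [Submodule.mem_orthogonal_singleton_iff_inner_right, real_inner_comm] at this
  exact this

lemma Orthonormal.eq_sum_of_mem_closure {ι : Type*} {e : ι → E} (he : Orthonormal ℝ e) {u : E}
    (hu : u ∈ (Submodule.span ℝ (Set.range e)).topologicalClosure) (F : Finset ι)
    (hF : ∀ k, k ∉ F → inner ℝ (e k) u = 0) :
    u = ∑ k ∈ F, inner ℝ (e k) u • e k := by
  classical
  set w := u - ∑ k ∈ F, inner ℝ (e k) u • e k with hw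
  have hwmem : w ∈ (Submodule.span ℝ (Set.range e)).topologicalClosure := by
    refine Submodule.sub_mem _ hu (Submodule.sum_mem _ fun k _ => Submodule.smul_mem _ _ ?_)
    exact Submodule.le_topologicalClosure _ (Submodule.subset_span ⟨k, rfl⟩)
  have horth : ∀ k, inner ℝ (e k) w = 0 := fun k => by
    rw [hw, inner_sub_right, inner_sum]
    simp only [inner_smul_right, orthonormal_iff_ite.1 he]
    by_cases hk : k ∈ F
    · simp [hk]
    · simp [hk, hF k hk]
  have h0 : inner ℝ w w = 0 :=
    inner_eq_zero_of_mem_topologicalClosure hwmem (by rintro _ ⟨k, rfl⟩; exact horth k)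
  rw [inner_self_eq_zero, hw, sub_eq_zero] at h0
  exact h0

lemma Orthonormal.norm_sq_eq_sum_of_mem_closure {ι : Type*} {e : ι → E} (he : Orthonormal ℝ e)
    {u : E} (hu : u ∈ (Submodule.span ℝ (Set.range e)).topologicalClosure) (F : Finset ι)
    (hF : ∀ k, k ∉ F → inner ℝ (e k) u = 0) :
    ‖u‖ ^ 2 = ∑ k ∈ F, inner ℝ (e k) u ^ 2 := by
  have h := he.eq_sum_of_mem_closure hu F hF
  rw [← real_inner_self_eq_norm_sq]
  nth_rewrite 1 [h]
  rw [sum_inner]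
  simp only [inner_smul_left, sq]
  rfl

end HilbertGeneral

/-! ### Summation by parts on `ℤ` -/

section Differences

/-- A finite linear form in the values of a sequence is its total weight times the value at `0`,
up to a finite linear form in the first differences. -/
lemma exists_linearCombination_fwdDiff (ρ : ℤ →₀ ℝ) :
    ∃ b : ℤ →₀ ℝ, ∀ a : ℤ → ℝ, Finsupp.linearCombination ℝ a ρ
      = Finsupp.linearCombination ℝ (fun _ => (1 : ℝ)) ρ * a 0
        + Finsupp.linearCombination ℝ (fwdDiff 1 a) b := by
  induction ρ using Finsupp.induction_linear with
  | zero => exact ⟨0, fun a => by rw [map_zero, map_zero, map_zero, zero_mul, zero_add]⟩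
  | add f g hf hg =>
    obtain ⟨b, hb⟩ := hf
    obtain ⟨b', hb'⟩ := hg
    exact ⟨b + b', fun a => by rw [map_add, map_add, map_add, hb a, hb' a]; ring⟩
  | single n c =>
    suffices h : ∃ b : ℤ →₀ ℝ, ∀ a : ℤ → ℝ,
        a n = a 0 + Finsupp.linearCombination ℝ (fwdDiff 1 a) b by
      obtain ⟨b, hb⟩ := h
      refine ⟨c • b, fun a => ?_⟩
      simp only [Finsupp.linearCombination_single, map_smul, smul_eq_mul, mul_one]
      rw [hb a]; ring
    induction n using Int.induction_on with
    | zero => exact ⟨0, by simp⟩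
    | succ n ih =>
      obtain ⟨b, hb⟩ := ih
      refine ⟨b + Finsupp.single (n : ℤ) 1, fun a => ?_⟩
      rw [map_add, Finsupp.linearCombination_single, fwdDiff, ← add_assoc, ← hb a]
      simp
    | pred n ih =>
      obtain ⟨b, hb⟩ := ih
      refine ⟨b - Finsupp.single (-(n : ℤ) - 1) 1, fun a => ?_⟩
      rw [map_sub, Finsupp.linearCombination_single, fwdDiff, ← add_sub_assoc, ← hb a]
      simp

/-- Mean value form of an iterated difference. -/
lemma exists_fwdDiff_iter_eq {ε : ℝ} (hε : 0 < ε) (i : ℕ) :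
    ∀ {f : ℝ → ℝ}, ContDiff ℝ i f → ∀ x, ∃ ξ ∈ Set.Icc x (x + i * ε),
      (fwdDiff ε)^[i] f x = ε ^ i * iteratedDeriv i f ξ := by
  induction i with
  | zero => intro f _ x; exact ⟨x, by simp⟩
  | succ i ih =>
    intro f hf x
    have hfi : ContDiff ℝ i f := hf.of_le (by exact_mod_cast Nat.le_succ i)
    have hsh : ContDiff ℝ i fun y => f (y + ε) := hfi.comp (contDiff_id.add contDiff_const)
    have hd : ContDiff ℝ i (fwdDiff ε f) := hsh.sub hfi
    obtain ⟨ξ, hξ, h⟩ := ih hd x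
    have hit : iteratedDeriv i (fwdDiff ε f) ξ
        = iteratedDeriv i f (ξ + ε) - iteratedDeriv i f ξ := by
      have : fwdDiff ε f = (fun y => f (y + ε)) - f := rfl
      rw [this, iteratedDeriv_sub hsh.contDiffAt hfi.contDiffAt, iteratedDeriv_comp_add_const]
    have hdiff : Differentiable ℝ (iteratedDeriv i f) :=
      hf.differentiable_iteratedDeriv i (by exact_mod_cast Nat.lt_succ_self i)
    obtain ⟨η, hη, hη'⟩ := exists_deriv_eq_slope (iteratedDeriv i f) (by linarith : ξ < ξ + ε)
      hdiff.continuous.continuousOn hdiff.differentiableOn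
    refine ⟨η, ⟨by linarith [hη.1, hξ.1], ?_⟩, ?_⟩
    · push_cast; linarith [hη.2, hξ.2]
    · rw [Function.iterate_succ_apply, h, hit, iteratedDeriv_succ, hη',
        add_sub_cancel_left, pow_succ]
      field_simp

end Differences

/-! ### Scaling functions on the line -/

section Scaling

namespace WaveletICA

variable {r : ℕ} {φ : ℝ → ℝ}

lemma scaled_zero_int (k : ℤ) (x : ℝ) : scaled φ 0 k x = φ (x - k) := by simp [scaled]

lemma rpow_half_mul_self (j : ℤ) :
    (2 : ℝ) ^ ((j : ℝ) / 2) * (2 : ℝ) ^ ((j : ℝ) / 2) = (2 : ℝ) ^ j := by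
  rw [← Real.rpow_add two_pos, add_halves, Real.rpow_intCast]

lemma continuous_scaled (hφ : Continuous φ) (j k : ℤ) : Continuous (scaled φ j k) := by
  unfold scaled; fun_prop

/-- `φ` vanishes outside `[-L, L]` for some integer `L ≥ 1`. -/
lemma exists_support_bound (hφ : HasCompactSupport φ) :
    ∃ L : ℕ, 1 ≤ L ∧ ∀ x, φ x ≠ 0 → |x| ≤ L := by
  obtain ⟨R, hR⟩ := hφ.isCompact.isBounded.exists_norm_le
  refine ⟨⌈R⌉₊ + 1, by omega, fun x hx => (hR x (subset_tsupport _ hx)).trans ?_⟩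
  push_cast
  linarith [Nat.le_ceil R]

lemma hasCompactSupport_scaled (hφ : HasCompactSupport φ) (j k : ℤ) :
    HasCompactSupport (scaled φ j k) := by
  obtain ⟨L, _, hL⟩ := exists_support_bound hφ
  have h2 : (0 : ℝ) < 2 ^ j := zpow_pos two_pos j
  refine HasCompactSupport.of_support_subset_isCompact
    (isCompact_Icc (a := ((k : ℝ) - L) / 2 ^ j) (b := ((k : ℝ) + L) / 2 ^ j)) fun x hx => ?_
  have := abs_le.1 (hL _ (right_ne_zero_of_mul (Function.mem_support.1 hx)))
  rw [Set.mem_Icc, div_le_iff₀ h2, le_div_iff₀ h2]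
  constructor <;> linarith

lemma memLp_scaled (hφ : Continuous φ) (hc : HasCompactSupport φ) (j k : ℤ) (p : ℝ≥0∞) :
    MemLp (scaled φ j k) p volume :=
  (continuous_scaled hφ j k).memLp_of_hasCompactSupport (hasCompactSupport_scaled hc j k)

lemma integral_scaled_mul_scaled (h : ∀ k l : ℤ, ∫ x : ℝ, φ (x - k) * φ (x - l) = if k = l then 1 else 0)
    (j k l : ℤ) : ∫ x, scaled φ j k x * scaled φ j l x = if k = l then 1 else 0 := by
  have h2 : (0 : ℝ) < 2 ^ j := zpow_pos two_pos j
  have e : ∀ x, scaled φ j k x * scaled φ j l x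
      = 2 ^ j * (fun y => φ (y - k) * φ (y - l)) (2 ^ j * x) := fun x => by
    simp only [scaled]; rw [← rpow_half_mul_self j]; ring
  rw [integral_congr_ae (ae_of_all _ e), integral_const_mul,
    Measure.integral_comp_mul_left (fun y => φ (y - k) * φ (y - l)), ← h k l, smul_eq_mul,
    abs_of_pos (inv_pos.2 h2), ← mul_assoc, mul_inv_cancel₀ h2.ne', one_mul]

namespace IsRegularScalingFunction

variable (hφ : IsRegularScalingFunction r φ)
include hφ

/-- `φ_{jk}` as an element of `L_2(ℝ)`. -/
noncomputable def scaledLp (j k : ℤ) : Lp ℝ 2 (volume : Measure ℝ) :=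
  (memLp_scaled hφ.contDiff.continuous hφ.hasCompactSupport j k 2).toLp _

lemma coeFn_scaledLp (j k : ℤ) : hφ.scaledLp j k =ᵐ[volume] scaled φ j k := MemLp.coeFn_toLp _

lemma approxSpace_eq (j : ℤ) : approxSpace φ j
    = (Submodule.span ℝ (Set.range (hφ.scaledLp j))).topologicalClosure := by
  unfold approxSpace
  congr 2
  ext u
  constructor
  · rintro ⟨k, hk⟩
    exact ⟨k, Lp.ext ((hφ.coeFn_scaledLp j k).trans hk.symm)⟩
  · rintro ⟨k, rfl⟩
    exact ⟨k, hφ.coeFn_scaledLp j k⟩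

lemma scaledLp_mem (j k : ℤ) : hφ.scaledLp j k ∈ approxSpace φ j := by
  rw [hφ.approxSpace_eq]
  exact Submodule.le_topologicalClosure _ (Submodule.subset_span ⟨k, rfl⟩)

lemma inner_scaledLp_toLp (j k : ℤ) {g : ℝ → ℝ} (hg : MemLp g 2 volume) :
    inner ℝ (hφ.scaledLp j k) (hg.toLp g) = ∫ x, g x * scaled φ j k x := by
  rw [L2.inner_def]
  refine integral_congr_ae ?_
  filter_upwards [hφ.coeFn_scaledLp j k, hg.coeFn_toLp] with x h1 h2
  rw [h1, h2]
  simp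

lemma inner_scaledLp (i j k l : ℤ) : inner ℝ (hφ.scaledLp i k) (hφ.scaledLp j l)
    = ∫ x, scaled φ j l x * scaled φ i k x :=
  hφ.inner_scaledLp_toLp i k _

lemma orthonormal_scaledLp (j : ℤ) : Orthonormal ℝ (hφ.scaledLp j) := by
  rw [orthonormal_iff_ite]
  intro k l
  rw [hφ.inner_scaledLp, integral_scaled_mul_scaled hφ.orthonormal]
  simp [eq_comm]

lemma approxSpace_mono {i j : ℤ} (h : i ≤ j) : approxSpace φ i ≤ approxSpace φ j :=
  monotone_int_of_le_succ (f := approxSpace φ) hφ.nested h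

/-- The refinement equation of a scaling function, with finitely many terms. -/
lemma refinement : ∃ h : ℤ →₀ ℝ, ∀ j k x, scaled φ j k x
    = Finsupp.linearCombination ℝ (fun n => scaled φ (j + 1) (2 * k + n) x) h := by
  classical
  obtain ⟨L, hL1, hL⟩ := exists_support_bound hφ.hasCompactSupport
  have hmem : hφ.scaledLp 0 0 ∈ (Submodule.span ℝ (Set.range (hφ.scaledLp 1))).topologicalClosure := by
    rw [← hφ.approxSpace_eq]
    exact hφ.approxSpace_mono zero_le_one (hφ.scaledLp_mem 0 0)
  set c : ℤ → ℝ := fun n => inner ℝ (hφ.scaledLp 1 n) (hφ.scaledLp 0 0) with hcdef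
  set F : Finset ℤ := Finset.Icc (-(3 * L : ℤ)) (3 * L) with hF
  have hc : ∀ n, n ∉ F → c n = 0 := fun n hn => by
    rw [hcdef]
    simp only
    rw [hφ.inner_scaledLp]
    refine integral_eq_zero_of_ae (ae_of_all _ fun x => ?_)
    by_contra hne
    simp only [Pi.zero_apply] at hne
    have h1 := hL _ (right_ne_zero_of_mul (left_ne_zero_of_mul hne))
    have h2 := hL _ (right_ne_zero_of_mul (right_ne_zero_of_mul hne))
    simp only [zpow_zero, one_mul, Int.cast_zero, sub_zero, zpow_one] at h1 h2
    rw [abs_le] at h1 h2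
    apply hn
    rw [hF, Finset.mem_Icc]
    constructor
    · have : (-(3 * L) : ℝ) ≤ n := by linarith [h1.1, h1.2, h2.1, h2.2]
      exact_mod_cast this
    · have : (n : ℝ) ≤ 3 * L := by linarith [h1.1, h1.2, h2.1, h2.2]
      exact_mod_cast this
  have hexp := (hφ.orthonormal_scaledLp 1).eq_sum_of_mem_closure hmem F hc
  have hae : scaled φ 0 0 =ᵐ[volume] fun x => ∑ n ∈ F, c n * scaled φ 1 n x := by
    have h1 : ⇑(∑ n ∈ F, c n • hφ.scaledLp 1 n)
        =ᵐ[volume] fun x => ∑ n ∈ F, c n * scaled φ 1 n x := by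
      refine (Lp.coeFn_finsetSum F _).trans ?_
      have : ∀ n ∈ F, ∀ᵐ x, (c n • hφ.scaledLp 1 n : Lp ℝ 2 (volume : Measure ℝ)) x
          = c n * scaled φ 1 n x := fun n _ => by
        filter_upwards [Lp.coeFn_smul (c n) (hφ.scaledLp 1 n), hφ.coeFn_scaledLp 1 n] with x h1 h2
        rw [h1, Pi.smul_apply, h2, smul_eq_mul]
      filter_upwards [(Finset.eventually_all F).2 this] with x hx
      rw [Finset.sum_apply]
      exact Finset.sum_congr rfl hx
    rw [← hexp] at h1
    exact (hφ.coeFn_scaledLp 0 0).symm.trans h1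
  have hcont := hφ.contDiff.continuous
  have hpt : scaled φ 0 0 = fun x => ∑ n ∈ F, c n * scaled φ 1 n x :=
    (Continuous.ae_eq_iff_eq volume (continuous_scaled hcont 0 0)
      (continuous_finsetSum _ fun n _ => (continuous_scaled hcont 1 n).const_mul _)).1 hae
  refine ⟨Finsupp.onFinset F c fun n hn => by_contra fun h => hn (hc n h), fun j k x => ?_⟩
  rw [Finsupp.linearCombination_apply, Finsupp.onFinset_sum _ fun a => by simp]
  have h0 := congrFun hpt (2 ^ j * x - k)
  have hs0 : scaled φ j k x = (2 : ℝ) ^ ((j : ℝ) / 2) * scaled φ 0 0 (2 ^ j * x - k) := by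
    simp [scaled]
  have hs1 : ∀ n, scaled φ (j + 1) (2 * k + n) x
      = (2 : ℝ) ^ ((j : ℝ) / 2) * scaled φ 1 n (2 ^ j * x - k) := fun n => by
    simp only [scaled]
    rw [← mul_assoc, ← Real.rpow_add two_pos, zpow_add₀ two_ne_zero]
    push_cast
    congr 2
    · ring
    · rw [zpow_one]; ring
  rw [hs0, h0, Finset.mul_sum]
  refine Finset.sum_congr rfl fun n _ => ?_
  rw [hs1, smul_eq_mul]; ring

end IsRegularScalingFunction

end WaveletICA

end Scaling

/-! ### Nonvanishing of the integral and of the derivatives -/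

section ScalingMoments

namespace WaveletICA

variable {r : ℕ} {φ : ℝ → ℝ}

namespace IsRegularScalingFunction

variable (hφ : IsRegularScalingFunction r φ)
include hφ

lemma norm_scaledLp (j k : ℤ) : ‖hφ.scaledLp j k‖ = 1 := (hφ.orthonormal_scaledLp j).1 k

/-- A scaling function has nonzero integral. If the integral vanished, then at scale `2^{-J}` each
of the `O(2^J)` nonzero coefficients of `φ` would be `O(2^{-3J/2})`, although the sum of their
squares is `‖φ‖_2^2 = 1`. -/
lemma integral_ne_zero (hr : 1 ≤ r) : ∫ x, φ x ≠ 0 := by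
  intro h0
  obtain ⟨L, hL1, hL⟩ := exists_support_bound hφ.hasCompactSupport
  have hcont := hφ.contDiff.continuous
  have hint : Integrable φ := hcont.integrable_of_hasCompactSupport hφ.hasCompactSupport
  obtain ⟨C, hC⟩ := ContDiff.lipschitzWith_of_hasCompactSupport hφ.hasCompactSupport hφ.contDiff
    (by exact_mod_cast (Nat.one_le_iff_ne_zero.1 hr))
  set I := ∫ x, ‖φ x‖ with hI
  set K : ℝ := C * L * I with hK
  have key : ∀ J : ℕ, (1 : ℝ) ≤ 8 * L * K ^ 2 * (1 / 4) ^ J := by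
    intro J
    have h2 : (0 : ℝ) < 2 ^ J := by positivity
    set F : Finset ℤ := Finset.Icc (-(2 ^ (J + 1) * L : ℤ)) (2 ^ (J + 1) * L) with hF
    have hmem : hφ.scaledLp 0 0
        ∈ (Submodule.span ℝ (Set.range (hφ.scaledLp (J : ℤ)))).topologicalClosure := by
      rw [← hφ.approxSpace_eq]
      exact hφ.approxSpace_mono (by positivity) (hφ.scaledLp_mem 0 0)
    have hc : ∀ n, n ∉ F → inner ℝ (hφ.scaledLp J n) (hφ.scaledLp 0 0) = 0 := fun n hn => by
      rw [hφ.inner_scaledLp]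
      refine integral_eq_zero_of_ae (ae_of_all _ fun x => ?_)
      by_contra hne
      simp only [Pi.zero_apply] at hne
      have h1 := hL _ (right_ne_zero_of_mul (left_ne_zero_of_mul hne))
      have h3 := hL _ (right_ne_zero_of_mul (right_ne_zero_of_mul hne))
      simp only [zpow_zero, one_mul, Int.cast_zero, sub_zero, zpow_natCast] at h1 h3
      apply hn
      rw [hF, Finset.mem_Icc, ← abs_le]
      have h4 : |(2 : ℝ) ^ J * x| ≤ 2 ^ J * L := by
        rw [abs_mul, abs_of_pos h2]; exact mul_le_mul_of_nonneg_left h1 h2.le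
      have h5 : |(n : ℝ)| ≤ 2 ^ (J + 1) * L := by
        have : (n : ℝ) = 2 ^ J * x - (2 ^ J * x - n) := by ring
        rw [this]
        have h6 : (L : ℝ) ≤ 2 ^ J * L :=
          le_mul_of_one_le_left (Nat.cast_nonneg L) (one_le_pow₀ one_le_two)
        calc |(2 : ℝ) ^ J * x - (2 ^ J * x - n)| ≤ |(2 : ℝ) ^ J * x| + |(2 : ℝ) ^ J * x - n| :=
            abs_sub _ _
          _ ≤ 2 ^ J * (L : ℝ) + L := add_le_add h4 h3
          _ ≤ 2 ^ (J + 1) * (L : ℝ) := by rw [pow_succ]; linarith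
      exact_mod_cast h5
    have hb : ∀ n, |inner ℝ (hφ.scaledLp J n) (hφ.scaledLp 0 0)|
        ≤ (2 : ℝ) ^ ((J : ℝ) / 2) * (K * (1 / 4) ^ J) := fun n => by
      rw [hφ.inner_scaledLp]
      have hg : Integrable (fun x => φ (2 ^ J * x - n)) :=
        (hint.comp_sub_right (n : ℝ)).comp_mul_left' h2.ne'
      have hz : ∫ x, φ (2 ^ J * x - n) = 0 := by
        rw [Measure.integral_comp_mul_left (fun y => φ (y - n)), integral_sub_right_eq_self, h0,
          smul_zero]
      have hn : ∫ x, ‖φ (2 ^ J * x - n)‖ = (2 ^ J)⁻¹ * I := by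
        rw [Measure.integral_comp_mul_left (fun y => ‖φ (y - n)‖),
          integral_sub_right_eq_self (fun y => ‖φ y‖), smul_eq_mul, abs_of_pos (inv_pos.2 h2)]
      have e : ∫ x, scaled φ 0 0 x * scaled φ J n x
          = ∫ x, (2 : ℝ) ^ ((J : ℝ) / 2) * ((φ x - φ (n / 2 ^ J)) * φ (2 ^ J * x - n)) := by
        have hi1 : Integrable fun x => φ x * φ (2 ^ J * x - n) := by
          obtain ⟨D, hD⟩ := hφ.hasCompactSupport.exists_bound_of_continuous hcont
          exact hg.bdd_mul hcont.aestronglyMeasurable (ae_of_all _ hD)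
        rw [integral_const_mul]
        simp only [sub_mul]
        rw [integral_sub hi1 (hg.const_mul _), integral_const_mul, hz, mul_zero, sub_zero,
          ← integral_const_mul]
        refine integral_congr_ae (ae_of_all _ fun x => ?_)
        simp [scaled]; ring
      rw [e, integral_const_mul, abs_mul, abs_of_pos (Real.rpow_pos_of_pos two_pos _)]
      refine mul_le_mul_of_nonneg_left ?_ (by positivity)
      rw [← Real.norm_eq_abs]
      refine (norm_integral_le_of_norm_le (hg.norm.const_mul (C * (L / 2 ^ J)))
        (ae_of_all _ fun x => ?_)).trans ?_
      · rw [norm_mul]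
        by_cases hx : φ (2 ^ J * x - n) = 0
        · simp [hx]
        refine mul_le_mul_of_nonneg_right ?_ (norm_nonneg _)
        have := hC.dist_le_mul x (n / 2 ^ J)
        rw [Real.dist_eq, Real.dist_eq] at this
        refine this.trans (mul_le_mul_of_nonneg_left ?_ C.2)
        have e2 : x - n / 2 ^ J = (2 ^ J * x - n) / 2 ^ J := by field_simp
        rw [e2, abs_div, abs_of_pos h2]
        exact div_le_div_of_nonneg_right (hL _ hx) h2.le
      · rw [integral_const_mul, hn, hK]
        have : (1 / 4 : ℝ) ^ J = (2 ^ J)⁻¹ * (2 ^ J)⁻¹ := by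
          rw [← mul_inv, ← mul_pow, one_div, inv_pow]; norm_num
        rw [this]
        exact le_of_eq (by ring)
    have hnorm := (hφ.orthonormal_scaledLp (J : ℤ)).norm_sq_eq_sum_of_mem_closure hmem F hc
    rw [hφ.norm_scaledLp, one_pow] at hnorm
    have hcard : (F.card : ℝ) ≤ 8 * L * 2 ^ J := by
      have : F.card = 2 * (2 ^ (J + 1) * L) + 1 := by
        rw [hF, Int.card_Icc]
        have : ((2 : ℤ) ^ (J + 1) * L + 1 - -(2 ^ (J + 1) * L))
          = ((2 * (2 ^ (J + 1) * L) + 1 : ℕ) : ℤ) := by push_cast; ring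
        rw [this, Int.toNat_natCast]
      rw [this]
      push_cast
      have h1 : (1 : ℝ) ≤ L := by exact_mod_cast hL1
      have h3 : (1 : ℝ) ≤ 2 ^ J := one_le_pow₀ one_le_two
      rw [pow_succ]
      nlinarith
    calc (1 : ℝ) = ∑ k ∈ F, inner ℝ (hφ.scaledLp J k) (hφ.scaledLp 0 0) ^ 2 := hnorm
      _ ≤ ∑ k ∈ F, ((2 : ℝ) ^ ((J : ℝ) / 2) * (K * (1 / 4) ^ J)) ^ 2 := by
          refine Finset.sum_le_sum fun k _ => ?_
          rw [← sq_abs]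
          exact pow_le_pow_left₀ (abs_nonneg _) (hb k) 2
      _ = F.card * (2 ^ J * (K * (1 / 4) ^ J) ^ 2) := by
          rw [Finset.sum_const, nsmul_eq_mul, mul_pow _ (K * _), sq ((2 : ℝ) ^ ((J : ℝ) / 2))]
          have := rpow_half_mul_self (J : ℤ)
          rw [Int.cast_natCast, zpow_natCast] at this
          rw [this]
      _ ≤ 8 * L * 2 ^ J * (2 ^ J * (K * (1 / 4) ^ J) ^ 2) :=
          mul_le_mul_of_nonneg_right hcard (by positivity)
      _ = 8 * L * K ^ 2 * (1 / 4) ^ J * (2 ^ J * 2 ^ J * (1 / 4) ^ J) := by ring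
      _ = 8 * L * K ^ 2 * (1 / 4) ^ J := by
          rw [← mul_pow, ← mul_pow]; norm_num
  have hlim : Tendsto (fun J : ℕ => 8 * L * K ^ 2 * (1 / 4 : ℝ) ^ J) atTop
      (nhds (8 * L * K ^ 2 * 0)) :=
    (tendsto_pow_atTop_nhds_zero_of_lt_one (by norm_num) (by norm_num)).const_mul _
  have := ge_of_tendsto' hlim key
  norm_num at this

/-- Some derivative value of order `i ≤ r` of `φ` at a dyadic point is nonzero: otherwise the
derivative of order `i` would vanish, and `φ`, having compact support, would be zero. -/
lemma exists_dyadic_iteratedDeriv_ne_zero {i : ℕ} (hi : i ≤ r) :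
    ∃ (k : ℤ) (J : ℕ), iteratedDeriv i φ (k / 2 ^ J) ≠ 0 := by
  have hne : ∀ i, i ≤ r → ∃ x, iteratedDeriv i φ x ≠ 0 := by
    intro i
    induction i with
    | zero =>
      intro _
      by_contra! h
      have h1 := hφ.orthonormal 0 0
      simp only [iteratedDeriv_zero] at h
      simp [h] at h1
    | succ i ih =>
      intro hir
      obtain ⟨x, hx⟩ := ih (by omega)
      by_contra! h
      have hd : Differentiable ℝ (iteratedDeriv i φ) :=
        hφ.contDiff.differentiable_iteratedDeriv i (by exact_mod_cast hir)
      have hconst := is_const_of_deriv_eq_zero hd (fun y => by rw [← iteratedDeriv_succ]; exact h y)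
      obtain ⟨L, hL1, hL⟩ := exists_support_bound hφ.hasCompactSupport
      have hev : φ =ᶠ[nhds ((L : ℝ) + 1)] fun _ => 0 := by
        filter_upwards [lt_mem_nhds (by linarith : (L : ℝ) < L + 1)] with y hy
        by_contra hne
        have := abs_le.1 (hL y hne)
        linarith [this.2]
      apply hx
      rw [hconst x (L + 1), hev.iteratedDeriv_eq]
      simp
  obtain ⟨x, hx⟩ := hne i hi
  have hcont : Continuous (iteratedDeriv i φ) :=
    hφ.contDiff.continuous_iteratedDeriv i (by exact_mod_cast hi)
  by_contra! h
  apply hx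
  have hlim : Tendsto (fun J : ℕ => ((⌊x * 2 ^ J⌋ : ℤ) : ℝ) / 2 ^ J) atTop (nhds x) := by
    have h1 : Tendsto (fun J : ℕ => x - (1 / 2 : ℝ) ^ J) atTop (nhds (x - 0)) :=
      (tendsto_pow_atTop_nhds_zero_of_lt_one (by norm_num) (by norm_num)).const_sub _
    rw [sub_zero] at h1
    refine tendsto_of_tendsto_of_tendsto_of_le_of_le h1 tendsto_const_nhds (fun J => ?_)
      (fun J => ?_)
    · have h2 : (0 : ℝ) < 2 ^ J := by positivity
      rw [le_div_iff₀ h2, sub_mul, ← mul_pow]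
      norm_num
      linarith [(Int.sub_one_lt_floor (x * 2 ^ J)).le]
    · have h2 : (0 : ℝ) < 2 ^ J := by positivity
      rw [div_le_iff₀ h2]
      exact Int.floor_le _
  exact tendsto_nhds_unique ((hcont.tendsto x).comp hlim)
    (tendsto_const_nhds.congr fun J => (h _ J).symm)

end IsRegularScalingFunction

end WaveletICA

end ScalingMoments

/-! ### Details as iterated differences -/

section Detail

namespace WaveletICA

variable {r : ℕ} {φ : ℝ → ℝ}

lemma integrable_mul_of_continuous (hc : Continuous φ) (hs : HasCompactSupport φ) {u : ℝ → ℝ}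
    (hu : Continuous u) : Integrable fun x => φ x * u x :=
  (hc.mul hu).integrable_of_hasCompactSupport hs.mul_right

lemma continuous_fwdDiff {u : ℝ → ℝ} (hu : Continuous u) (ε : ℝ) : Continuous (fwdDiff ε u) := by
  unfold fwdDiff; fun_prop

lemma continuous_fwdDiff_iter {u : ℝ → ℝ} (hu : Continuous u) (ε : ℝ) (i : ℕ) :
    Continuous ((fwdDiff ε)^[i] u) := by
  induction i generalizing u with
  | zero => exact hu
  | succ i ih => rw [Function.iterate_succ_apply]; exact ih (continuous_fwdDiff hu ε)

lemma fwdDiff_iter_integral_mul_comp (hc : Continuous φ) (hs : HasCompactSupport φ) (ε t : ℝ)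
    (i : ℕ) {u : ℝ → ℝ} (hu : Continuous u) :
    (fwdDiff (1 : ℤ))^[i] (fun n : ℤ => ∫ y, φ y * u (t + ε * (n + y)))
      = fun n : ℤ => ∫ y, φ y * ((fwdDiff ε)^[i] u) (t + ε * (n + y)) := by
  induction i generalizing u with
  | zero => rfl
  | succ i ih =>
    rw [Function.iterate_succ_apply, Function.iterate_succ_apply, ← ih (continuous_fwdDiff hu ε)]
    congr 1
    funext n
    rw [fwdDiff, ← integral_sub (integrable_mul_of_continuous hc hs (by fun_prop))
      (integrable_mul_of_continuous hc hs (by fun_prop))]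
    refine integral_congr_ae (ae_of_all _ fun y => ?_)
    simp only [fwdDiff, ← mul_sub]
    congr 3
    push_cast; ring

/-- Normalized iterated differences converge to the derivative, weakly against `φ`. -/
lemma tendsto_integral_mul_fwdDiff_iter (hc : Continuous φ) (hs : HasCompactSupport φ) {i : ℕ}
    {u : ℝ → ℝ} (hu : ContDiff ℝ i u) (hus : HasCompactSupport u) (t : ℝ) (n : ℤ) {ε : ℕ → ℝ}
    (hε : ∀ J, 0 < ε J) (hε0 : Tendsto ε atTop (nhds 0)) :
    Tendsto (fun J => (ε J ^ i)⁻¹ * ∫ y, φ y * ((fwdDiff (ε J))^[i] u) (t + ε J * (n + y))) atTop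
      (nhds ((∫ y, φ y) * iteratedDeriv i u t)) := by
  have hcu : Continuous (iteratedDeriv i u) := hu.continuous_iteratedDeriv i le_rfl
  have hsu : HasCompactSupport (iteratedDeriv i u) := by
    refine hus.of_isClosed_subset (isClosed_tsupport _) (closure_minimal ?_ (isClosed_tsupport _))
    intro x hx
    by_contra hnot
    have hev : u =ᶠ[nhds x] fun _ => 0 := by
      filter_upwards [(isClosed_tsupport u).isOpen_compl.mem_nhds hnot] with y hy
      exact image_eq_zero_of_notMem_tsupport hy
    exact hx (by rw [hev.iteratedDeriv_eq]; simp)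
  obtain ⟨D, hD⟩ := hsu.exists_bound_of_continuous hcu
  have hint : Integrable φ := hc.integrable_of_hasCompactSupport hs
  simp only [← integral_const_mul]
  rw [← integral_mul_const]
  refine tendsto_integral_of_dominated_convergence (fun y => ‖φ y‖ * D) (fun J => ?_)
    (hint.norm.mul_const D) (fun J => ae_of_all _ fun y => ?_) (ae_of_all _ fun y => ?_)
  · have := continuous_fwdDiff_iter hu.continuous (ε J) i
    exact (by fun_prop : Continuous fun y =>
      (ε J ^ i)⁻¹ * (φ y * ((fwdDiff (ε J))^[i] u) (t + ε J * (n + y)))).aestronglyMeasurable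
  · obtain ⟨ξ, _, h⟩ := exists_fwdDiff_iter_eq (hε J) i hu (t + ε J * (n + y))
    have hne := (pow_pos (hε J) i).ne'
    rw [h, show (ε J ^ i)⁻¹ * (φ y * (ε J ^ i * iteratedDeriv i u ξ)) = φ y * iteratedDeriv i u ξ by
      field_simp, norm_mul]
    exact mul_le_mul_of_nonneg_left (hD ξ) (norm_nonneg _)
  · choose ξ hξ h using fun J => exists_fwdDiff_iter_eq (hε J) i hu (t + ε J * (n + y))
    have hlow : Tendsto (fun J => t + ε J * (n + y)) atTop (nhds t) := by
      simpa using (hε0.mul_const ((n : ℝ) + y)).const_add t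
    have hup : Tendsto (fun J => t + ε J * (n + y) + i * ε J) atTop (nhds t) := by
      simpa using hlow.add (hε0.const_mul (i : ℝ))
    have hlim : Tendsto ξ atTop (nhds t) :=
      tendsto_of_tendsto_of_tendsto_of_le_of_le hlow hup (fun J => (hξ J).1) (fun J => (hξ J).2)
    refine (((hcu.tendsto t).comp hlim).const_mul (φ y)).congr fun J => ?_
    have hne := (pow_pos (hε J) i).ne'
    rw [h, Function.comp]
    field_simp

namespace IsRegularScalingFunction

variable (hφ : IsRegularScalingFunction r φ)
include hφ

/-- A function orthogonal to `V_0` is orthogonal to all translates of the dilates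
`φ(2^{-J} ·)`, `J ≥ 0`, by integers. -/
lemma integral_mul_dilate_eq_zero {w : ℝ → ℝ} (hw : MemLp w 2 volume)
    (h0 : ∀ k : ℤ, ∫ x, w x * scaled φ 0 k x = 0) (J : ℕ) (k : ℤ) :
    ∫ x, w x * φ ((k : ℝ) / 2 ^ J + x / 2 ^ J) = 0 := by
  have hmp := measurePreserving_sub_right (volume : Measure ℝ) (k : ℝ)
  have hwk : MemLp (fun x => w (x - k)) 2 volume := hw.comp_measurePreserving hmp
  have hmem : hφ.scaledLp (-J : ℤ) 0
      ∈ (Submodule.span ℝ (Set.range (hφ.scaledLp 0))).topologicalClosure := by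
    rw [← hφ.approxSpace_eq]
    exact hφ.approxSpace_mono (by simp) (hφ.scaledLp_mem _ 0)
  have h := inner_eq_zero_of_mem_topologicalClosure (u := hwk.toLp _) hmem (by
    rintro _ ⟨m, rfl⟩
    rw [hφ.inner_scaledLp_toLp, ← h0 (m - k),
      ← integral_sub_right_eq_self (fun x => w x * scaled φ 0 (m - k) x) (k : ℝ)]
    refine integral_congr_ae (ae_of_all _ fun x => ?_)
    simp only [scaled_zero_int]
    congr 2
    push_cast; ring)
  rw [hφ.inner_scaledLp_toLp] at h
  have e : ∀ x, w (x - k) * scaled φ (-J) 0 x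
      = (2 : ℝ) ^ (((-J : ℤ) : ℝ) / 2) * (w (x - k) * φ (k / 2 ^ J + (x - k) / 2 ^ J)) := fun x => by
    simp only [scaled, zpow_neg, zpow_natCast, Int.cast_zero, sub_zero]
    rw [show (k : ℝ) / 2 ^ J + (x - k) / 2 ^ J = (2 ^ J)⁻¹ * x by field_simp; ring]
    ring
  rw [integral_congr_ae (ae_of_all _ e), integral_const_mul,
    integral_sub_right_eq_self (fun x => w x * φ (k / 2 ^ J + x / 2 ^ J))] at h
  exact (mul_eq_zero.1 h).resolve_left (Real.rpow_pos_of_pos two_pos _).ne'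

/-- A finite combination of the `φ_{1n}` that is orthogonal to `V_0` factors through the iterated
difference of the `φ_{1n}` in `n`, of any order `N ≤ r`. Once a factor `Δ^i` has been split off,
orthogonality to the dilates of `φ` makes the total weight of the remaining combination,
multiplied by `φ^{(i)}(t) ∫ φ`, vanish at every dyadic `t`. -/
lemma exists_fwdDiff_factor (hr : 1 ≤ r) {ρ : ℤ →₀ ℝ}
    (h0 : ∀ k : ℤ, ∫ x, Finsupp.linearCombination ℝ (fun n => scaled φ 1 n x) ρ
      * scaled φ 0 k x = 0) (N : ℕ) (hN : N ≤ r) :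
    ∃ b : ℤ →₀ ℝ, ∀ a : ℤ → ℝ, Finsupp.linearCombination ℝ a ρ
      = Finsupp.linearCombination ℝ ((fwdDiff 1)^[N] a) b := by
  have hc := hφ.contDiff.continuous
  have hs := hφ.hasCompactSupport
  induction N with
  | zero => exact ⟨ρ, fun a => rfl⟩
  | succ i ih =>
    obtain ⟨b, hb⟩ := ih (by omega)
    suffices hsum : Finsupp.linearCombination ℝ (fun _ => (1 : ℝ)) b = 0 by
      obtain ⟨b', hb'⟩ := exists_linearCombination_fwdDiff b
      refine ⟨b', fun a => ?_⟩
      rw [hb, hb', hsum, zero_mul, zero_add, Function.iterate_succ_apply']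
    obtain ⟨k, J₀, hk⟩ := hφ.exists_dyadic_iteratedDeriv_ne_zero (i := i) (by omega)
    set t : ℝ := k / 2 ^ J₀ with ht
    set ε : ℕ → ℝ := fun J => (1 / 2 : ℝ) ^ (J + J₀ + 1) with hε
    have hε0 : Tendsto ε atTop (nhds 0) := by
      have h := (tendsto_pow_atTop_nhds_zero_of_lt_one (r := (1 / 2 : ℝ)) (by norm_num)
        (by norm_num)).comp (tendsto_add_atTop_nat (J₀ + 1))
      exact h
    have hεp : ∀ J, 0 < ε J := fun J => by positivity
    have hw : MemLp (fun x => Finsupp.linearCombination ℝ (fun n => scaled φ 1 n x) ρ) 2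
        volume := by
      simp only [Finsupp.linearCombination_apply, Finsupp.sum]
      exact memLp_finsetSum _ fun n _ => (memLp_scaled hc hs 1 n 2).const_mul (ρ n)
    have hzero : ∀ J, ∑ n ∈ b.support, b n
        * ((ε J ^ i)⁻¹ * ∫ y, φ y * ((fwdDiff (ε J))^[i] φ) (t + ε J * (n + y))) = 0 := by
      intro J
      have h1 := hφ.integral_mul_dilate_eq_zero hw h0 (J + J₀) (k * 2 ^ J)
      have htJ : ((k * 2 ^ J : ℤ) : ℝ) / 2 ^ (J + J₀) = t := by
        rw [ht]; push_cast; rw [pow_add]; field_simp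
      rw [htJ] at h1
      have h2 : ∀ n : ℤ, ∫ x, scaled φ 1 n x * φ (t + x / 2 ^ (J + J₀))
          = ((2 : ℝ) ^ ((1 : ℝ) / 2) * 2⁻¹) * ∫ y, φ y * φ (t + ε J * (n + y)) := fun n => by
        have e : ∀ x, scaled φ 1 n x * φ (t + x / 2 ^ (J + J₀)) = (2 : ℝ) ^ ((1 : ℝ) / 2)
            * (fun z => (fun y => φ y * φ (t + ε J * (n + y))) (z - n)) (2 * x) := fun x => by
          simp only [scaled, zpow_one, Int.cast_one, hε]
          rw [show (n : ℝ) + (2 * x - n) = 2 * x by ring, pow_succ, one_div, inv_pow,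
            show ((2 : ℝ) ^ (J + J₀))⁻¹ * 2⁻¹ * (2 * x) = x / 2 ^ (J + J₀) by field_simp]
          ring
        rw [integral_congr_ae (ae_of_all _ e), integral_const_mul,
          Measure.integral_comp_mul_left
            (fun z => (fun y => φ y * φ (t + ε J * (n + y))) (z - n)),
          integral_sub_right_eq_self (fun y => φ y * φ (t + ε J * (n + y))), smul_eq_mul,
          ← mul_assoc,
          abs_of_pos (by norm_num)]
      have h3 : Finsupp.linearCombination ℝ
          (fun n : ℤ => ∫ y, φ y * φ (t + ε J * (n + y))) ρ = 0 := by
        have h4 : ∫ x, Finsupp.linearCombination ℝ (fun n => scaled φ 1 n x) ρ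
            * φ (t + x / 2 ^ (J + J₀)) = Finsupp.linearCombination ℝ
              (fun n : ℤ => ∫ x, scaled φ 1 n x * φ (t + x / 2 ^ (J + J₀))) ρ := by
          simp only [Finsupp.linearCombination_apply, Finsupp.sum, Finset.sum_mul, smul_eq_mul,
            mul_assoc]
          rw [integral_finsetSum]
          · simp only [integral_const_mul]
          · intro n _
            exact (integrable_mul_of_continuous (continuous_scaled hc 1 n)
              (hasCompactSupport_scaled hs 1 n) (by fun_prop)).const_mul _
        rw [h4] at h1
        simp only [h2, Finsupp.linearCombination_apply, Finsupp.sum, smul_eq_mul,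
          mul_left_comm _ ((2 : ℝ) ^ ((1 : ℝ) / 2) * 2⁻¹), ← Finset.mul_sum] at h1 ⊢
        exact (mul_eq_zero.1 h1).resolve_left (by positivity)
      rw [hb, fwdDiff_iter_integral_mul_comp hc hs _ _ _ hc, Finsupp.linearCombination_apply,
        Finsupp.sum] at h3
      simp only [smul_eq_mul] at h3
      simp only [mul_left_comm _ ((ε J ^ i)⁻¹), ← Finset.mul_sum]
      rw [h3, mul_zero]
    have hlim : Tendsto (fun J => ∑ n ∈ b.support, b n
        * ((ε J ^ i)⁻¹ * ∫ y, φ y * ((fwdDiff (ε J))^[i] φ) (t + ε J * (n + y)))) atTop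
        (nhds (∑ n ∈ b.support, b n * ((∫ y, φ y) * iteratedDeriv i φ t))) :=
      tendsto_finsetSum _ fun n _ => (tendsto_integral_mul_fwdDiff_iter hc hs
        (hφ.contDiff.of_le (by exact_mod_cast (by omega : i ≤ r))) hs t n hεp hε0).const_mul _
    simp only [hzero] at hlim
    have hfin := tendsto_nhds_unique tendsto_const_nhds hlim
    rw [← Finset.sum_mul] at hfin
    rw [Finsupp.linearCombination_apply, Finsupp.sum]
    simp only [smul_eq_mul, mul_one]
    exact (mul_eq_zero.1 hfin.symm).resolve_right
      (mul_ne_zero (hφ.integral_ne_zero hr) hk)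

/-- The component of `φ_{1π}` orthogonal to `V_0` is a finite combination of the
`φ_{1n}` whose coefficients factor through the `N`-th difference in `n`. -/
theorem exists_detail (hr : 1 ≤ r) {N : ℕ} (hN : N ≤ r) (π : ℤ) :
    ∃ c ρ b : ℤ →₀ ℝ,
      (∀ x, scaled φ 1 π x - Finsupp.linearCombination ℝ (fun k => scaled φ 0 k x) c
        = Finsupp.linearCombination ℝ (fun n => scaled φ 1 n x) ρ) ∧
      (∀ k, ∫ x, Finsupp.linearCombination ℝ (fun n => scaled φ 1 n x) ρ
        * scaled φ 0 k x = 0) ∧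
      ∀ a : ℤ → ℝ, Finsupp.linearCombination ℝ a ρ
        = Finsupp.linearCombination ℝ ((fwdDiff 1)^[N] a) b := by
  classical
  have hc := hφ.contDiff.continuous
  have hs := hφ.hasCompactSupport
  obtain ⟨L, hL1, hL⟩ := exists_support_bound hs
  set c₀ : ℤ → ℝ := fun k => ∫ x, scaled φ 1 π x * scaled φ 0 k x with hc₀
  have hc₀F : ∀ k, c₀ k ≠ 0 → k ∈ Finset.Icc (-(2 * L + |π| : ℤ)) (2 * L + |π|) := fun k hk => by
    by_contra hn
    refine hk (integral_eq_zero_of_ae (ae_of_all _ fun x => ?_))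
    by_contra hne
    simp only [Pi.zero_apply] at hne
    have h1 := hL _ (right_ne_zero_of_mul (left_ne_zero_of_mul hne))
    have h2 := hL _ (right_ne_zero_of_mul (right_ne_zero_of_mul hne))
    simp only [zpow_zero, one_mul, zpow_one] at h1 h2
    rw [abs_le] at h1 h2
    apply hn
    rw [Finset.mem_Icc]
    have hπ := abs_le.1 (le_refl |(π : ℝ)|)
    have hπ0 := abs_nonneg (π : ℝ)
    have hLn : (0 : ℝ) ≤ L := Nat.cast_nonneg L
    constructor
    · have : (-(2 * L + |(π : ℝ)|) : ℝ) ≤ k := by linarith [h1.1, h1.2, h2.1, h2.2]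
      exact_mod_cast this
    · have : (k : ℝ) ≤ 2 * L + |(π : ℝ)| := by linarith [h1.1, h1.2, h2.1, h2.2]
      exact_mod_cast this
  set c : ℤ →₀ ℝ := Finsupp.onFinset _ c₀ hc₀F with hcdef
  have horth : ∀ k, ∫ x, (scaled φ 1 π x
      - Finsupp.linearCombination ℝ (fun k => scaled φ 0 k x) c) * scaled φ 0 k x = 0 := fun k => by
    have hi : ∀ j l, Integrable fun x => scaled φ j l x * scaled φ 0 k x := fun j l =>
      integrable_mul_of_continuous (continuous_scaled hc j l) (hasCompactSupport_scaled hs j l)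
        (continuous_scaled hc 0 k)
    simp only [sub_mul, Finsupp.linearCombination_apply, Finsupp.sum, Finset.sum_mul, smul_eq_mul,
      mul_assoc]
    rw [integral_sub (hi 1 π) (integrable_finsetSum _ fun n _ => (hi 0 n).const_mul _),
      integral_finsetSum _ fun n _ => (hi 0 n).const_mul _]
    simp only [integral_const_mul, integral_scaled_mul_scaled hφ.orthonormal, mul_ite, mul_one,
      mul_zero, Finset.sum_ite_eq']
    by_cases hk : k ∈ c.support
    · rw [if_pos hk]; simp [hcdef, hc₀]
    · rw [if_neg hk, sub_zero]
      simpa [hcdef, hc₀] using hk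
  obtain ⟨h, hh⟩ := hφ.refinement
  have hspan : (fun x => scaled φ 1 π x - Finsupp.linearCombination ℝ (fun k => scaled φ 0 k x) c)
      ∈ Submodule.span ℝ (Set.range fun n : ℤ => (scaled φ 1 n : ℝ → ℝ)) := by
    have hin : ∀ n, (scaled φ 1 n : ℝ → ℝ)
        ∈ Submodule.span ℝ (Set.range fun n : ℤ => (scaled φ 1 n : ℝ → ℝ)) := fun n =>
      Submodule.subset_span ⟨n, rfl⟩
    have e : (fun x => scaled φ 1 π x - Finsupp.linearCombination ℝ (fun k => scaled φ 0 k x) c)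
        = scaled φ 1 π - ∑ k ∈ c.support, c k • ∑ n ∈ h.support, h n • scaled φ 1 (2 * k + n) := by
      funext x
      simp only [Pi.sub_apply, Finset.sum_apply, Pi.smul_apply]
      rw [Finsupp.linearCombination_apply, Finsupp.sum]
      congr 1
      refine Finset.sum_congr rfl fun k _ => ?_
      rw [hh 0 k x, Finsupp.linearCombination_apply, Finsupp.sum, zero_add]
    rw [e]
    exact Submodule.sub_mem _ (hin π) (Submodule.sum_mem _ fun k _ => Submodule.smul_mem _ _
      (Submodule.sum_mem _ fun n _ => Submodule.smul_mem _ _ (hin _)))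
  obtain ⟨ρ, hρ⟩ := (Finsupp.mem_span_range_iff_exists_finsupp).1 hspan
  have hρx : ∀ x, scaled φ 1 π x - Finsupp.linearCombination ℝ (fun k => scaled φ 0 k x) c
      = Finsupp.linearCombination ℝ (fun n => scaled φ 1 n x) ρ := fun x => by
    have := congrFun hρ x
    rw [← this, Finsupp.linearCombination_apply, Finsupp.sum, Finsupp.sum, Finset.sum_apply]
    rfl
  have horth' : ∀ k, ∫ x, Finsupp.linearCombination ℝ (fun n => scaled φ 1 n x) ρ
      * scaled φ 0 k x = 0 := fun k => by simpa only [hρx] using horth k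
  obtain ⟨b, hb⟩ := hφ.exists_fwdDiff_factor hr horth' N hN
  exact ⟨c, ρ, b, hρx, horth', hb⟩

end IsRegularScalingFunction

end WaveletICA

end Detail

/-! ### Projections on closed spans of orthonormal families -/

section HilbertProjection

variable {E : Type*} [NormedAddCommGroup E] [InnerProductSpace ℝ E]

/-- The closed linear span of a family. -/
def closedSpan {ι : Type*} (e : ι → E) : Submodule ℝ E :=
  (Submodule.span ℝ (Set.range e)).topologicalClosure

lemma mem_closedSpan {ι : Type*} (e : ι → E) (k : ι) : e k ∈ closedSpan e :=
  Submodule.le_topologicalClosure _ (Submodule.subset_span ⟨k, rfl⟩)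

lemma closedSpan_le {ι : Type*} {e : ι → E} {K : Submodule ℝ E} (hK : IsClosed (K : Set E))
    (h : ∀ k, e k ∈ K) : closedSpan e ≤ K :=
  Submodule.topologicalClosure_minimal _
    (Submodule.span_le.2 (by rintro _ ⟨k, rfl⟩; exact h k)) hK

lemma isClosed_closedSpan {ι : Type*} (e : ι → E) : IsClosed (closedSpan e : Set E) :=
  Submodule.isClosed_topologicalClosure _

lemma eq_zero_of_mem_closedSpan {ι : Type*} {e : ι → E} {v : E} (hv : v ∈ closedSpan e)
    (h : ∀ k, inner ℝ (e k) v = 0) : v = 0 :=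
  inner_self_eq_zero.1 (inner_eq_zero_of_mem_topologicalClosure hv
    (by rintro _ ⟨k, rfl⟩; exact h k))

variable [CompleteSpace E]

instance {ι : Type*} (e : ι → E) : CompleteSpace (closedSpan e) :=
  (isClosed_closedSpan e).completeSpace_coe

/-- Parseval's identity on the closed span of an orthonormal family. -/
lemma Orthonormal.hasSum_inner_sq {ι : Type*} {e : ι → E} (he : Orthonormal ℝ e) (g : E) :
    HasSum (fun k => inner ℝ (e k) g ^ 2) (‖(closedSpan e).starProjection g‖ ^ 2) := by
  classical
  set V := closedSpan e
  let e' : ι → V := fun k => ⟨e k, mem_closedSpan e k⟩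
  have he' : Orthonormal ℝ e' := by
    rw [orthonormal_iff_ite] at he ⊢
    exact fun i j => he i j
  have hbot : (Submodule.span ℝ (Set.range e'))ᗮ = ⊥ := by
    rw [Submodule.eq_bot_iff]
    intro v hv
    refine Subtype.ext (eq_zero_of_mem_closedSpan v.2 fun k => ?_)
    exact (Submodule.mem_orthogonal _ _).1 hv (e' k) (Submodule.subset_span ⟨k, rfl⟩)
  let b := HilbertBasis.mkOfOrthogonalEqBot he' hbot
  have hb : ∀ k, b k = e' k := fun k => by
    rw [HilbertBasis.coe_mkOfOrthogonalEqBot]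
  have h := b.hasSum_inner_mul_inner (V.orthogonalProjectionOnto g) (V.orthogonalProjectionOnto g)
  rw [real_inner_self_eq_norm_sq] at h
  have hn : ‖V.orthogonalProjectionOnto g‖ = ‖V.starProjection g‖ := by
    rw [Submodule.starProjection_apply]; rfl
  rw [hn] at h
  refine h.congr_fun ?_
  intro k
  have h1 : inner ℝ (b k) (V.orthogonalProjectionOnto g) = inner ℝ (e k) g := by
    rw [hb]
    exact (Submodule.inner_orthogonalProjectionOnto_eq_of_mem_left (e' k) g)
  rw [real_inner_comm (b k) (V.orthogonalProjectionOnto g), h1, sq]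

/-- The squared norm of the difference of two nested projections of `g` is the sum of the squares
of the inner products of `g` with the components of the finer basis orthogonal to the
coarser space. -/
lemma hasSum_inner_sq_of_nested {ι ι' : Type*} {e : ι → E} {e' : ι' → E} (he : Orthonormal ℝ e)
    (hle : closedSpan e' ≤ closedSpan e) {w : ι → E}
    (hw : ∀ k, e k - w k ∈ closedSpan e') (hw' : ∀ k l, inner ℝ (e' l) (w k) = 0) (g : E) :
    HasSum (fun k => inner ℝ (w k) g ^ 2)
      (‖(closedSpan e).starProjection g‖ ^ 2 - ‖(closedSpan e').starProjection g‖ ^ 2) := by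
  set V := closedSpan e
  set V' := closedSpan e'
  set u := V.starProjection g - V'.starProjection g
  have huV : u ∈ V := V.sub_mem (Submodule.starProjection_apply_mem _ _)
    (hle (Submodule.starProjection_apply_mem _ _))
  have hPu : V.starProjection u = u := Submodule.starProjection_eq_self_iff.2 huV
  have hsum := he.hasSum_inner_sq u
  have hnorm : ‖V.starProjection u‖ ^ 2 = ‖V.starProjection g‖ ^ 2 - ‖V'.starProjection g‖ ^ 2 := by
    rw [hPu]
    have hpp : V'.starProjection (V.starProjection g) = V'.starProjection g := by
      have := Submodule.starProjection_comp_starProjection_of_le hle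
      exact congrArg (fun T => T g) this
    have := Submodule.norm_sq_eq_add_norm_sq_starProjection (V.starProjection g) V'
    rw [hpp] at this
    have h2 : (V'ᗮ).starProjection (V.starProjection g) = u := by
      have := Submodule.starProjection_add_starProjection_orthogonal (K := V') (V.starProjection g)
      rw [hpp] at this
      exact eq_sub_of_add_eq' this
    rw [h2] at this
    linarith
  rw [← hnorm]
  refine hsum.congr_fun fun k => ?_
  congr 1
  have h1 : inner ℝ (e k) (V.starProjection g) = inner ℝ (e k) g := by
    rw [← Submodule.inner_starProjection_left_eq_right,
      Submodule.starProjection_eq_self_iff.2 (mem_closedSpan e k)]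
  have h2 : V'.starProjection (e k) = e k - w k :=
    (Submodule.eq_starProjection_of_mem_of_inner_eq_zero (u := e k) (hw k) fun v hv => by
      rw [sub_sub_cancel, real_inner_comm]
      exact inner_eq_zero_of_mem_topologicalClosure hv (by rintro _ ⟨l, rfl⟩; exact hw' k l))
  have h3 : inner ℝ (e k) (V'.starProjection g) = inner ℝ (e k - w k) g := by
    rw [← Submodule.inner_starProjection_left_eq_right, h2]
  simp only [u]
  rw [inner_sub_right, h1, h3, inner_sub_left]
  ring

end HilbertProjection

/-! ### Tensor products of functions of one variable -/

section Tensor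

namespace WaveletICA

variable {d : ℕ}

/-- The tensor product `x ↦ ∏ u_ℓ(x^ℓ)` of functions of one variable. -/
def tensor (u : Fin d → ℝ → ℝ) (x : Fin d → ℝ) : ℝ := ∏ ℓ, u ℓ (x ℓ)

lemma tensor_mul (u v : Fin d → ℝ → ℝ) (x : Fin d → ℝ) :
    tensor u x * tensor v x = ∏ ℓ, (u ℓ (x ℓ) * v ℓ (x ℓ)) := Finset.prod_mul_distrib.symm

lemma integral_tensor_mul_tensor (u v : Fin d → ℝ → ℝ) :
    ∫ x, tensor u x * tensor v x = ∏ ℓ, ∫ t, u ℓ t * v ℓ t := by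
  simp only [tensor_mul]
  exact integral_fintype_prod_volume_eq_prod fun ℓ t => u ℓ t * v ℓ t

lemma measurable_tensor {u : Fin d → ℝ → ℝ} (hu : ∀ ℓ, Measurable (u ℓ)) :
    Measurable (tensor u) :=
  Finset.measurable_fun_prod _ fun ℓ _ => (hu ℓ).comp (measurable_pi_apply ℓ)

lemma memLp_tensor {u : Fin d → ℝ → ℝ} (hu : ∀ ℓ, Measurable (u ℓ))
    (h2 : ∀ ℓ, MemLp (u ℓ) 2 volume) : MemLp (tensor u) 2 volume := by
  rw [memLp_two_iff_integrable_sq (measurable_tensor hu).aestronglyMeasurable]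
  have h := Integrable.fintype_prod (μ := fun _ : Fin d => (volume : Measure ℝ))
    (f := fun ℓ t => u ℓ t ^ 2) fun ℓ =>
      (memLp_two_iff_integrable_sq (hu ℓ).aestronglyMeasurable).1 (h2 ℓ)
  refine h.congr (ae_of_all _ fun x => ?_)
  simp [tensor, Finset.prod_pow]

lemma tensor_congr_ae {u v : Fin d → ℝ → ℝ} (h : ∀ ℓ, u ℓ =ᵐ[volume] v ℓ) :
    tensor u =ᵐ[volume] tensor v := by
  have : ∀ ℓ, ∀ᵐ x : Fin d → ℝ, u ℓ (x ℓ) = v ℓ (x ℓ) := fun ℓ =>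
    (Measure.quasiMeasurePreserving_eval (fun _ : Fin d => (volume : Measure ℝ)) ℓ).ae (h ℓ)
  filter_upwards [ae_all_iff.2 this] with x hx
  exact Finset.prod_congr rfl fun ℓ _ => hx ℓ

lemma tensor_update (u : Fin d → ℝ → ℝ) (a : Fin d) (v : ℝ → ℝ) (x : Fin d → ℝ) :
    tensor (Function.update u a v) x = v (x a) * ∏ ℓ ∈ Finset.univ.erase a, u ℓ (x ℓ) := by
  classical
  unfold tensor
  rw [← Finset.mul_prod_erase _ _ (Finset.mem_univ a), Function.update_self]
  congr 1
  refine Finset.prod_congr rfl fun ℓ hℓ => ?_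
  rw [Function.update_of_ne (Finset.ne_of_mem_erase hℓ)]

/-- Tensor products of elements of `L_2(ℝ)`. -/
noncomputable def tensorLp (u : Fin d → Lp ℝ 2 (volume : Measure ℝ)) :
    Lp ℝ 2 (volume : Measure (Fin d → ℝ)) :=
  (memLp_tensor (u := fun ℓ => u ℓ) (fun ℓ => (Lp.stronglyMeasurable (u ℓ)).measurable)
    fun ℓ => Lp.memLp (u ℓ)).toLp _

lemma coeFn_tensorLp (u : Fin d → Lp ℝ 2 (volume : Measure ℝ)) {v : Fin d → ℝ → ℝ}
    (h : ∀ ℓ, u ℓ =ᵐ[volume] v ℓ) : tensorLp u =ᵐ[volume] tensor v :=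
  (MemLp.coeFn_toLp _).trans (tensor_congr_ae h)

lemma inner_tensorLp (u v : Fin d → Lp ℝ 2 (volume : Measure ℝ)) :
    inner ℝ (tensorLp u) (tensorLp v) = ∏ ℓ, inner ℝ (u ℓ) (v ℓ) := by
  rw [L2.inner_def]
  have : ∀ᵐ x : Fin d → ℝ, inner ℝ (tensorLp u x) (tensorLp v x)
      = tensor (fun ℓ => v ℓ) x * tensor (fun ℓ => u ℓ) x := by
    filter_upwards [coeFn_tensorLp u (v := fun ℓ => u ℓ) fun ℓ => ae_eq_refl _,
      coeFn_tensorLp v (v := fun ℓ => v ℓ) fun ℓ => ae_eq_refl _] with x h1 h2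
    rw [h1, h2]
    simp
  rw [integral_congr_ae this, integral_tensor_mul_tensor]
  refine Finset.prod_congr rfl fun ℓ _ => ?_
  rw [L2.inner_def]
  simp

lemma norm_tensorLp (u : Fin d → Lp ℝ 2 (volume : Measure ℝ)) :
    ‖tensorLp u‖ = ∏ ℓ, ‖u ℓ‖ := by
  have h := inner_tensorLp u u
  simp only [real_inner_self_eq_norm_sq] at h
  rw [Finset.prod_pow] at h
  exact (pow_left_inj₀ (norm_nonneg _) (Finset.prod_nonneg fun _ _ => norm_nonneg _)
    two_ne_zero).1 h

/-- Tensor products are linear in each factor. -/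
noncomputable def tensorLpUpdate (u : Fin d → Lp ℝ 2 (volume : Measure ℝ)) (a : Fin d) :
    Lp ℝ 2 (volume : Measure ℝ) →L[ℝ] Lp ℝ 2 (volume : Measure (Fin d → ℝ)) :=
  LinearMap.mkContinuous
    { toFun := fun y => tensorLp (Function.update u a y)
      map_add' := fun y z => by
        have hy : ∀ y : Lp ℝ 2 (volume : Measure ℝ), tensorLp (Function.update u a y)
            =ᵐ[volume] tensor (Function.update (fun ℓ => (u ℓ : ℝ → ℝ)) a y) := fun y =>
          coeFn_tensorLp _ fun ℓ => by
            by_cases h : ℓ = a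
            · subst h; simp
            · simp [h]
        have hq := (Measure.quasiMeasurePreserving_eval
          (fun _ : Fin d => (volume : Measure ℝ)) a).ae (Lp.coeFn_add y z)
        refine Lp.ext ?_
        filter_upwards [hy (y + z), hy y, hy z, hq,
          Lp.coeFn_add (tensorLp (Function.update u a y)) (tensorLp (Function.update u a z))]
          with x h1 h2 h3 h4 h5
        rw [h5, Pi.add_apply, h1, h2, h3, tensor_update, tensor_update, tensor_update]
        simp only [Function.eval, Pi.add_apply] at h4
        rw [h4, add_mul]
      map_smul' := fun c y => by
        have hy : ∀ y : Lp ℝ 2 (volume : Measure ℝ), tensorLp (Function.update u a y)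
            =ᵐ[volume] tensor (Function.update (fun ℓ => (u ℓ : ℝ → ℝ)) a y) := fun y =>
          coeFn_tensorLp _ fun ℓ => by
            by_cases h : ℓ = a
            · subst h; simp
            · simp [h]
        have hq := (Measure.quasiMeasurePreserving_eval
          (fun _ : Fin d => (volume : Measure ℝ)) a).ae (Lp.coeFn_smul c y)
        refine Lp.ext ?_
        filter_upwards [hy (c • y), hy y, hq,
          Lp.coeFn_smul c (tensorLp (Function.update u a y))]
          with x h1 h2 h4 h5
        rw [RingHom.id_apply, h5, Pi.smul_apply, h1, h2, tensor_update, tensor_update]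
        simp only [Function.eval, Pi.smul_apply] at h4
        rw [h4, smul_eq_mul, smul_eq_mul, mul_assoc] }
    (∏ ℓ ∈ Finset.univ.erase a, ‖u ℓ‖) fun y => by
      classical
      simp only [LinearMap.coe_mk, AddHom.coe_mk]
      rw [norm_tensorLp, ← Finset.mul_prod_erase _ _ (Finset.mem_univ a), Function.update_self,
        mul_comm]
      refine le_of_eq ?_
      congr 1
      refine Finset.prod_congr rfl fun ℓ hℓ => ?_
      rw [Function.update_of_ne (Finset.ne_of_mem_erase hℓ)]

lemma tensorLpUpdate_apply (u : Fin d → Lp ℝ 2 (volume : Measure ℝ)) (a : Fin d)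
    (y : Lp ℝ 2 (volume : Measure ℝ)) :
    tensorLpUpdate u a y = tensorLp (Function.update u a y) := rfl

/-- A function of `L_2(ℝ^d)` whose integrals over all bounded measurable boxes vanish is zero. -/
lemma ae_eq_zero_of_setIntegral_pi {g : (Fin d → ℝ) → ℝ} (hg : MemLp g 2 volume)
    (h : ∀ B : Fin d → Set ℝ, (∀ ℓ, MeasurableSet (B ℓ)) → (∀ ℓ, volume (B ℓ) ≠ ∞) →
      ∫ x in Set.pi Set.univ B, g x = 0) : g =ᵐ[volume] 0 := by
  have key : ∀ m : ℕ, ∀ᵐ x : Fin d → ℝ,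
      x ∈ Set.pi Set.univ (fun _ : Fin d => Set.Icc (-m : ℝ) m) → g x = 0 := by
    intro m
    set Q : Set (Fin d → ℝ) := Set.pi Set.univ (fun _ : Fin d => Set.Icc (-m : ℝ) m) with hQ
    have hQm : MeasurableSet Q := MeasurableSet.univ_pi fun _ => measurableSet_Icc
    have hQf : volume Q ≠ ∞ := by
      rw [hQ, volume_pi_pi]
      exact ENNReal.prod_ne_top fun _ _ => by simp
    have hfin : IsFiniteMeasure (volume.restrict Q) := ⟨by
      rw [Measure.restrict_apply_univ]; exact hQf.lt_top⟩
    have hgi : Integrable g (volume.restrict Q) :=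
      (hg.restrict Q).integrable one_le_two
    have hset : ∀ s, MeasurableSet s → ∫ x in s, g x ∂(volume.restrict Q) = 0 := by
      have huniv : ∫ x, g x ∂(volume.restrict Q) = 0 :=
        h _ (fun _ => measurableSet_Icc) fun _ => by simp
      intro s hs
      induction s, hs using MeasurableSpace.induction_on_inter
        (generateFrom_pi (α := fun _ : Fin d => ℝ)).symm isPiSystem_pi with
      | empty => simp
      | basic t ht =>
        obtain ⟨B, hB, rfl⟩ := ht
        have hBm : ∀ ℓ, MeasurableSet (B ℓ) := fun ℓ => hB ℓ (Set.mem_univ ℓ)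
        rw [Measure.restrict_restrict (MeasurableSet.univ_pi hBm), hQ, ← Set.pi_inter_distrib]
        refine h _ (fun ℓ => (hBm ℓ).inter measurableSet_Icc) fun ℓ => ?_
        exact measure_ne_top_of_subset Set.inter_subset_right (by simp)
      | compl t ht ih =>
        have := integral_add_compl ht hgi
        rw [ih, huniv, zero_add] at this
        exact this
      | iUnion t hd hm ih =>
        have := hasSum_integral_iUnion hm hd hgi.integrableOn
        simp only [ih] at this
        exact this.unique hasSum_zero
    have := hgi.ae_eq_zero_of_forall_setIntegral_eq_zero fun s hs _ => hset s hs
    exact (ae_restrict_iff' hQm).1 this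
  filter_upwards [ae_all_iff.2 key] with x hx
  obtain ⟨m, hm⟩ := exists_nat_ge ‖x‖
  refine hx m fun ℓ _ => ?_
  rw [Set.mem_Icc, ← abs_le]
  exact (norm_le_pi_norm x ℓ).trans hm

end WaveletICA

end Tensor

/-! ### Tensor product multiresolution analysis with coordinatewise resolutions -/

section TensorMRA

namespace WaveletICA

variable {d r : ℕ} {φ : ℝ → ℝ}

/-- The tensor product of the `φ_{J_ℓ k_ℓ}`, with a resolution `J_ℓ` for each coordinate. -/
noncomputable def anisoScaled (φ : ℝ → ℝ) (J k : Fin d → ℤ) : (Fin d → ℝ) → ℝ :=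
  tensor fun ℓ => scaled φ (J ℓ) (k ℓ)

namespace IsRegularScalingFunction

variable (hφ : IsRegularScalingFunction r φ)
include hφ

/-- `anisoScaled` as an element of `L_2(ℝ^d)`. -/
noncomputable def anisoLp (J k : Fin d → ℤ) : Lp ℝ 2 (volume : Measure (Fin d → ℝ)) :=
  tensorLp fun ℓ => hφ.scaledLp (J ℓ) (k ℓ)

lemma coeFn_anisoLp (J k : Fin d → ℤ) : hφ.anisoLp J k =ᵐ[volume] anisoScaled φ J k :=
  coeFn_tensorLp _ fun _ => hφ.coeFn_scaledLp _ _

lemma orthonormal_anisoLp (J : Fin d → ℤ) : Orthonormal ℝ (hφ.anisoLp J) := by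
  classical
  rw [orthonormal_iff_ite]
  intro k l
  unfold anisoLp
  rw [inner_tensorLp]
  simp only [orthonormal_iff_ite.1 (hφ.orthonormal_scaledLp _)]
  split_ifs with h
  · subst h; simp
  · obtain ⟨ℓ, hℓ⟩ := Function.ne_iff.1 h
    exact Finset.prod_eq_zero (Finset.mem_univ ℓ) (if_neg hℓ)

lemma inner_anisoLp_toLp (J k : Fin d → ℤ) {g : (Fin d → ℝ) → ℝ} (hg : MemLp g 2 volume) :
    inner ℝ (hφ.anisoLp J k) (hg.toLp g) = ∫ x, g x * anisoScaled φ J k x := by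
  rw [L2.inner_def]
  refine integral_congr_ae ?_
  filter_upwards [hφ.coeFn_anisoLp J k, hg.coeFn_toLp] with x h1 h2
  rw [h1, h2]
  simp

/-- The space `V_J` of the resolution vector `J`. -/
noncomputable def anisoSpace (J : Fin d → ℤ) : Submodule ℝ (Lp ℝ 2 (volume : Measure (Fin d → ℝ))) :=
  closedSpan (hφ.anisoLp J)

instance (J : Fin d → ℤ) : CompleteSpace (hφ.anisoSpace J) :=
  (isClosed_closedSpan _).completeSpace_coe

lemma anisoSpace_le_update_succ (J : Fin d → ℤ) (a : Fin d) :
    hφ.anisoSpace J ≤ hφ.anisoSpace (Function.update J a (J a + 1)) := by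
  obtain ⟨h, hh⟩ := hφ.refinement
  refine closedSpan_le (isClosed_closedSpan _) fun k => ?_
  have e : hφ.anisoLp J k = ∑ n ∈ h.support, h n • hφ.anisoLp (Function.update J a (J a + 1))
      (Function.update k a (2 * k a + n)) := by
    have h1 : hφ.scaledLp (J a) (k a)
        = ∑ n ∈ h.support, h n • hφ.scaledLp (J a + 1) (2 * k a + n) := by
      refine Lp.ext ?_
      have h2 : ∀ n ∈ h.support, ∀ᵐ x, (h n • hφ.scaledLp (J a + 1) (2 * k a + n) :
          Lp ℝ 2 (volume : Measure ℝ)) x = h n * scaled φ (J a + 1) (2 * k a + n) x :=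
        fun n _ => by
          filter_upwards [Lp.coeFn_smul (h n) (hφ.scaledLp (J a + 1) (2 * k a + n)),
            hφ.coeFn_scaledLp (J a + 1) (2 * k a + n)] with x h1 h2
          rw [h1, Pi.smul_apply, h2, smul_eq_mul]
      filter_upwards [hφ.coeFn_scaledLp (J a) (k a), Lp.coeFn_finsetSum h.support
        fun n => h n • hφ.scaledLp (J a + 1) (2 * k a + n),
        (Finset.eventually_all h.support).2 h2] with x h3 h4 h5
      rw [h3, h4, Finset.sum_apply, hh, Finsupp.linearCombination_apply, Finsupp.sum]
      exact (Finset.sum_congr rfl h5).symm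
    have h2 : ∀ y, tensorLpUpdate (fun ℓ => hφ.scaledLp (J ℓ) (k ℓ)) a y
        = tensorLp (Function.update (fun ℓ => hφ.scaledLp (J ℓ) (k ℓ)) a y) := fun y => rfl
    have h3 : hφ.anisoLp J k
        = tensorLpUpdate (fun ℓ => hφ.scaledLp (J ℓ) (k ℓ)) a (hφ.scaledLp (J a) (k a)) := by
      rw [h2, Function.update_eq_self]; rfl
    rw [h3, h1, map_sum]
    refine Finset.sum_congr rfl fun n _ => ?_
    rw [map_smul, h2]
    congr 1
    unfold anisoLp
    congr 1
    funext ℓ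
    by_cases hℓ : ℓ = a
    · subst hℓ; simp
    · simp [hℓ]
  rw [e]
  exact Submodule.sum_mem _ fun n _ => Submodule.smul_mem _ _ (mem_closedSpan _ _)

lemma anisoSpace_mono {J J' : Fin d → ℤ} (hJ : J ≤ J') : hφ.anisoSpace J ≤ hφ.anisoSpace J' := by
  classical
  have step : ∀ (J : Fin d → ℤ) (a : Fin d) (j : ℤ), J a ≤ j →
      hφ.anisoSpace J ≤ hφ.anisoSpace (Function.update J a j) := by
    intro J a j hj
    induction j, hj using Int.leInduction with
    | base => rw [Function.update_eq_self]
    | succ j hj ih =>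
      refine ih.trans ?_
      have := hφ.anisoSpace_le_update_succ (Function.update J a j) a
      rwa [Function.update_self, Function.update_idem] at this
  have h : ∀ S : Finset (Fin d),
      hφ.anisoSpace J ≤ hφ.anisoSpace fun ℓ => if ℓ ∈ S then J' ℓ else J ℓ := by
    intro S
    induction S using Finset.induction_on with
    | empty => simp
    | insert a S ha ih =>
      refine ih.trans ?_
      have := step (fun ℓ => if ℓ ∈ S then J' ℓ else J ℓ) a (J' a) (by simpa [ha] using hJ a)
      convert this using 2
      funext ℓ
      by_cases hℓ : ℓ = a
      · subst hℓ; simp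
      · simp [hℓ]
  simpa using h Finset.univ

/-- The spaces of all resolution vectors are dense in `L_2(ℝ^d)`: by density on the line, one
coordinate at a time, the closure of their union contains all tensor products, and a function
orthogonal to the indicators of boxes is zero. -/
lemma topologicalClosure_iSup_anisoSpace :
    (⨆ j : ℕ, hφ.anisoSpace fun _ : Fin d => (j : ℤ)).topologicalClosure = ⊤ := by
  classical
  set K := (⨆ j : ℕ, hφ.anisoSpace fun _ : Fin d => (j : ℤ)).topologicalClosure with hK
  have hKc : IsClosed (K : Set (Lp ℝ 2 (volume : Measure (Fin d → ℝ)))) :=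
    Submodule.isClosed_topologicalClosure _
  have hbase : ∀ J k : Fin d → ℤ, hφ.anisoLp J k ∈ K := fun J k => by
    have hj : ∀ ℓ, J ℓ ≤ ((∑ i, (J i).toNat : ℕ) : ℤ) := fun ℓ => by
      have h1 := Finset.single_le_sum (f := fun i => (J i).toNat) (fun _ _ => Nat.zero_le _)
        (Finset.mem_univ ℓ)
      have h2 := Int.self_le_toNat (J ℓ)
      have h3 : ((J ℓ).toNat : ℤ) ≤ ((∑ i, (J i).toNat : ℕ) : ℤ) := by exact_mod_cast h1
      exact h2.trans h3
    exact Submodule.le_topologicalClosure _ (Submodule.mem_iSup_of_mem _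
      (hφ.anisoSpace_mono (J' := fun _ => ((∑ i, (J i).toNat : ℕ) : ℤ)) hj (mem_closedSpan _ k)))
  have htensor : ∀ S : Finset (Fin d), ∀ (u : Fin d → Lp ℝ 2 (volume : Measure ℝ))
      (J k : Fin d → ℤ),
      tensorLp (fun ℓ => if ℓ ∈ S then u ℓ else hφ.scaledLp (J ℓ) (k ℓ)) ∈ K := by
    intro S
    induction S using Finset.induction_on with
    | empty => intro u J k; simpa using! hbase J k
    | insert a S ha ih =>
      intro u J k
      set v : Fin d → Lp ℝ 2 (volume : Measure ℝ) :=
        fun ℓ => if ℓ ∈ S then u ℓ else hφ.scaledLp (J ℓ) (k ℓ) with hv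
      have hv' : (fun ℓ => if ℓ ∈ insert a S then u ℓ else hφ.scaledLp (J ℓ) (k ℓ))
          = Function.update v a (u a) := by
        funext ℓ
        by_cases hℓ : ℓ = a
        · subst hℓ; simp
        · simp [hℓ, hv]
      rw [hv', ← tensorLpUpdate_apply]
      set T := tensorLpUpdate v a
      have hcl : IsClosed ((K.comap T.toLinearMap : Submodule ℝ (Lp ℝ 2 (volume : Measure ℝ))) :
          Set (Lp ℝ 2 (volume : Measure ℝ))) :=
        hKc.preimage T.continuous
      have hV : ∀ j : ℤ, approxSpace φ j ≤ K.comap T.toLinearMap := fun j => by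
        rw [hφ.approxSpace_eq]
        refine closedSpan_le hcl fun m => ?_
        have := ih u (Function.update J a j) (Function.update k a m)
        rw [Submodule.mem_comap]
        change tensorLp (Function.update v a (hφ.scaledLp j m)) ∈ K
        convert this using 2
        funext ℓ
        by_cases hℓ : ℓ = a
        · subst hℓ; simp [ha]
        · simp [hℓ, hv]
      have huniv := hφ.dense.closure_eq
      have : closure (⋃ j : ℕ, (approxSpace φ j : Set (Lp ℝ 2 (volume : Measure ℝ))))
          ⊆ (K.comap T.toLinearMap : Submodule ℝ _) :=
        closure_minimal (Set.iUnion_subset fun j => hV j) hcl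
      rw [huniv] at this
      exact this (Set.mem_univ (u a))
  rw [hK, Submodule.topologicalClosure_eq_top_iff, Submodule.eq_bot_iff]
  intro g hg
  have hg0 : ∀ y ∈ K, inner ℝ y g = 0 := fun y hy => by
    have hg' : g ∈ Kᗮ := by rwa [hK, Submodule.orthogonal_closure]
    exact (Submodule.mem_orthogonal _ _).1 hg' y hy
  have hzero : g =ᵐ[volume] (0 : (Fin d → ℝ) → ℝ) := by
    refine ae_eq_zero_of_setIntegral_pi (Lp.memLp g) fun B hB hBf => ?_
    have hmem := htensor Finset.univ (fun ℓ => indicatorConstLp 2 (hB ℓ) (hBf ℓ) 1) 0 0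
    simp only [Finset.mem_univ, if_true] at hmem
    have h0 := hg0 _ hmem
    rw [L2.inner_def] at h0
    rw [← h0, ← integral_indicator (MeasurableSet.univ_pi hB)]
    refine integral_congr_ae ?_
    filter_upwards [coeFn_tensorLp (fun ℓ => indicatorConstLp 2 (hB ℓ) (hBf ℓ) (1 : ℝ))
      (v := fun ℓ => (B ℓ).indicator fun _ => 1) fun ℓ => indicatorConstLp_coeFn] with x hx
    rw [hx]
    by_cases hxB : x ∈ Set.pi Set.univ B
    · have h1 : tensor (fun ℓ => (B ℓ).indicator fun _ => (1 : ℝ)) x = 1 :=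
        Finset.prod_eq_one fun ℓ _ => Set.indicator_of_mem (hxB ℓ (Set.mem_univ ℓ)) _
      rw [Set.indicator_of_mem hxB, h1]
      simp
    · rw [Set.indicator_of_notMem hxB]
      obtain ⟨ℓ, hℓ⟩ : ∃ ℓ, x ℓ ∉ B ℓ := by
        simpa [Set.mem_pi] using hxB
      have h1 : tensor (fun ℓ => (B ℓ).indicator fun _ => (1 : ℝ)) x = 0 :=
        Finset.prod_eq_zero (Finset.mem_univ ℓ) (Set.indicator_of_notMem hℓ _)
      rw [h1]
      simp
  exact Lp.ext (hzero.trans (Lp.coeFn_zero ℝ 2 volume).symm)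

lemma tendsto_starProjection_anisoSpace (g : Lp ℝ 2 (volume : Measure (Fin d → ℝ))) :
    Tendsto (fun j : ℕ => (hφ.anisoSpace fun _ : Fin d => (j : ℤ)).starProjection g) atTop
      (nhds g) :=
  Submodule.starProjection_tendsto_self (fun j : ℕ => hφ.anisoSpace fun _ : Fin d => (j : ℤ))
    (fun _ _ h => hφ.anisoSpace_mono fun _ => Int.ofNat_le.2 h) g
    hφ.topologicalClosure_iSup_anisoSpace.ge

end IsRegularScalingFunction

end WaveletICA

end TensorMRA

/-! ### Approximation error in terms of coordinate differences -/

section Jackson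

namespace WaveletICA

variable {d r : ℕ} {φ : ℝ → ℝ}

lemma memLp_fwdDiff {g : (Fin d → ℝ) → ℝ} (hg : MemLp g 2 volume) (v : Fin d → ℝ) :
    MemLp (fwdDiff v g) 2 volume :=
  (hg.comp_measurePreserving (measurePreserving_add_right volume v)).sub hg

lemma memLp_fwdDiff_iter {g : (Fin d → ℝ) → ℝ} (hg : MemLp g 2 volume) (v : Fin d → ℝ) (N : ℕ) :
    MemLp ((fwdDiff v)^[N] g) 2 volume := by
  induction N generalizing g with
  | zero => exact hg
  | succ N ih => rw [Function.iterate_succ_apply]; exact ih (memLp_fwdDiff hg v)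

lemma norm_toLp_sq {g : (Fin d → ℝ) → ℝ} (hg : MemLp g 2 volume) :
    ‖hg.toLp g‖ ^ 2 = ∫ x, g x ^ 2 := by
  rw [← real_inner_self_eq_norm_sq, L2.inner_def]
  refine integral_congr_ae ?_
  filter_upwards [hg.coeFn_toLp] with x h
  rw [h]; simp [sq]

/-- The coefficients of `g` with respect to the tensor products at resolution `J`. -/
noncomputable def anisoCoeff (φ : ℝ → ℝ) (g : (Fin d → ℝ) → ℝ) (J k : Fin d → ℤ) : ℝ :=
  ∫ x, g x * anisoScaled φ J k x

lemma scaled_succ_add (j m : ℤ) (x : ℝ) :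
    scaled φ j (m + 1) (x + (2 : ℝ) ^ (-j)) = scaled φ j m x := by
  have h : (2 : ℝ) ^ j * (2 : ℝ) ^ (-j) = 1 := by
    rw [← zpow_add₀ two_ne_zero]; simp
  simp only [scaled]
  rw [mul_add, h]
  push_cast
  congr 2
  ring

lemma scaled_eq_scaled_zero (j i n : ℤ) (x : ℝ) :
    scaled φ j (i + n) x = (2 : ℝ) ^ ((j : ℝ) / 2) * scaled φ 0 n (2 ^ j * x - i) := by
  simp only [scaled, zpow_zero, one_mul, Int.cast_zero, zero_div, Real.rpow_zero]
  push_cast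
  congr 2
  ring

lemma scaled_eq_scaled_one (j i n : ℤ) (x : ℝ) :
    scaled φ (j + 1) (2 * i + n) x = (2 : ℝ) ^ ((j : ℝ) / 2) * scaled φ 1 n (2 ^ j * x - i) := by
  simp only [scaled]
  rw [← mul_assoc, ← Real.rpow_add two_pos, zpow_add₀ two_ne_zero]
  push_cast
  congr 2
  · ring
  · rw [zpow_one]; ring

lemma anisoScaled_shift (J k : Fin d → ℤ) (a : Fin d) (m : ℤ) (x : Fin d → ℝ) :
    anisoScaled φ J (Function.update k a (m + 1)) (x + Pi.single a ((2 : ℝ) ^ (-J a)))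
      = anisoScaled φ J (Function.update k a m) x := by
  unfold anisoScaled tensor
  refine Finset.prod_congr rfl fun ℓ _ => ?_
  by_cases h : ℓ = a
  · subst h
    simp only [Function.update_self, Pi.add_apply, Pi.single_eq_same]
    exact scaled_succ_add _ _ _
  · simp [h]

/-- The Cauchy-Schwarz inequality for a finite filter acting in coordinate `a`, with the sum of
squares written over translates of `k`. -/
lemma sq_sum_shift_le (b : ℤ →₀ ℝ) (D : (Fin d → ℤ) → ℝ) (k : Fin d → ℤ) (a : Fin d)
    {π i : ℤ} (hk : 2 * i + π = k a) :
    (∑ n ∈ b.support, b n * D (Function.update k a (2 * i + n))) ^ 2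
      ≤ (∑ n ∈ b.support, b n ^ 2) * ∑ n ∈ b.support, D (k + Pi.single a (n - π)) ^ 2 := by
  refine (Finset.sum_mul_sq_le_sq_mul_sq _ _ _).trans (le_of_eq ?_)
  congr 1
  refine Finset.sum_congr rfl fun n _ => ?_
  congr 2
  funext ℓ
  by_cases h : ℓ = a
  · rw [h, Function.update_self, Pi.add_apply, Pi.single_eq_same]
    linarith
  · simp [h]

namespace IsRegularScalingFunction

variable (hφ : IsRegularScalingFunction r φ)
include hφ

lemma memLp_anisoScaled (J k : Fin d → ℤ) : MemLp (anisoScaled φ J k) 2 volume :=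
  memLp_tensor (fun _ => (continuous_scaled hφ.contDiff.continuous _ _).measurable)
    fun _ => memLp_scaled hφ.contDiff.continuous hφ.hasCompactSupport _ _ _

/-- Differences of the coefficients in the index `k a` are coefficients of the differences of `g` with
step `2^{-J_a}` along the axis `a`. -/
lemma fwdDiff_iter_anisoCoeff (J k : Fin d → ℤ) (a : Fin d) (N : ℕ) {g : (Fin d → ℝ) → ℝ}
    (hg : MemLp g 2 volume) :
    (fwdDiff (1 : ℤ))^[N] (fun m => anisoCoeff φ g J (Function.update k a m))
      = fun m => anisoCoeff φ ((fwdDiff (Pi.single a ((2 : ℝ) ^ (-J a))))^[N] g) J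
          (Function.update k a m) := by
  induction N generalizing g with
  | zero => rfl
  | succ N ih =>
    rw [Function.iterate_succ_apply, Function.iterate_succ_apply, ← ih (memLp_fwdDiff hg _)]
    congr 1
    funext m
    set v : Fin d → ℝ := Pi.single a ((2 : ℝ) ^ (-J a))
    have hsh : MemLp (fun x => g (x + v)) 2 volume :=
      hg.comp_measurePreserving (measurePreserving_add_right volume v)
    have h1 : anisoCoeff φ g J (Function.update k a (m + 1))
        = ∫ x, g (x + v) * anisoScaled φ J (Function.update k a m) x := by
      unfold anisoCoeff
      rw [← integral_add_right_eq_self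
        (fun x => g x * anisoScaled φ J (Function.update k a (m + 1)) x) v]
      simp only [v, anisoScaled_shift]
    rw [fwdDiff, h1]
    unfold anisoCoeff
    have hi : ∀ {f : (Fin d → ℝ) → ℝ}, MemLp f 2 volume →
        Integrable fun x => f x * anisoScaled φ J (Function.update k a m) x :=
      fun hf => hf.integrable_mul (hφ.memLp_anisoScaled _ _)
    rw [← integral_sub (hi hsh) (hi hg)]
    simp only [fwdDiff, sub_mul]

lemma inner_anisoLp (J k : Fin d → ℤ) {g : (Fin d → ℝ) → ℝ} (hg : MemLp g 2 volume) :
    inner ℝ (hφ.anisoLp J k) (hg.toLp g) = anisoCoeff φ g J k :=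
  hφ.inner_anisoLp_toLp J k hg

lemma hasSum_anisoCoeff_sq (J : Fin d → ℤ) {g : (Fin d → ℝ) → ℝ} (hg : MemLp g 2 volume) :
    HasSum (fun k => anisoCoeff φ g J k ^ 2)
      (‖(hφ.anisoSpace J).starProjection (hg.toLp g)‖ ^ 2) := by
  simp only [← hφ.inner_anisoLp _ _ hg]
  exact (hφ.orthonormal_anisoLp J).hasSum_inner_sq _

lemma norm_starProjection_sq_le (J : Fin d → ℤ) {g : (Fin d → ℝ) → ℝ} (hg : MemLp g 2 volume) :
    ‖(hφ.anisoSpace J).starProjection (hg.toLp g)‖ ^ 2 ≤ ∫ x, g x ^ 2 := by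
  rw [← norm_toLp_sq hg]
  exact pow_le_pow_left₀ (norm_nonneg _) (Submodule.norm_starProjection_apply_le _ _) 2

lemma coeFn_linearCombination_scaledLp (j : ℤ) (i : ℤ) (c : ℤ →₀ ℝ) :
    Finsupp.linearCombination ℝ (fun n => hφ.scaledLp j (i + n)) c
      =ᵐ[volume] fun x => Finsupp.linearCombination ℝ (fun n => scaled φ j (i + n) x) c := by
  rw [Finsupp.linearCombination_apply, Finsupp.sum]
  have h : ∀ n ∈ c.support, ∀ᵐ x, (c n • hφ.scaledLp j (i + n) : Lp ℝ 2 (volume : Measure ℝ)) x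
      = c n • scaled φ j (i + n) x := fun n _ => by
    filter_upwards [Lp.coeFn_smul (c n) (hφ.scaledLp j (i + n)), hφ.coeFn_scaledLp j (i + n)]
      with x h1 h2
    rw [h1, Pi.smul_apply, h2]
  filter_upwards [Lp.coeFn_finsetSum c.support fun n => c n • hφ.scaledLp j (i + n),
    (Finset.eventually_all c.support).2 h] with x h1 h2
  rw [h1, Finset.sum_apply, Finsupp.linearCombination_apply, Finsupp.sum]
  exact Finset.sum_congr rfl h2

/-- The detail functions of `exists_detail`, dilated and translated, in `L_2(ℝ)`. -/
lemma exists_detailLp (hr : 1 ≤ r) {N : ℕ} (hN : N ≤ r) (π : ℤ) :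
    ∃ c ρ b : ℤ →₀ ℝ,
      (∀ j i, hφ.scaledLp (j + 1) (2 * i + π)
          - Finsupp.linearCombination ℝ (fun n => hφ.scaledLp (j + 1) (2 * i + n)) ρ
        = Finsupp.linearCombination ℝ (fun n => hφ.scaledLp j (i + n)) c) ∧
      (∀ j i l, inner ℝ (hφ.scaledLp j l)
        (Finsupp.linearCombination ℝ (fun n => hφ.scaledLp (j + 1) (2 * i + n)) ρ) = 0) ∧
      ∀ a : ℤ → ℝ, Finsupp.linearCombination ℝ a ρ
        = Finsupp.linearCombination ℝ ((fwdDiff 1)^[N] a) b := by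
  obtain ⟨c, ρ, b, h1, h2, h3⟩ := hφ.exists_detail hr hN π
  have hone : ∀ j i x, Finsupp.linearCombination ℝ (fun n => scaled φ (j + 1) (2 * i + n) x) ρ
      = (2 : ℝ) ^ ((j : ℝ) / 2)
        * Finsupp.linearCombination ℝ (fun n => scaled φ 1 n (2 ^ j * x - i)) ρ :=
    fun j i x => by
      simp only [Finsupp.linearCombination_apply, Finsupp.sum, Finset.mul_sum,
        scaled_eq_scaled_one, smul_eq_mul, mul_left_comm]
  refine ⟨c, ρ, b, fun j i => Lp.ext ?_, fun j i l => ?_, h3⟩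
  · filter_upwards [Lp.coeFn_sub (hφ.scaledLp (j + 1) (2 * i + π))
      (Finsupp.linearCombination ℝ (fun n => hφ.scaledLp (j + 1) (2 * i + n)) ρ),
      hφ.coeFn_scaledLp (j + 1) (2 * i + π), hφ.coeFn_linearCombination_scaledLp (j + 1) (2 * i) ρ,
      hφ.coeFn_linearCombination_scaledLp j i c] with x e1 e2 e3 e4
    have hzero : Finsupp.linearCombination ℝ (fun n => scaled φ j (i + n) x) c
        = (2 : ℝ) ^ ((j : ℝ) / 2)
          * Finsupp.linearCombination ℝ (fun n => scaled φ 0 n (2 ^ j * x - i)) c := by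
      simp only [Finsupp.linearCombination_apply, Finsupp.sum, Finset.mul_sum,
        scaled_eq_scaled_zero, smul_eq_mul, mul_left_comm]
    rw [e1, Pi.sub_apply, e2, e3, e4, hone, hzero, scaled_eq_scaled_one, ← mul_sub, ← h1]
    congr 1
    ring
  · rw [L2.inner_def]
    have e : ∀ᵐ x, inner ℝ (hφ.scaledLp j l x)
        ((Finsupp.linearCombination ℝ (fun n => hφ.scaledLp (j + 1) (2 * i + n)) ρ :
          Lp ℝ 2 (volume : Measure ℝ)) x)
        = (2 : ℝ) ^ j * (fun y => (fun z => Finsupp.linearCombination ℝ (fun n => scaled φ 1 n z) ρ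
          * scaled φ 0 (l - i) z) (y - i)) (2 ^ j * x) := by
      filter_upwards [hφ.coeFn_scaledLp j l,
        hφ.coeFn_linearCombination_scaledLp (j + 1) (2 * i) ρ] with x e1 e2
      have := scaled_eq_scaled_zero (φ := φ) j i (l - i) x
      rw [add_sub_cancel] at this
      rw [e1, e2, hone, this, ← rpow_half_mul_self j]
      simp only [RCLike.inner_apply, conj_trivial]
      ring
    rw [integral_congr_ae e, integral_const_mul, Measure.integral_comp_mul_left
      (fun y => (fun z => Finsupp.linearCombination ℝ (fun n => scaled φ 1 n z) ρ
          * scaled φ 0 (l - i) z) (y - i)), integral_sub_right_eq_self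
      (fun z => Finsupp.linearCombination ℝ (fun n => scaled φ 1 n z) ρ
          * scaled φ 0 (l - i) z), h2, smul_zero, mul_zero]

/-- The components of the `anisoLp` of a resolution vector that are orthogonal to the space in which
coordinate `a` is one step coarser. Their inner products with `g` are finite combinations, depending
only on the parity of `k a`, of coefficients of the `N`-th difference of `g` in coordinate `a`. -/
lemma exists_aniso_detail (hr : 1 ≤ r) {N : ℕ} (hN : N ≤ r) :
    ∃ b : ℤ → ℤ →₀ ℝ, ∀ (J J' : Fin d → ℤ) (a : Fin d), J' = Function.update J a (J a + 1) →
      ∃ w : (Fin d → ℤ) → Lp ℝ 2 (volume : Measure (Fin d → ℝ)),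
        (∀ k, hφ.anisoLp J' k - w k ∈ hφ.anisoSpace J) ∧
        (∀ k l, inner ℝ (hφ.anisoLp J l) (w k) = 0) ∧
        ∀ k (g : (Fin d → ℝ) → ℝ) (hg : MemLp g 2 volume), inner ℝ (w k) (hg.toLp g)
          = ∑ n ∈ (b (k a % 2)).support, b (k a % 2) n
            * anisoCoeff φ ((fwdDiff (Pi.single a ((2 : ℝ) ^ (-(J a + 1)))))^[N] g) J'
              (Function.update k a (2 * (k a / 2) + n)) := by
  classical
  choose c ρ b h1 h2 h3 using fun π => hφ.exists_detailLp hr hN π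
  refine ⟨b, fun J J' a hJ' => ?_⟩
  have hJ'a : J' a = J a + 1 := by rw [hJ', Function.update_self]
  have hT : ∀ k m, tensorLpUpdate (fun ℓ => hφ.scaledLp (J ℓ) (k ℓ)) a (hφ.scaledLp (J a + 1) m)
      = hφ.anisoLp J' (Function.update k a m) := fun k m => by
    rw [tensorLpUpdate_apply]
    unfold anisoLp
    congr 1
    funext ℓ
    by_cases h : ℓ = a
    · subst h; simp only [Function.update_self, hJ'a]
    · rw [Function.update_of_ne h, Function.update_of_ne h, hJ', Function.update_of_ne h]
  have hT0 : ∀ k m, tensorLpUpdate (fun ℓ => hφ.scaledLp (J ℓ) (k ℓ)) a (hφ.scaledLp (J a) m)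
      = hφ.anisoLp J (Function.update k a m) := fun k m => by
    rw [tensorLpUpdate_apply]
    unfold anisoLp
    congr 1
    funext ℓ
    by_cases h : ℓ = a
    · subst h; simp only [Function.update_self]
    · rw [Function.update_of_ne h, Function.update_of_ne h]
  have hdiv : ∀ k : Fin d → ℤ, 2 * (k a / 2) + k a % 2 = k a := fun k => Int.mul_ediv_add_emod _ _
  have hek : ∀ k, hφ.anisoLp J' k = tensorLpUpdate (fun ℓ => hφ.scaledLp (J ℓ) (k ℓ)) a
      (hφ.scaledLp (J a + 1) (2 * (k a / 2) + k a % 2)) := fun k => by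
    rw [hT, hdiv, Function.update_eq_self]
  refine ⟨fun k => tensorLpUpdate (fun ℓ => hφ.scaledLp (J ℓ) (k ℓ)) a
    (Finsupp.linearCombination ℝ
      (fun n => hφ.scaledLp (J a + 1) (2 * (k a / 2) + n)) (ρ (k a % 2))),
    fun k => ?_, fun k l => ?_, fun k g hg => ?_⟩
  · rw [hek, ← map_sub, h1, Finsupp.linearCombination_apply, Finsupp.sum, map_sum]
    refine Submodule.sum_mem _ fun n _ => ?_
    rw [map_smul, hT0]
    exact Submodule.smul_mem _ _ (mem_closedSpan _ _)
  · beta_reduce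
    rw [tensorLpUpdate_apply]
    unfold anisoLp
    rw [inner_tensorLp]
    refine Finset.prod_eq_zero (Finset.mem_univ a) ?_
    rw [Function.update_self]
    exact h2 _ _ _ _
  · have e1 : inner ℝ (tensorLpUpdate (fun ℓ => hφ.scaledLp (J ℓ) (k ℓ)) a
          (Finsupp.linearCombination ℝ
            (fun n => hφ.scaledLp (J a + 1) (2 * (k a / 2) + n)) (ρ (k a % 2)))) (hg.toLp g)
        = Finsupp.linearCombination ℝ
          (fun n => anisoCoeff φ g J' (Function.update k a (2 * (k a / 2) + n)))
            (ρ (k a % 2)) := by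
      rw [Finsupp.linearCombination_apply, Finsupp.linearCombination_apply, Finsupp.sum,
        Finsupp.sum, map_sum, sum_inner]
      refine Finset.sum_congr rfl fun n _ => ?_
      rw [map_smul, hT, inner_smul_left, hφ.inner_anisoLp]
      rfl
    have e2 : (fwdDiff (1 : ℤ))^[N]
        (fun n => anisoCoeff φ g J' (Function.update k a (2 * (k a / 2) + n)))
        = fun n => anisoCoeff φ ((fwdDiff (Pi.single a ((2 : ℝ) ^ (-(J a + 1)))))^[N] g) J'
          (Function.update k a (2 * (k a / 2) + n)) := by
      funext n
      have e3 := congrFun (hφ.fwdDiff_iter_anisoCoeff J' k a N hg) (2 * (k a / 2) + n)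
      rw [hJ'a] at e3
      rw [← e3, fwdDiff_iter_eq_sum_shift, fwdDiff_iter_eq_sum_shift]
      simp only [add_assoc]
    rw [e1, h3, e2, Finsupp.linearCombination_apply, Finsupp.sum]
    rfl

/-- Refining the resolution of one coordinate by one step increases the squared norm of the
projection at most by a constant times the squared norm of the `N`-th difference of `g` in that
coordinate. -/
theorem exists_norm_sq_step_le (hr : 1 ≤ r) {N : ℕ} (hN : N ≤ r) :
    ∃ C : ℝ, 0 ≤ C ∧ ∀ (J J' : Fin d → ℤ) (a : Fin d), J' = Function.update J a (J a + 1) →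
      ∀ (g : (Fin d → ℝ) → ℝ) (hg : MemLp g 2 volume),
      ‖(hφ.anisoSpace J').starProjection (hg.toLp g)‖ ^ 2
        - ‖(hφ.anisoSpace J).starProjection (hg.toLp g)‖ ^ 2
      ≤ C * ∫ x, ((fwdDiff (Pi.single a ((2 : ℝ) ^ (-(J a + 1)))))^[N] g) x ^ 2 := by
  classical
  obtain ⟨b, hb⟩ := hφ.exists_aniso_detail (d := d) hr hN
  have hC : ∀ π, 0 ≤ (∑ n ∈ (b π).support, b π n ^ 2) * (b π).support.card := fun π =>
    mul_nonneg (Finset.sum_nonneg fun n _ => sq_nonneg _) (Nat.cast_nonneg _)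
  refine ⟨(∑ n ∈ (b 0).support, b 0 n ^ 2) * (b 0).support.card
    + (∑ n ∈ (b 1).support, b 1 n ^ 2) * (b 1).support.card, add_nonneg (hC 0) (hC 1),
    fun J J' a hJ' g hg => ?_⟩
  obtain ⟨w, hw1, hw2, hw3⟩ := hb J J' a hJ'
  have hwg := fun k => hw3 k g hg
  have hGm : MemLp ((fwdDiff (Pi.single a ((2 : ℝ) ^ (-(J a + 1)))))^[N] g) 2 volume :=
    memLp_fwdDiff_iter hg _ _
  generalize (fwdDiff (Pi.single a ((2 : ℝ) ^ (-(J a + 1)))))^[N] g = G at hwg hGm ⊢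
  have hle : hφ.anisoSpace J ≤ hφ.anisoSpace J' := by
    rw [hJ']; exact hφ.anisoSpace_le_update_succ J a
  have hnested : HasSum (fun k => inner ℝ (w k) (hg.toLp g) ^ 2)
      (‖(hφ.anisoSpace J').starProjection (hg.toLp g)‖ ^ 2
        - ‖(hφ.anisoSpace J).starProjection (hg.toLp g)‖ ^ 2) :=
    hasSum_inner_sq_of_nested (hφ.orthonormal_anisoLp J') hle hw1 hw2 (hg.toLp g)
  have hDsum := hφ.hasSum_anisoCoeff_sq J' hGm
  have hZle := hφ.norm_starProjection_sq_le J' hGm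
  generalize ‖(hφ.anisoSpace J').starProjection (hGm.toLp G)‖ ^ 2 = Z at hDsum hZle
  generalize anisoCoeff φ G J' = D at hwg hDsum
  have hnn : ∀ (π : ℤ) (k : Fin d → ℤ), 0 ≤ (∑ n ∈ (b π).support, b π n ^ 2)
      * ∑ n ∈ (b π).support, D (k + Pi.single a (n - π)) ^ 2 := fun π k =>
    mul_nonneg (Finset.sum_nonneg fun n _ => sq_nonneg _) (Finset.sum_nonneg fun n _ => sq_nonneg _)
  have hbound : ∀ k, inner ℝ (w k) (hg.toLp g) ^ 2
      ≤ (∑ n ∈ (b 0).support, b 0 n ^ 2)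
          * ∑ n ∈ (b 0).support, D (k + Pi.single a (n - 0)) ^ 2
        + (∑ n ∈ (b 1).support, b 1 n ^ 2)
          * ∑ n ∈ (b 1).support, D (k + Pi.single a (n - 1)) ^ 2 := fun k => by
    have hdiv := Int.mul_ediv_add_emod (k a) 2
    have h := sq_sum_shift_le (b (k a % 2)) D k a hdiv
    rw [← hwg] at h
    rcases Int.emod_two_eq_zero_or_one (k a) with h2 | h2 <;> rw [h2] at h
    · linarith [hnn 1 k]
    · linarith [hnn 0 k]
  have hshift : ∀ π : ℤ, HasSum (fun k : Fin d → ℤ => (∑ n ∈ (b π).support, b π n ^ 2)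
      * ∑ n ∈ (b π).support, D (k + Pi.single a (n - π)) ^ 2)
      ((∑ n ∈ (b π).support, b π n ^ 2) * ∑ n ∈ (b π).support, Z) := fun π =>
    (hasSum_sum fun n _ =>
      (Equiv.hasSum_iff (Equiv.addRight (Pi.single a (n - π) : Fin d → ℤ))).2 hDsum).mul_left _
  have hsum := hasSum_le hbound hnested ((hshift 0).add (hshift 1))
  rw [Finset.sum_const, Finset.sum_const, nsmul_eq_mul, nsmul_eq_mul, ← mul_assoc,
    ← mul_assoc] at hsum
  have h0 := mul_le_mul_of_nonneg_left hZle (hC 0)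
  have h1 := mul_le_mul_of_nonneg_left hZle (hC 1)
  rw [add_mul]
  exact hsum.trans (add_le_add h0 h1)

end IsRegularScalingFunction

end WaveletICA

end Jackson

/-! ### Rate of approximation with equal resolutions -/

section JacksonConst

namespace WaveletICA

variable {d r : ℕ} {φ : ℝ → ℝ}

namespace IsRegularScalingFunction

variable (hφ : IsRegularScalingFunction r φ)
include hφ

/-- Refining all coordinates by one step. -/
lemma exists_norm_sq_succ_le (hr : 1 ≤ r) {N : ℕ} (hN : N ≤ r) :
    ∃ C : ℝ, 0 ≤ C ∧ ∀ (g : (Fin d → ℝ) → ℝ) (hg : MemLp g 2 volume) (j : ℤ) (D : ℝ),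
      (∀ a : Fin d, ∫ x, ((fwdDiff (Pi.single a ((2 : ℝ) ^ (-(j + 1)))))^[N] g) x ^ 2 ≤ D) →
      ‖(hφ.anisoSpace fun _ : Fin d => j + 1).starProjection (hg.toLp g)‖ ^ 2
        - ‖(hφ.anisoSpace fun _ : Fin d => j).starProjection (hg.toLp g)‖ ^ 2 ≤ C * D := by
  classical
  obtain ⟨C, hC, h⟩ := hφ.exists_norm_sq_step_le (d := d) hr hN
  refine ⟨d * C, by positivity, fun g hg j D hD => ?_⟩
  have hS : ∀ S : Finset (Fin d),
      ‖(hφ.anisoSpace fun ℓ : Fin d => if ℓ ∈ S then j + 1 else j).starProjection (hg.toLp g)‖ ^ 2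
        - ‖(hφ.anisoSpace fun _ : Fin d => j).starProjection (hg.toLp g)‖ ^ 2
      ≤ S.card * (C * D) := by
    intro S
    induction S using Finset.induction_on with
    | empty => simp
    | insert a S ha ih =>
      have hstep := h (fun ℓ => if ℓ ∈ S then j + 1 else j)
        (fun ℓ => if ℓ ∈ insert a S then j + 1 else j) a (by
          funext ℓ
          by_cases hℓ : ℓ = a
          · subst hℓ; simp [ha]
          · simp [hℓ]) g hg
      simp only [if_neg ha] at hstep
      have h2 := mul_le_mul_of_nonneg_left (hD a) hC
      rw [Finset.card_insert_of_notMem ha]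
      push_cast
      linarith
  have := hS Finset.univ
  simp only [Finset.mem_univ, if_true, Finset.card_univ, Fintype.card_fin] at this
  rw [mul_assoc]
  exact this

/-- Approximation error of the tensor product multiresolution analysis: if the `N`-th differences
of `g` with steps `2^{-(i+1)}` along the axes have squared norm at most `B q^i`, then the squared
distance from `g` to the space of resolution `j` is of the order of `B q^j`. -/
theorem exists_approximation_error_le (hr : 1 ≤ r) {N : ℕ} (hN : N ≤ r) :
    ∃ C : ℝ, 0 ≤ C ∧ ∀ (g : (Fin d → ℝ) → ℝ), MemLp g 2 volume → ∀ (B q : ℝ), 0 ≤ q → q < 1 →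
      (∀ (a : Fin d) (i : ℕ),
        ∫ x, ((fwdDiff (Pi.single a ((2 : ℝ) ^ (-((i : ℤ) + 1)))))^[N] g) x ^ 2 ≤ B * q ^ i) →
      ∀ j : ℕ, ∑' k, anisoCoeff φ g (fun _ => (j : ℤ)) k ^ 2 ≤ ∫ x, g x ^ 2 ∧
        (∫ x, g x ^ 2) - ∑' k, anisoCoeff φ g (fun _ => (j : ℤ)) k ^ 2 ≤ C * B / (1 - q) * q ^ j := by
  obtain ⟨C, hC, h⟩ := hφ.exists_norm_sq_succ_le (d := d) hr hN
  refine ⟨C, hC, fun g hg B q hq0 hq1 hB j => ?_⟩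
  rw [(hφ.hasSum_anisoCoeff_sq (fun _ => (j : ℤ)) hg).tsum_eq]
  refine ⟨hφ.norm_starProjection_sq_le _ hg, ?_⟩
  set S : ℕ → ℝ := fun j =>
    ‖(hφ.anisoSpace fun _ : Fin d => (j : ℤ)).starProjection (hg.toLp g)‖ ^ 2 with hS
  have hstep : ∀ i, S (i + 1) - S i ≤ C * (B * q ^ i) := fun i => by
    have := h g hg i (B * q ^ i) fun a => hB a i
    simp only [hS]
    push_cast
    exact this
  have hq : 0 < 1 - q := by linarith
  have htel : ∀ m, S (j + m) - S j ≤ C * B / (1 - q) * q ^ j * (1 - q ^ m) := by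
    intro m
    induction m with
    | zero => simp
    | succ m ih =>
      have := hstep (j + m)
      rw [← add_assoc]
      have e : C * B / (1 - q) * q ^ j * (1 - q ^ (m + 1))
          = C * B / (1 - q) * q ^ j * (1 - q ^ m) + C * (B * q ^ (j + m)) := by
        field_simp
        ring
      linarith
  have hlim : Tendsto (fun m => S (j + m) - S j) atTop (nhds ((∫ x, g x ^ 2) - S j)) := by
    have h1 : Tendsto S atTop (nhds (∫ x, g x ^ 2)) := by
      rw [← norm_toLp_sq hg]
      exact ((hφ.tendsto_starProjection_anisoSpace (hg.toLp g)).norm).pow 2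
    have h2 : Tendsto (fun m => S (j + m)) atTop (nhds (∫ x, g x ^ 2)) := by
      simpa only [add_comm j] using (tendsto_add_atTop_iff_nat j).2 h1
    exact h2.sub_const _
  have hlim2 : Tendsto (fun m => C * B / (1 - q) * q ^ j * (1 - q ^ m)) atTop
      (nhds (C * B / (1 - q) * q ^ j * (1 - 0))) :=
    ((tendsto_pow_atTop_nhds_zero_of_lt_one hq0 hq1).const_sub 1).const_mul _
  have := le_of_tendsto_of_tendsto' hlim hlim2 htel
  simpa using this

end IsRegularScalingFunction

end WaveletICA

end JacksonConst

/-! ### Marginals of compactly supported functions -/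

section Marginal

namespace WaveletICA

variable {d : ℕ}

/-- The point of `ℝ^d` with `ℓ`-th coordinate `t` and remaining coordinates `y`. -/
def glue (ℓ : Fin d) (t : ℝ) (y : {i : Fin d // i ≠ ℓ} → ℝ) : Fin d → ℝ :=
  fun i => if h : i = ℓ then t else y ⟨i, h⟩

lemma marginal_eq (f : (Fin d → ℝ) → ℝ) (ℓ : Fin d) (t : ℝ) :
    marginal f ℓ t = ∫ y, f (glue ℓ t y) := rfl

lemma glue_self (ℓ : Fin d) (t : ℝ) (y : {i : Fin d // i ≠ ℓ} → ℝ) : glue ℓ t y ℓ = t := by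
  simp [glue]

lemma glue_add_single (ℓ : Fin d) (t h : ℝ) (y : {i : Fin d // i ≠ ℓ} → ℝ) :
    glue ℓ t y + Pi.single ℓ h = glue ℓ (t + h) y := by
  funext i
  by_cases hi : i = ℓ
  · subst hi; simp [glue]
  · simp [glue, hi]

lemma measurePreserving_glue (ℓ : Fin d) :
    MeasurePreserving (fun q : ℝ × ({i : Fin d // i ≠ ℓ} → ℝ) => glue ℓ q.1 q.2)
      (volume.prod volume) volume := by
  have h1 : MeasurePreserving (MeasurableEquiv.piEquivPiSubtypeProd (fun _ : Fin d => ℝ) (· = ℓ)).symm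
      ((volume : Measure ({i : Fin d // i = ℓ} → ℝ)).prod volume) volume := by
    convert (volume_preserving_piEquivPiSubtypeProd (fun _ : Fin d => ℝ) (· = ℓ)).symm
    · rfl
    · rw [Measure.volume_eq_prod]
      congr!
  -- `convert` reconciles the two `Fintype` instances on the one-point index type
  have h2 : MeasurePreserving (MeasurableEquiv.funUnique {i : Fin d // i = ℓ} ℝ).symm
      volume volume := by
    convert (volume_preserving_funUnique {i : Fin d // i = ℓ} ℝ).symm
  exact h1.comp (h2.prod (MeasurePreserving.id (volume : Measure ({i : Fin d // i ≠ ℓ} → ℝ))))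

lemma measurable_glue (ℓ : Fin d) :
    Measurable fun q : ℝ × ({i : Fin d // i ≠ ℓ} → ℝ) => glue ℓ q.1 q.2 :=
  (measurePreserving_glue ℓ).measurable

lemma measurable_marginal {f : (Fin d → ℝ) → ℝ} (hf : Measurable f) (ℓ : Fin d) :
    Measurable (marginal f ℓ) := by
  have h : StronglyMeasurable fun q : ℝ × ({i : Fin d // i ≠ ℓ} → ℝ) => f (glue ℓ q.1 q.2) :=
    (hf.comp (measurable_glue ℓ)).stronglyMeasurable
  exact h.integral_prod_right.measurable

lemma integrable_glue {f : (Fin d → ℝ) → ℝ} (hf : Integrable f) (ℓ : Fin d) :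
    Integrable (fun q : ℝ × ({i : Fin d // i ≠ ℓ} → ℝ) => f (glue ℓ q.1 q.2))
      (volume.prod volume) :=
  (measurePreserving_glue ℓ).integrable_comp_of_integrable hf

/-- Integrating a function of the coordinate `x^ℓ` against `f` amounts to integrating it against
the marginal. -/
lemma integral_marginal_mul {f : (Fin d → ℝ) → ℝ} (hm : Measurable f) (hf : Integrable f)
    (ℓ : Fin d) {ψ : ℝ → ℝ} (hψ : Measurable ψ) {C : ℝ} (hC : ∀ t, ‖ψ t‖ ≤ C) :
    ∫ t, marginal f ℓ t * ψ t = ∫ x, f x * ψ (x ℓ) := by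
  have hi : Integrable fun x : Fin d → ℝ => f x * ψ (x ℓ) := by
    have := hf.bdd_mul (c := C) (f := fun x : Fin d → ℝ => ψ (x ℓ))
      (hψ.comp (measurable_pi_apply ℓ)).aestronglyMeasurable (ae_of_all _ fun x => hC _)
    simpa only [mul_comm] using this
  have h1 := integral_prod _ (integrable_glue hi ℓ)
  have h2 := integral_map (μ := (volume : Measure ℝ).prod
    (volume : Measure ({i : Fin d // i ≠ ℓ} → ℝ))) (measurable_glue ℓ).aemeasurable
    (f := fun x : Fin d → ℝ => f x * ψ (x ℓ))
    (hm.mul (hψ.comp (measurable_pi_apply ℓ))).aestronglyMeasurable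
  rw [(measurePreserving_glue ℓ).map_eq] at h2
  rw [h2, h1]
  refine integral_congr_ae (ae_of_all _ fun t => ?_)
  simp only [glue_self, marginal_eq]
  rw [integral_mul_const]

/-- By the Cauchy-Schwarz inequality on the fibres, the marginal of a function supported in a cube
is controlled in `L_2` by the function. -/
lemma lintegral_marginal_sq_le {u : (Fin d → ℝ) → ℝ} (hu : Measurable u) {R : ℝ}
    (hR : ∀ x, u x ≠ 0 → ∀ i, |x i| ≤ R) (ℓ : Fin d) :
    ∫⁻ t, ‖marginal u ℓ t‖ₑ ^ 2 ≤ ENNReal.ofReal (2 * R) ^ (d - 1) * ∫⁻ x, ‖u x‖ₑ ^ 2 := by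
  set Q : Set ({i : Fin d // i ≠ ℓ} → ℝ) := Set.pi Set.univ fun _ => Set.Icc (-R) R with hQ
  have hQm : MeasurableSet Q := MeasurableSet.univ_pi fun _ => measurableSet_Icc
  have hQv : volume Q = ENNReal.ofReal (2 * R) ^ (d - 1) := by
    rw [hQ, volume_pi_pi]
    simp only [Real.volume_Icc, Finset.prod_const, Finset.card_univ]
    congr 1
    · congr 1; ring
    · rw [Fintype.card_subtype_compl]; simp
  have hpt : ∀ t, ‖marginal u ℓ t‖ₑ ^ 2
      ≤ ENNReal.ofReal (2 * R) ^ (d - 1) * ∫⁻ y, ‖u (glue ℓ t y)‖ₑ ^ 2 := fun t => by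
    have hmeas : Measurable fun y => u (glue ℓ t y) :=
      hu.comp ((measurable_glue ℓ).comp measurable_prodMk_left)
    have h1 : ‖marginal u ℓ t‖ₑ ≤ ∫⁻ y, ‖u (glue ℓ t y)‖ₑ := enorm_integral_le_lintegral_enorm _
    have h2 : ∫⁻ y, ‖u (glue ℓ t y)‖ₑ
        = ∫⁻ y, ((fun y => ‖u (glue ℓ t y)‖ₑ) * Q.indicator fun _ => (1 : ℝ≥0∞)) y := by
      refine lintegral_congr fun y => ?_
      rw [Pi.mul_apply]
      by_cases hy : y ∈ Q
      · rw [Set.indicator_of_mem hy, mul_one]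
      · rw [Set.indicator_of_notMem hy, mul_zero, enorm_eq_zero]
        by_contra hne
        refine hy fun i _ => ?_
        have := hR _ hne i
        simp only [glue, dif_neg i.2] at this
        exact Set.mem_Icc.2 (abs_le.1 this)
    have h3 := ENNReal.lintegral_mul_le_Lp_mul_Lq volume Real.HolderConjugate.two_two
      hmeas.enorm.aemeasurable ((measurable_const (a := (1 : ℝ≥0∞))).indicator hQm).aemeasurable
    have h4 : ∫⁻ y, (Q.indicator fun _ => (1 : ℝ≥0∞)) y ^ (2 : ℝ) = volume Q := by
      rw [← lintegral_indicator_one hQm]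
      refine lintegral_congr fun y => ?_
      by_cases hy : y ∈ Q <;> simp [hy]
    rw [← h2, h4] at h3
    have h5 := pow_le_pow_left' (h1.trans h3) 2
    refine h5.trans (le_of_eq ?_)
    rw [mul_pow, ← ENNReal.rpow_natCast, ← ENNReal.rpow_natCast, ← ENNReal.rpow_mul,
      ← ENNReal.rpow_mul, hQv, mul_comm]
    norm_num
  calc ∫⁻ t, ‖marginal u ℓ t‖ₑ ^ 2
      ≤ ∫⁻ t, ENNReal.ofReal (2 * R) ^ (d - 1) * ∫⁻ y, ‖u (glue ℓ t y)‖ₑ ^ 2 :=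
        lintegral_mono hpt
    _ = ENNReal.ofReal (2 * R) ^ (d - 1) * ∫⁻ t, ∫⁻ y, ‖u (glue ℓ t y)‖ₑ ^ 2 :=
        lintegral_const_mul' _ _ (ENNReal.pow_ne_top ENNReal.ofReal_ne_top)
    _ = _ := by
        rw [← (measurePreserving_glue ℓ).lintegral_comp (hu.enorm.pow_const 2),
          lintegral_prod (fun q : ℝ × ({i : Fin d // i ≠ ℓ} → ℝ) => ‖u (glue ℓ q.1 q.2)‖ₑ ^ 2)
            ((hu.enorm.pow_const 2).comp (measurable_glue ℓ)).aemeasurable]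

lemma lintegral_enorm_sq_eq {α : Type*} [MeasurableSpace α] {μ : Measure α} {u : α → ℝ}
    (hu : MemLp u 2 μ) : ∫⁻ x, ‖u x‖ₑ ^ 2 ∂μ = ENNReal.ofReal (∫ x, u x ^ 2 ∂μ) := by
  rw [ofReal_integral_eq_lintegral_ofReal hu.integrable_sq (ae_of_all _ fun x => sq_nonneg _)]
  refine lintegral_congr fun x => ?_
  rw [← sq_abs, ENNReal.ofReal_pow (abs_nonneg _), ← Real.norm_eq_abs, ofReal_norm]

lemma memLp_marginal {u : (Fin d → ℝ) → ℝ} (hu : Measurable u) (h2 : MemLp u 2 volume) {R : ℝ}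
    (hR : ∀ x, u x ≠ 0 → ∀ i, |x i| ≤ R) (ℓ : Fin d) :
    MemLp (marginal u ℓ) 2 volume := by
  rw [memLp_two_iff_integrable_sq (measurable_marginal hu ℓ).aestronglyMeasurable]
  refine ⟨((measurable_marginal hu ℓ).pow_const 2).aestronglyMeasurable, ?_⟩
  have h := lintegral_marginal_sq_le hu hR ℓ
  rw [lintegral_enorm_sq_eq h2] at h
  have e : ∀ t, ‖marginal u ℓ t ^ 2‖ₑ = ‖marginal u ℓ t‖ₑ ^ 2 := fun t => enorm_pow _ _
  rw [HasFiniteIntegral]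
  simp only [e]
  exact h.trans_lt (ENNReal.mul_lt_top (ENNReal.pow_lt_top ENNReal.ofReal_lt_top)
    ENNReal.ofReal_lt_top)

lemma integral_marginal_sq_le {u : (Fin d → ℝ) → ℝ} (hu : Measurable u) (h2 : MemLp u 2 volume)
    {R : ℝ} (hR0 : 0 ≤ R) (hR : ∀ x, u x ≠ 0 → ∀ i, |x i| ≤ R) (ℓ : Fin d) :
    ∫ t, marginal u ℓ t ^ 2 ≤ (2 * R) ^ (d - 1) * ∫ x, u x ^ 2 := by
  have h := lintegral_marginal_sq_le hu hR ℓ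
  rw [lintegral_enorm_sq_eq h2, lintegral_enorm_sq_eq (memLp_marginal hu h2 hR ℓ),
    ← ENNReal.ofReal_pow (by positivity), ← ENNReal.ofReal_mul (by positivity)] at h
  exact (ENNReal.ofReal_le_ofReal_iff (mul_nonneg (by positivity)
    (integral_nonneg fun _ => sq_nonneg _))).1 h

lemma fwdDiff_congr_ae {f g : ℝ → ℝ} (h : f =ᵐ[volume] g) (v : ℝ) :
    fwdDiff v f =ᵐ[volume] fwdDiff v g := by
  have h2 := (measurePreserving_add_right (volume : Measure ℝ) v).quasiMeasurePreserving.ae h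
  filter_upwards [h, h2] with x h1 h2
  simp only [fwdDiff, h1, h2]

lemma fwdDiff_iter_congr_ae {f g : ℝ → ℝ} (h : f =ᵐ[volume] g) (v : ℝ) (N : ℕ) :
    (fwdDiff v)^[N] f =ᵐ[volume] (fwdDiff v)^[N] g := by
  induction N generalizing f g with
  | zero => exact h
  | succ N ih => exact ih (fwdDiff_congr_ae h v)

/-- Taking the marginal commutes with differences along the axis. The identity holds only almost
everywhere, as the integral over a fibre on which the function is not integrable is zero by
convention. -/
lemma marginal_fwdDiff {u : (Fin d → ℝ) → ℝ} (hu : Integrable u) (ℓ : Fin d) (h : ℝ) :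
    marginal (fwdDiff (Pi.single ℓ h) u) ℓ =ᵐ[volume] fwdDiff h (marginal u ℓ) := by
  have h1 := (integrable_glue hu ℓ).prod_right_ae
  have h2 := (measurePreserving_add_right (volume : Measure ℝ) h).quasiMeasurePreserving.ae h1
  filter_upwards [h1, h2] with t ht1 ht2
  rw [marginal_eq, fwdDiff, marginal_eq, marginal_eq]
  rw [← integral_sub ht2 ht1]
  refine integral_congr_ae (ae_of_all _ fun y => ?_)
  simp only [fwdDiff, glue_add_single]

lemma integrable_fwdDiff {u : (Fin d → ℝ) → ℝ} (hu : Integrable u) (v : Fin d → ℝ) :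
    Integrable (fwdDiff v u) := (hu.comp_add_right v).sub hu

lemma marginal_fwdDiff_iter {u : (Fin d → ℝ) → ℝ} (hu : Integrable u) (ℓ : Fin d) (h : ℝ)
    (N : ℕ) : marginal ((fwdDiff (Pi.single ℓ h))^[N] u) ℓ
      =ᵐ[volume] (fwdDiff h)^[N] (marginal u ℓ) := by
  induction N generalizing u with
  | zero => rfl
  | succ N ih =>
    rw [Function.iterate_succ_apply, Function.iterate_succ_apply]
    exact (ih (integrable_fwdDiff hu _)).trans
      (fwdDiff_iter_congr_ae (marginal_fwdDiff hu ℓ h) h N)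

lemma measurable_fwdDiff_iter {u : (Fin d → ℝ) → ℝ} (hu : Measurable u) (v : Fin d → ℝ) (N : ℕ) :
    Measurable ((fwdDiff v)^[N] u) := by
  induction N generalizing u with
  | zero => exact hu
  | succ N ih =>
    rw [Function.iterate_succ_apply]
    exact ih ((hu.comp (measurable_id.add_const v)).sub hu)

lemma support_fwdDiff_iter {u : (Fin d → ℝ) → ℝ} {R : ℝ} (hR : ∀ x, u x ≠ 0 → ∀ i, |x i| ≤ R)
    (ℓ : Fin d) (h : ℝ) (N : ℕ) :
    ∀ x, ((fwdDiff (Pi.single ℓ h))^[N] u) x ≠ 0 → ∀ i, |x i| ≤ R + N * |h| := by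
  induction N generalizing u R with
  | zero => simpa using hR
  | succ N ih =>
    intro x hx i
    rw [Function.iterate_succ_apply] at hx
    have hstep : ∀ x, fwdDiff (Pi.single ℓ h) u x ≠ 0 → ∀ i, |x i| ≤ R + |h| := by
      intro x hx i
      have hcase : u (x + Pi.single ℓ h) ≠ 0 ∨ u x ≠ 0 := by
        by_contra! hcon
        exact hx (by simp [fwdDiff, hcon.1, hcon.2])
      rcases hcase with hc | hc
      · have h1 := hR _ hc i
        have h2 : |(Pi.single ℓ h : Fin d → ℝ) i| ≤ |h| := by
          by_cases hi : i = ℓ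
          · subst hi; simp
          · simp [hi]
        have h3 := abs_sub (x i + (Pi.single ℓ h : Fin d → ℝ) i) ((Pi.single ℓ h : Fin d → ℝ) i)
        rw [add_sub_cancel_right] at h3
        exact h3.trans (add_le_add h1 h2)
      · exact (hR _ hc i).trans (le_add_of_nonneg_right (abs_nonneg _))
    have := ih hstep x hx i
    push_cast
    linarith

lemma fwdDiff_iter_tensor (u : Fin d → ℝ → ℝ) (a : Fin d) (h : ℝ) (N : ℕ) :
    (fwdDiff (Pi.single a h))^[N] (tensor u)
      = tensor (Function.update u a ((fwdDiff h)^[N] (u a))) := by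
  induction N generalizing u with
  | zero => simp
  | succ N ih =>
    have h1 : fwdDiff (Pi.single a h) (tensor u)
        = tensor (Function.update u a (fwdDiff h (u a))) := by
      funext x
      have e : ∀ x, tensor u x = tensor (Function.update u a (u a)) x := by simp
      rw [fwdDiff, e, e, tensor_update, tensor_update, tensor_update]
      have e2 : ∏ ℓ ∈ Finset.univ.erase a, u ℓ ((x + Pi.single a h : Fin d → ℝ) ℓ)
          = ∏ ℓ ∈ Finset.univ.erase a, u ℓ (x ℓ) := by
        refine Finset.prod_congr rfl fun ℓ hℓ => ?_
        simp [Finset.ne_of_mem_erase hℓ]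
      rw [e2, ← sub_mul]
      simp [fwdDiff]
    rw [Function.iterate_succ_apply, h1, ih, Function.update_idem, Function.update_self,
      Function.iterate_succ_apply]

lemma fwdDiff_iter_sub' {M : Type*} [AddCommMonoid M] (f g : M → ℝ) (v : M) (N : ℕ) :
    (fwdDiff v)^[N] (f - g) = (fwdDiff v)^[N] f - (fwdDiff v)^[N] g := by
  induction N generalizing f g with
  | zero => rfl
  | succ N ih =>
    have : fwdDiff v (f - g) = fwdDiff v f - fwdDiff v g := by
      funext x; simp only [fwdDiff, Pi.sub_apply]; ring
    simp only [Function.iterate_succ_apply, this, ih]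

end WaveletICA

end Marginal

/-! ### The bias of the contrast -/

section Bias

namespace WaveletICA

variable {d : ℕ}

/-- The densities supported in the cube `[-R, R]^d`, with squared `L_2` norm at most `P`, whose
`N`-th differences of step `h ≤ 1` along the axes have squared `L_2` norm at most `S h^{2s}`. -/
structure InSmoothClass (N : ℕ) (s R P S : ℝ) (p : (Fin d → ℝ) → ℝ) : Prop where
  isDensity : IsDensity p
  support_subset : ∀ x, p x ≠ 0 → ∀ i, |x i| ≤ R
  memLp : MemLp p 2 volume
  integral_sq_le : ∫ x, p x ^ 2 ≤ P
  integral_fwdDiff_sq_le : ∀ (a : Fin d) (h : ℝ), 0 < h → h ≤ 1 →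
    ∫ x, ((fwdDiff (Pi.single a h))^[N] p) x ^ 2 ≤ S * h ^ (2 * s)

lemma marginalProd_eq_tensor (p : (Fin d → ℝ) → ℝ) : marginalProd p = tensor (marginal p) := rfl

lemma integral_tensor_sq (u : Fin d → ℝ → ℝ) :
    ∫ x, tensor u x ^ 2 = ∏ ℓ, ∫ t, u ℓ t ^ 2 := by
  simp only [sq]
  exact integral_tensor_mul_tensor u u

lemma integral_sub_sq_le {α : Type*} [MeasurableSpace α] {μ : Measure α} {u v : α → ℝ}
    (hu : MemLp u 2 μ) (hv : MemLp v 2 μ) :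
    ∫ x, (u - v) x ^ 2 ∂μ ≤ 2 * ∫ x, u x ^ 2 ∂μ + 2 * ∫ x, v x ^ 2 ∂μ := by
  rw [← integral_const_mul, ← integral_const_mul, ← integral_add
    (hu.integrable_sq.const_mul 2) (hv.integrable_sq.const_mul 2)]
  refine integral_mono (hu.sub hv).integrable_sq
    ((hu.integrable_sq.const_mul 2).add (hv.integrable_sq.const_mul 2)) fun x => ?_
  simp only [Pi.sub_apply]
  nlinarith [sq_nonneg (u x + v x)]

namespace InSmoothClass

variable {N : ℕ} {s R P S : ℝ} {p : (Fin d → ℝ) → ℝ}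

lemma memLp_marginalProd (hp : InSmoothClass N s R P S p) : MemLp (marginalProd p) 2 volume :=
  memLp_tensor (measurable_marginal hp.isDensity.measurable)
    (memLp_marginal hp.isDensity.measurable hp.memLp hp.support_subset)

lemma integral_marginal_sq_le (hp : InSmoothClass N s R P S p) (hR : 0 ≤ R) (ℓ : Fin d) :
    ∫ t, marginal p ℓ t ^ 2 ≤ (2 * R) ^ (d - 1) * P :=
  (WaveletICA.integral_marginal_sq_le hp.isDensity.measurable hp.memLp hR hp.support_subset
    ℓ).trans (mul_le_mul_of_nonneg_left hp.integral_sq_le (by positivity))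

lemma integral_marginalProd_sq_le (hp : InSmoothClass N s R P S p) (hR : 0 ≤ R) :
    ∫ x, marginalProd p x ^ 2 ≤ ((2 * R) ^ (d - 1) * P) ^ d := by
  rw [marginalProd_eq_tensor, integral_tensor_sq]
  refine (Finset.prod_le_prod (fun _ _ => integral_nonneg fun _ => sq_nonneg _)
    fun ℓ _ => hp.integral_marginal_sq_le hR ℓ).trans (le_of_eq ?_)
  simp

/-- The product of the marginals is as smooth along the axes as the density itself. -/
lemma integral_fwdDiff_marginalProd_sq_le (hp : InSmoothClass N s R P S p) (hR : 0 ≤ R)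
    (a : Fin d) {h : ℝ} (h0 : 0 < h) (h1 : h ≤ 1) :
    ∫ x, ((fwdDiff (Pi.single a h))^[N] (marginalProd p)) x ^ 2
      ≤ (2 * (R + N)) ^ (d - 1) * (S * h ^ (2 * s)) * ((2 * R) ^ (d - 1) * P) ^ (d - 1) := by
  have hm := measurable_fwdDiff_iter hp.isDensity.measurable (Pi.single a h) N
  have hRN : ∀ x, ((fwdDiff (Pi.single a h))^[N] p) x ≠ 0 → ∀ i, |x i| ≤ R + N := fun x hx i => by
    refine (support_fwdDiff_iter hp.support_subset a h N x hx i).trans ?_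
    rw [abs_of_pos h0]
    have : (N : ℝ) * h ≤ N := mul_le_of_le_one_right (Nat.cast_nonneg _) h1
    linarith
  have hA : ∫ t, ((fwdDiff h)^[N] (marginal p a)) t ^ 2
      ≤ (2 * (R + N)) ^ (d - 1) * (S * h ^ (2 * s)) := by
    have e : ∫ t, ((fwdDiff h)^[N] (marginal p a)) t ^ 2
        = ∫ t, marginal ((fwdDiff (Pi.single a h))^[N] p) a t ^ 2 := by
      refine integral_congr_ae ?_
      filter_upwards [marginal_fwdDiff_iter hp.isDensity.integrable a h N] with t ht
      rw [ht]
    rw [e]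
    refine (WaveletICA.integral_marginal_sq_le hm (memLp_fwdDiff_iter hp.memLp _ N)
      (by positivity) hRN a).trans ?_
    exact mul_le_mul_of_nonneg_left (hp.integral_fwdDiff_sq_le a h h0 h1) (by positivity)
  rw [marginalProd_eq_tensor, fwdDiff_iter_tensor, integral_tensor_sq,
    ← Finset.mul_prod_erase _ _ (Finset.mem_univ a), Function.update_self]
  have hB : ∏ ℓ ∈ Finset.univ.erase a,
      ∫ t, Function.update (marginal p) a ((fwdDiff h)^[N] (marginal p a)) ℓ t ^ 2
      ≤ ((2 * R) ^ (d - 1) * P) ^ (d - 1) := by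
    have hcard : (Finset.univ.erase a).card = d - 1 := by simp
    rw [← hcard, ← Finset.prod_const]
    refine Finset.prod_le_prod (fun _ _ => integral_nonneg fun _ => sq_nonneg _) fun ℓ hℓ => ?_
    rw [Function.update_of_ne (Finset.ne_of_mem_erase hℓ), hcard]
    exact hp.integral_marginal_sq_le hR ℓ
  exact mul_le_mul hA hB (Finset.prod_nonneg fun _ _ => integral_nonneg fun _ => sq_nonneg _)
    ((integral_nonneg fun _ => sq_nonneg _).trans hA)

lemma memLp_sub_marginalProd (hp : InSmoothClass N s R P S p) :
    MemLp (p - marginalProd p) 2 volume := hp.memLp.sub hp.memLp_marginalProd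

lemma depNorm_sq (hp : InSmoothClass N s R P S p) :
    depNorm p ^ 2 = ∫ x, (p - marginalProd p) x ^ 2 := by
  have h := hp.memLp_sub_marginalProd
  rw [← norm_toLp_sq h, Lp.norm_toLp]
  rfl

lemma depNorm_sq_le (hp : InSmoothClass N s R P S p) (hR : 0 ≤ R) :
    depNorm p ^ 2 ≤ 2 * P + 2 * ((2 * R) ^ (d - 1) * P) ^ d := by
  rw [hp.depNorm_sq]
  refine (integral_sub_sq_le hp.memLp hp.memLp_marginalProd).trans ?_
  have h1 := hp.integral_sq_le
  have h2 := hp.integral_marginalProd_sq_le hR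
  linarith

variable {r : ℕ} {φ : ℝ → ℝ}

/-- The terms of the contrast are the coefficients of the density minus the product of its
marginals. -/
lemma coeff_sub_prod_eq (hp : InSmoothClass N s R P S p) (hφ : IsRegularScalingFunction r φ)
    (j : ℤ) (k : Fin d → ℤ) :
    coeff φ p j k - ∏ ℓ, marginalCoeff φ p j ℓ (k ℓ)
      = anisoCoeff φ (p - marginalProd p) (fun _ => j) k := by
  have h0 := hφ.memLp_anisoScaled (fun _ : Fin d => j) k
  have h1 : ∏ ℓ, marginalCoeff φ p j ℓ (k ℓ)
      = ∫ x, marginalProd p x * anisoScaled φ (fun _ => j) k x :=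
    (integral_tensor_mul_tensor (marginal p) fun ℓ => scaled φ j (k ℓ)).symm
  have h2 : coeff φ p j k = ∫ x, p x * anisoScaled φ (fun _ => j) k x := rfl
  rw [h1, h2, ← integral_sub (f := fun x => p x * anisoScaled φ (fun _ => j) k x)
    (g := fun x => marginalProd p x * anisoScaled φ (fun _ => j) k x)
    (hp.memLp.integrable_mul h0) (hp.memLp_marginalProd.integrable_mul h0)]
  refine integral_congr_ae (ae_of_all _ fun x => ?_)
  simp only [Pi.sub_apply]
  ring

end InSmoothClass

/-- The bias of the contrast, uniformly over a smoothness class. -/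
theorem IsRegularScalingFunction.exists_contrast_bias_le {r : ℕ} {φ : ℝ → ℝ}
    (hφ : IsRegularScalingFunction r φ) (hr : 1 ≤ r) {N : ℕ} (hN : N ≤ r) {s R P S : ℝ}
    (hs : 0 < s) (hR : 0 ≤ R) (hP : 0 ≤ P) (hS : 0 ≤ S) :
    ∃ K : ℝ, 0 ≤ K ∧ ∀ p : (Fin d → ℝ) → ℝ, InSmoothClass N s R P S p → ∀ j : ℕ,
      contrast φ p j ≤ depNorm p ^ 2 ∧
        depNorm p ^ 2 - contrast φ p j ≤ K * (2 : ℝ) ^ (-(2 * j * s)) := by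
  obtain ⟨C, hC, h⟩ := hφ.exists_approximation_error_le (d := d) hr hN
  set E : ℝ := (2 * (R + N)) ^ (d - 1) * ((2 * R) ^ (d - 1) * P) ^ (d - 1) with hE
  have hE0 : 0 ≤ E := by positivity
  -- the ratio of the geometric series: halving the step divides `h^{2s}` by `2^{2s}`
  set q : ℝ := (2 : ℝ) ^ (-(2 * s)) with hq
  have hq1 : q < 1 := Real.rpow_lt_one_of_one_lt_of_neg one_lt_two (by linarith)
  have hq0 : 0 ≤ q := by positivity
  refine ⟨C * (2 * S * (1 + E)) / (1 - q),
    div_nonneg (by positivity) (by linarith), fun p hp j => ?_⟩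
  have hc : contrast φ p j
      = ∑' k, anisoCoeff φ (p - marginalProd p) (fun _ => (j : ℤ)) k ^ 2 := by
    unfold contrast
    simp only [hp.coeff_sub_prod_eq hφ]
  have hqj : (2 : ℝ) ^ (-(2 * j * s)) = q ^ j := by
    rw [hq, ← Real.rpow_natCast, ← Real.rpow_mul two_pos.le]
    congr 1; ring
  rw [hc, hp.depNorm_sq, hqj]
  refine h _ hp.memLp_sub_marginalProd _ q hq0 hq1 (fun a i => ?_) j
  set t : ℝ := (2 : ℝ) ^ (-((i : ℤ) + 1)) with ht
  have ht0 : 0 < t := by positivity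
  have ht1 : t ≤ 1 := by
    rw [ht]; exact zpow_le_one_of_nonpos₀ one_le_two (by omega)
  have htq : t ^ (2 * s) ≤ q ^ i := by
    rw [ht, hq, ← Real.rpow_intCast, ← Real.rpow_mul two_pos.le, ← Real.rpow_natCast,
      ← Real.rpow_mul two_pos.le]
    refine Real.rpow_le_rpow_of_exponent_le one_le_two ?_
    push_cast
    nlinarith
  rw [fwdDiff_iter_sub']
  refine (integral_sub_sq_le (memLp_fwdDiff_iter hp.memLp _ N)
    (memLp_fwdDiff_iter hp.memLp_marginalProd _ N)).trans ?_
  have h1 := hp.integral_fwdDiff_sq_le a t ht0 ht1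
  have h2 := hp.integral_fwdDiff_marginalProd_sq_le hR a ht0 ht1
  calc _ ≤ 2 * (S * t ^ (2 * s)) + 2 * ((2 * (R + N)) ^ (d - 1) * (S * t ^ (2 * s))
          * ((2 * R) ^ (d - 1) * P) ^ (d - 1)) := by linarith
    _ = 2 * S * (1 + E) * t ^ (2 * s) := by rw [hE]; ring
    _ ≤ _ := mul_le_mul_of_nonneg_left htq (by positivity)

end WaveletICA

end Bias

/-! ### The contrast estimator as a squared norm -/

section Moments

variable {H : Type*} [NormedAddCommGroup H] [InnerProductSpace ℝ H] [CompleteSpace H]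
variable {d n : ℕ}

/-- Mean square error and bias of `‖empDiff v X‖²` as an estimator of `‖popDiff μ v‖²`, from the
expansion `‖T‖² - ‖θ‖² = ‖T - θ‖² + 2 ⟪θ, T - θ⟫`. -/
lemma empDiff_norm_sq_moments (hn : 1 ≤ n) (μ : Measure (Fin d → ℝ)) [IsProbabilityMeasure μ]
    {v : (Fin d → ℝ) → H} {c B : ℝ} (hv : StronglyMeasurable v) (hc : ∀ x, ‖v x‖ ≤ c)
    (hc1 : 1 ≤ c) (hB : ‖popDiff μ v‖ ≤ B) :
    (∫ X : Fin n → Fin d → ℝ, (‖empDiff v X‖ ^ 2 - ‖popDiff μ v‖ ^ 2) ^ 2 ∂(Measure.pi fun _ => μ)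
        ≤ 2048 * (d + 1) ^ 8 * (c ^ 2 / n) ^ 2 + 128 * B ^ 2 * (d + 1) ^ 4 * (c ^ 2 / n)) ∧
      ∫ X : Fin n → Fin d → ℝ, (‖empDiff v X‖ ^ 2 - ‖popDiff μ v‖ ^ 2) ∂(Measure.pi fun _ => μ)
        ≤ (16 * (d + 1) ^ 4 + 4 * d ^ 2 * B) * (c ^ 2 / n) := by
  set θ := popDiff μ v with hθ
  set ν : Measure (Fin n → Fin d → ℝ) := Measure.pi fun _ => μ with hν
  have hn0 : (0 : ℝ) < n := by exact_mod_cast hn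
  have hB0 : 0 ≤ B := (norm_nonneg _).trans hB
  have hT : StronglyMeasurable (empDiff v : (Fin n → Fin d → ℝ) → H) := stronglyMeasurable_empDiff hv
  have hD : StronglyMeasurable fun X : Fin n → Fin d → ℝ => empDiff v X - θ :=
    hT.sub stronglyMeasurable_const
  have hDb : ∀ X : Fin n → Fin d → ℝ, ‖empDiff v X - θ‖ ≤ 2 * c + B := fun X =>
    (norm_sub_le _ _).trans (add_le_add (norm_empDiff_le hc X) hB)
  obtain ⟨m2, m4⟩ := empDiff_moments hn μ hv hc
  have mb := norm_integral_empDiff_sub_popDiff_le hn μ hv hc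
  rw [← hθ, ← hν] at m2 m4 mb
  have hexp : ∀ X : Fin n → Fin d → ℝ, ‖empDiff v X‖ ^ 2 - ‖θ‖ ^ 2
      = ‖empDiff v X - θ‖ ^ 2 + 2 * inner ℝ θ (empDiff v X - θ) := fun X => by
    have := norm_add_sq_real θ (empDiff v X - θ)
    rw [add_sub_cancel] at this
    linarith
  have i1 : Integrable (fun X => empDiff v X - θ) ν :=
    Integrable.of_bound hD.aestronglyMeasurable (2 * c + B) (ae_of_all _ hDb)
  have ip : ∀ k : ℕ, Integrable (fun X => ‖empDiff v X - θ‖ ^ k) ν := fun k =>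
    Integrable.of_bound (hD.norm.pow k).aestronglyMeasurable ((2 * c + B) ^ k)
      (ae_of_all _ fun X => by
        rw [Real.norm_of_nonneg (by positivity)]
        exact pow_le_pow_left₀ (norm_nonneg _) (hDb X) k)
  have iin : Integrable (fun X => inner ℝ θ (empDiff v X - θ)) ν := i1.const_inner θ
  have hsq : ∀ X : Fin n → Fin d → ℝ, (‖empDiff v X‖ ^ 2 - ‖θ‖ ^ 2) ^ 2
      ≤ 2 * ‖empDiff v X - θ‖ ^ 4 + 8 * B ^ 2 * ‖empDiff v X - θ‖ ^ 2 := fun X => by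
    rw [hexp X]
    have h1 : (inner ℝ θ (empDiff v X - θ)) ^ 2 ≤ B ^ 2 * ‖empDiff v X - θ‖ ^ 2 := by
      rw [← mul_pow, ← sq_abs]
      refine pow_le_pow_left₀ (abs_nonneg _) ((abs_real_inner_le_norm _ _).trans ?_) 2
      exact mul_le_mul_of_nonneg_right hB (norm_nonneg _)
    nlinarith [sq_nonneg (‖empDiff v X - θ‖ ^ 2 - 2 * inner ℝ θ (empDiff v X - θ))]
  constructor
  · have h := integral_mono_of_nonneg (μ := ν) (ae_of_all _ fun X => sq_nonneg _)
      (((ip 4).const_mul 2).add ((ip 2).const_mul (8 * B ^ 2))) (ae_of_all _ hsq)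
    rw [integral_add' ((ip 4).const_mul 2) ((ip 2).const_mul (8 * B ^ 2)), integral_const_mul,
      integral_const_mul] at h
    refine h.trans ?_
    calc _ ≤ 2 * (1024 * (d + 1) ^ 8 * c ^ 4 / n ^ 2) + 8 * B ^ 2 * (16 * (d + 1) ^ 4 * c ^ 2 / n) :=
          add_le_add (mul_le_mul_of_nonneg_left m4 two_pos.le)
            (mul_le_mul_of_nonneg_left m2 (by positivity))
      _ = _ := by ring
  · simp only [hexp]
    rw [integral_add (ip 2) (iin.const_mul 2), integral_const_mul, integral_inner i1]
    have hsub : ∫ X, (empDiff v X - θ) ∂ν = (∫ X, empDiff v X ∂ν) - θ := by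
      rw [integral_sub (Integrable.of_bound hT.aestronglyMeasurable (2 * c)
        (ae_of_all _ fun X => norm_empDiff_le hc X)) (integrable_const _)]
      simp
    rw [hsub]
    have h1 : inner ℝ θ ((∫ X, empDiff v X ∂ν) - θ) ≤ B * (2 * d ^ 2 * c / n) :=
      (real_inner_le_norm _ _).trans (mul_le_mul hB mb (norm_nonneg _) hB0)
    have h2 : B * (2 * d ^ 2 * c / n) ≤ B * (2 * d ^ 2 * c ^ 2 / n) := by
      refine mul_le_mul_of_nonneg_left ?_ hB0
      refine div_le_div_of_nonneg_right ?_ hn0.le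
      refine mul_le_mul_of_nonneg_left ?_ (by positivity)
      nlinarith
    calc _ ≤ 16 * (d + 1) ^ 4 * c ^ 2 / n + 2 * (B * (2 * d ^ 2 * c ^ 2 / n)) := by linarith
      _ = _ := by ring

end Moments

section Sample

namespace WaveletICA

variable {d n : ℕ} {φ : ℝ → ℝ} {p : (Fin d → ℝ) → ℝ}

/-- The law with density `p`. -/
noncomputable def densityLaw (p : (Fin d → ℝ) → ℝ) : Measure (Fin d → ℝ) :=
  volume.withDensity fun x => ENNReal.ofReal (p x)

lemma sampleLaw_eq (n : ℕ) (p : (Fin d → ℝ) → ℝ) :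
    sampleLaw n p = Measure.pi fun _ => densityLaw p := rfl

lemma IsDensity.isProbabilityMeasure (hp : IsDensity p) : IsProbabilityMeasure (densityLaw p) := by
  constructor
  rw [densityLaw, withDensity_apply _ MeasurableSet.univ, Measure.restrict_univ,
    ← ofReal_integral_eq_lintegral_ofReal hp.integrable (ae_of_all _ hp.nonneg),
    hp.integral_eq_one, ENNReal.ofReal_one]

lemma IsDensity.integral_densityLaw (hp : IsDensity p) (g : (Fin d → ℝ) → ℝ) :
    ∫ x, g x ∂(densityLaw p) = ∫ x, p x * g x := by
  rw [densityLaw, integral_withDensity_eq_integral_toReal_smul hp.measurable.ennreal_ofReal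
    (ae_of_all _ fun _ => ENNReal.ofReal_lt_top)]
  refine integral_congr_ae (ae_of_all _ fun x => ?_)
  simp only [ENNReal.toReal_ofReal (hp.nonneg x), smul_eq_mul]

/-- Sample points almost surely lie in the set where the density is nonzero. -/
lemma IsDensity.ae_sampleLaw (hp : IsDensity p) (n : ℕ) {q : (Fin d → ℝ) → Prop}
    (hq : ∀ x, p x ≠ 0 → q x) : ∀ᵐ X ∂(sampleLaw n p), ∀ i, q (X i) := by
  have := hp.isProbabilityMeasure
  have h : ∀ᵐ x ∂(densityLaw p), q x := by
    rw [densityLaw, ae_withDensity_iff hp.measurable.ennreal_ofReal]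
    refine ae_of_all _ fun x hx => hq x fun h0 => hx ?_
    rw [h0, ENNReal.ofReal_zero]
  rw [sampleLaw_eq, ae_all_iff]
  exact fun i => (Measure.quasiMeasurePreserving_eval (fun _ : Fin n => densityLaw p) i).ae h

/-- The functions `Φ_{jk}`, `k ∈ F`, as a map into a Euclidean space. -/
noncomputable def waveletVector (φ : ℝ → ℝ) (j : ℤ) (F : Finset (Fin d → ℤ)) (x : Fin d → ℝ) :
    EuclideanSpace ℝ F :=
  WithLp.toLp 2 fun k => tensorScaled φ j k x

lemma continuous_tensorScaled (hφ : Continuous φ) (j : ℤ) (k : Fin d → ℤ) :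
    Continuous (tensorScaled φ j k) :=
  continuous_finsetProd _ fun ℓ _ => (continuous_scaled hφ j (k ℓ)).comp (continuous_apply ℓ)

lemma continuous_waveletVector (hφ : Continuous φ) (j : ℤ) (F : Finset (Fin d → ℤ)) :
    Continuous (waveletVector φ j F) :=
  (PiLp.continuous_toLp 2 _).comp (continuous_pi fun k : F => continuous_tensorScaled hφ j k.1)

/-- Only boundedly many translates of a compactly supported function overlap. -/
lemma exists_sum_scaled_sq_le (hφ : Continuous φ) (hs : HasCompactSupport φ) :
    ∃ C : ℝ, 1 ≤ C ∧ ∀ (j : ℤ) (G : Finset ℤ) (t : ℝ),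
      ∑ m ∈ G, scaled φ j m t ^ 2 ≤ C * (2 : ℝ) ^ j := by
  obtain ⟨L, -, hL⟩ := exists_support_bound hs
  obtain ⟨D, hD⟩ := hs.exists_bound_of_continuous hφ
  refine ⟨1 + (2 * L + 1) * D ^ 2, by nlinarith [sq_nonneg D, (Nat.cast_nonneg L : (0 : ℝ) ≤ L)],
    fun j G t => ?_⟩
  set y : ℝ := (2 : ℝ) ^ j * t with hy
  have e : ∀ m, scaled φ j m t ^ 2 = (2 : ℝ) ^ j * φ (y - m) ^ 2 := fun m => by
    rw [scaled, mul_pow, sq ((2 : ℝ) ^ ((j : ℝ) / 2)), rpow_half_mul_self]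
  simp only [e]
  rw [← Finset.mul_sum, mul_comm]
  refine mul_le_mul_of_nonneg_right ?_ (by positivity)
  set I : Finset ℤ := Finset.Icc ⌈y - L⌉ ⌊y + L⌋ with hI
  have hcard : (I.card : ℝ) ≤ 2 * L + 1 := by
    rw [hI, Int.card_Icc]
    have h1 : ((⌊y + L⌋ + 1 - ⌈y - L⌉ : ℤ) : ℝ) ≤ 2 * L + 1 := by
      push_cast
      linarith [Int.floor_le (y + L), Int.le_ceil (y - L)]
    have h2 : ⌊y + L⌋ + 1 - ⌈y - L⌉ ≤ 2 * L + 1 := by exact_mod_cast h1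
    have h3 : (⌊y + L⌋ + 1 - ⌈y - L⌉).toNat ≤ 2 * L + 1 := by omega
    exact_mod_cast h3
  have hle : ∑ m ∈ G, φ (y - m) ^ 2 ≤ ∑ m ∈ I, D ^ 2 := by
    have h1 : ∑ m ∈ G, φ (y - m) ^ 2 = ∑ m ∈ G with m ∈ I, φ (y - m) ^ 2 := by
      rw [Finset.sum_filter_of_ne]
      intro m _ hm
      have h0 : φ (y - m) ≠ 0 := fun h => hm (by rw [h]; simp)
      have := abs_le.1 (hL _ h0)
      exact Finset.mem_Icc.2 ⟨Int.ceil_le.2 (by linarith), Int.le_floor.2 (by linarith)⟩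
    rw [h1]
    refine (Finset.sum_le_sum fun m _ => ?_).trans
      (Finset.sum_le_sum_of_subset_of_nonneg (fun m hm => (Finset.mem_filter.1 hm).2)
        fun _ _ _ => sq_nonneg D)
    rw [← sq_abs]
    exact pow_le_pow_left₀ (abs_nonneg _) (hD _) 2
  refine hle.trans ?_
  rw [Finset.sum_const, nsmul_eq_mul]
  nlinarith [mul_le_mul_of_nonneg_right hcard (sq_nonneg D)]

/-- The sum of the squares `Φ_{jk}(x)²` over a cube of indices is a product of sums in one
variable. -/
lemma norm_waveletVector_sq_le {C : ℝ} {j : ℤ}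
    (h : ∀ (G : Finset ℤ) (t : ℝ), ∑ m ∈ G, scaled φ j m t ^ 2 ≤ C * (2 : ℝ) ^ j)
    (G : Finset ℤ) (x : Fin d → ℝ) :
    ‖waveletVector φ j (Fintype.piFinset fun _ => G) x‖ ^ 2 ≤ (C * (2 : ℝ) ^ j) ^ d := by
  rw [EuclideanSpace.real_norm_sq_eq]
  simp only [waveletVector]
  rw [Finset.sum_coe_sort (Fintype.piFinset fun _ : Fin d => G) fun k => tensorScaled φ j k x ^ 2]
  simp only [tensorScaled, ← Finset.prod_pow]
  rw [← Finset.prod_univ_sum (fun _ : Fin d => G) fun ℓ m => scaled φ j m (x ℓ) ^ 2]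
  refine (Finset.prod_le_prod (fun _ _ => Finset.sum_nonneg fun _ _ => sq_nonneg _)
    fun ℓ _ => h G (x ℓ)).trans (le_of_eq ?_)
  simp

lemma empDiff_waveletVector_apply (j : ℤ) (F : Finset (Fin d → ℤ)) (X : Fin n → Fin d → ℝ)
    (k : F) :
    empDiff (waveletVector φ j F) X k
      = empCoeff φ j k X - ∏ ℓ, empMarginalCoeff φ j ℓ (k.1 ℓ) X := by
  have h1 : ∏ ℓ, empMarginalCoeff φ j ℓ (k.1 ℓ) X
      = ((n : ℝ) ^ d)⁻¹ * ∑ ι : Fin d → Fin n, tensorScaled φ j k fun ℓ => X (ι ℓ) ℓ := by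
    simp only [empMarginalCoeff]
    rw [Finset.prod_mul_distrib, Finset.prod_univ_sum (fun _ : Fin d => Finset.univ)
      fun ℓ i => scaled φ j (k.1 ℓ) (X i ℓ), Fintype.piFinset_univ]
    simp [tensorScaled]
  rw [h1, empCoeff]
  simp [empDiff, waveletVector]

variable (hφ : Continuous φ) (hs : HasCompactSupport φ) (hp : IsDensity p)
include hφ hs hp

lemma popDiff_waveletVector_apply (j : ℤ) (F : Finset (Fin d → ℤ)) (k : F) :
    popDiff (densityLaw p) (waveletVector φ j F) k
      = coeff φ p j k - ∏ ℓ, marginalCoeff φ p j ℓ (k.1 ℓ) := by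
  have := hp.isProbabilityMeasure
  have hv := continuous_waveletVector (d := d) hφ j F
  obtain ⟨c, hc⟩ : ∃ c, ∀ x : Fin d → ℝ, ‖waveletVector φ j F x‖ ≤ c := by
    have hD : ∀ m : ℤ, ∃ D, ∀ t, ‖scaled φ j m t‖ ≤ D := fun m =>
      (hasCompactSupport_scaled hs j m).exists_bound_of_continuous (continuous_scaled hφ j m)
    choose D hD using hD
    refine ⟨Real.sqrt (∑ k : F, (∏ ℓ, D (k.1 ℓ)) ^ 2), fun x => ?_⟩
    refine Real.le_sqrt_of_sq_le ?_
    rw [EuclideanSpace.real_norm_sq_eq]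
    refine Finset.sum_le_sum fun k _ => ?_
    rw [← sq_abs]
    refine pow_le_pow_left₀ (abs_nonneg _) ?_ 2
    simp only [waveletVector, tensorScaled, Finset.abs_prod]
    exact Finset.prod_le_prod (fun _ _ => abs_nonneg _) fun ℓ _ => hD _ _
  have i1 : Integrable (waveletVector φ j F) (densityLaw p) :=
    Integrable.of_bound hv.stronglyMeasurable.aestronglyMeasurable c (ae_of_all _ hc)
  have hdiag : Continuous fun Y : Fin d → Fin d → ℝ => fun ℓ => Y ℓ ℓ :=
    continuous_pi fun ℓ => (continuous_apply ℓ).comp (continuous_apply ℓ)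
  have i2 : Integrable (fun Y : Fin d → Fin d → ℝ => waveletVector φ j F fun ℓ => Y ℓ ℓ)
      (Measure.pi fun _ => densityLaw p) :=
    Integrable.of_bound (hv.comp hdiag).stronglyMeasurable.aestronglyMeasurable c
      (ae_of_all _ fun Y => hc _)
  have e1 : ∫ x, waveletVector φ j F x k ∂(densityLaw p)
      = (∫ x, waveletVector φ j F x ∂(densityLaw p)) k :=
    (EuclideanSpace.proj (𝕜 := ℝ) k).integral_comp_comm i1
  have e2 : ∫ Y : Fin d → Fin d → ℝ, waveletVector φ j F (fun ℓ => Y ℓ ℓ) k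
        ∂(Measure.pi fun _ => densityLaw p)
      = (∫ Y : Fin d → Fin d → ℝ, waveletVector φ j F (fun ℓ => Y ℓ ℓ)
        ∂(Measure.pi fun _ => densityLaw p)) k :=
    (EuclideanSpace.proj (𝕜 := ℝ) k).integral_comp_comm i2
  rw [popDiff, PiLp.sub_apply, ← e1, ← e2]
  simp only [waveletVector]
  congr 1
  · exact hp.integral_densityLaw _
  · simp only [tensorScaled]
    rw [integral_fintype_prod_eq_prod (μ := fun _ : Fin d => densityLaw p)
      fun ℓ (x : Fin d → ℝ) => scaled φ j (k.1 ℓ) (x ℓ)]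
    refine Finset.prod_congr rfl fun ℓ _ => ?_
    obtain ⟨D, hD⟩ := (hasCompactSupport_scaled hs j (k.1 ℓ)).exists_bound_of_continuous
      (continuous_scaled hφ j (k.1 ℓ))
    rw [hp.integral_densityLaw, marginalCoeff, integral_marginal_mul hp.measurable hp.integrable ℓ
      (continuous_scaled hφ j (k.1 ℓ)).measurable hD]

/-- For a density supported in a cube, finitely many indices contribute to the contrast and, almost
surely, to its estimator, which are therefore the squared norms of `popDiff` and `empDiff`. -/
lemma exists_contrast_eq_norm_sq {R : ℝ} (hR : ∀ x, p x ≠ 0 → ∀ i, |x i| ≤ R) (j : ℤ) :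
    ∃ G : Finset ℤ,
      contrast φ p j
        = ‖popDiff (densityLaw p) (waveletVector φ j (Fintype.piFinset fun _ => G))‖ ^ 2 ∧
      ∀ n : ℕ, ∀ᵐ X ∂(sampleLaw n p), contrastEst φ j X
        = ‖empDiff (waveletVector φ j (Fintype.piFinset fun _ => G)) X‖ ^ 2 := by
  obtain ⟨L, -, hL⟩ := exists_support_bound hs
  set B : ℤ := ⌈(2 : ℝ) ^ j * R + L⌉ with hB
  have hvan : ∀ m : ℤ, m ∉ Finset.Icc (-B) B → ∀ t, |t| ≤ R → scaled φ j m t = 0 := by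
    intro m hm t ht
    by_contra hne
    have h0 : φ ((2 : ℝ) ^ j * t - m) ≠ 0 := fun h => hne (by rw [scaled, h, mul_zero])
    have h1 := hL _ h0
    have h2 : |(2 : ℝ) ^ j * t| ≤ (2 : ℝ) ^ j * R := by
      rw [abs_mul, abs_of_pos (by positivity : (0 : ℝ) < (2 : ℝ) ^ j)]
      exact mul_le_mul_of_nonneg_left ht (by positivity)
    have h3 : |(m : ℝ)| ≤ (2 : ℝ) ^ j * R + L := by
      have := abs_sub ((2 : ℝ) ^ j * t) ((2 : ℝ) ^ j * t - m)
      rw [sub_sub_cancel] at this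
      linarith
    have h4 := abs_le.1 (h3.trans (Int.le_ceil _))
    exact hm (Finset.mem_Icc.2 ⟨by exact_mod_cast h4.1, by exact_mod_cast h4.2⟩)
  have hout : ∀ k : Fin d → ℤ, k ∉ (Fintype.piFinset fun _ : Fin d => Finset.Icc (-B) B) →
      ∃ ℓ, ∀ t, |t| ≤ R → scaled φ j (k ℓ) t = 0 := fun k hk => by
    rw [Fintype.mem_piFinset] at hk
    push Not at hk
    obtain ⟨ℓ, hℓ⟩ := hk
    exact ⟨ℓ, hvan _ hℓ⟩
  refine ⟨Finset.Icc (-B) B, ?_, fun n => ?_⟩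
  · rw [EuclideanSpace.real_norm_sq_eq]
    simp only [popDiff_waveletVector_apply hφ hs hp]
    rw [Finset.sum_coe_sort (Fintype.piFinset fun _ : Fin d => Finset.Icc (-B) B)
      fun k => (coeff φ p j k - ∏ ℓ, marginalCoeff φ p j ℓ (k ℓ)) ^ 2]
    refine tsum_eq_sum fun k hk => ?_
    obtain ⟨ℓ, hℓ⟩ := hout k hk
    have h1 : coeff φ p j k = 0 := by
      refine (integral_congr_ae (ae_of_all _ fun x => ?_)).trans (integral_zero _ _)
      by_cases hx : p x = 0
      · simp [hx]
      · simp only [tensorScaled]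
        rw [Finset.prod_eq_zero (Finset.mem_univ ℓ) (hℓ _ (hR x hx ℓ)), mul_zero]
    have h2 : marginalCoeff φ p j ℓ (k ℓ) = 0 := by
      obtain ⟨D, hD⟩ := (hasCompactSupport_scaled hs j (k ℓ)).exists_bound_of_continuous
        (continuous_scaled hφ j (k ℓ))
      rw [marginalCoeff, integral_marginal_mul hp.measurable hp.integrable ℓ
        (continuous_scaled hφ j (k ℓ)).measurable hD]
      refine (integral_congr_ae (ae_of_all _ fun x => ?_)).trans (integral_zero _ _)
      by_cases hx : p x = 0
      · simp [hx]
      · rw [hℓ _ (hR x hx ℓ), mul_zero]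
    rw [h1, Finset.prod_eq_zero (Finset.mem_univ ℓ) h2]
    simp
  · filter_upwards [hp.ae_sampleLaw n hR] with X hX
    rw [EuclideanSpace.real_norm_sq_eq]
    simp only [empDiff_waveletVector_apply]
    rw [Finset.sum_coe_sort (Fintype.piFinset fun _ : Fin d => Finset.Icc (-B) B)
      fun k => (empCoeff φ j k X - ∏ ℓ, empMarginalCoeff φ j ℓ (k ℓ) X) ^ 2]
    refine tsum_eq_sum fun k hk => ?_
    obtain ⟨ℓ, hℓ⟩ := hout k hk
    have h1 : empCoeff φ j k X = 0 := by
      rw [empCoeff, Finset.sum_eq_zero fun i _ =>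
        Finset.prod_eq_zero (Finset.mem_univ ℓ) (hℓ _ (hX i ℓ)), mul_zero]
    have h2 : empMarginalCoeff φ j ℓ (k ℓ) X = 0 := by
      rw [empMarginalCoeff, Finset.sum_eq_zero fun i _ => hℓ _ (hX i ℓ), mul_zero]
    rw [h1, Finset.prod_eq_zero (Finset.mem_univ ℓ) h2]
    simp

end WaveletICA

end Sample

/-! ### Risk bounds over a smoothness class -/

section Risk

namespace WaveletICA

variable {d r : ℕ} {φ : ℝ → ℝ}

/-- The algebra behind the choice of `Q`: a squared estimator plus `b Q(√C, b)` splits into the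
mean square error, the bias of the estimator and `(b - √C)⁴ ≤ (b² - C)²`. -/
lemma add_mul_quarticQ_le {b C V e : ℝ} (hb : 0 ≤ b) (hC : 0 ≤ C) (hCb : C ≤ b ^ 2) :
    (V + 2 * C * e + C ^ 2) + b * quarticQ (Real.sqrt C) b ≤ V + 2 * C * e + (b ^ 2 - C) ^ 2 := by
  set a := Real.sqrt C with ha
  have ha0 : 0 ≤ a := Real.sqrt_nonneg _
  have haC : a ^ 2 = C := Real.sq_sqrt hC
  have hab : a ≤ b := by
    rw [ha]; exact Real.sqrt_le_iff.2 ⟨hb, hCb⟩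
  rw [← haC]
  have h1 : (b - a) ^ 4 ≤ (b ^ 2 - a ^ 2) ^ 2 := by
    have h2 : (b - a) ^ 2 ≤ b ^ 2 - a ^ 2 := by nlinarith
    calc (b - a) ^ 4 = ((b - a) ^ 2) ^ 2 := by ring
      _ ≤ _ := pow_le_pow_left₀ (sq_nonneg _) h2 2
  have h3 : (a ^ 2) ^ 2 + b * quarticQ a b = (b - a) ^ 4 := by
    rw [quarticQ]; ring
  linarith

/-- The second moment about zero in terms of the second moment about `c` and the bias. -/
lemma integral_sq_eq_add_bias {α : Type*} [MeasurableSpace α] {μ : Measure α}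
    [IsProbabilityMeasure μ] {Y : α → ℝ} (hY : MemLp Y 2 μ) (c : ℝ) :
    ∫ x, (Y x - 0) ^ 2 ∂μ
      = ∫ x, (Y x - c) ^ 2 ∂μ + 2 * c * ∫ x, (Y x - c) ∂μ + c ^ 2 := by
  have i0 : MemLp (fun x => Y x - c) 2 μ := hY.sub (memLp_const _)
  have i1 := i0.integrable_sq
  have i2 := (i0.integrable one_le_two).const_mul (2 * c)
  have h : ∀ x, (Y x - 0) ^ 2 = ((Y x - c) ^ 2 + 2 * c * (Y x - c)) + c ^ 2 := fun x => by ring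
  simp only [h]
  rw [integral_add (f := fun x => (Y x - c) ^ 2 + 2 * c * (Y x - c)) (i1.add i2)
    (integrable_const _), integral_add i1 i2, integral_const_mul]
  simp

/-- The risk of the contrast estimator over a smoothness class, with `u = 2^{jd} / n`. -/
theorem IsRegularScalingFunction.exists_risk_le (hφ : IsRegularScalingFunction r φ) (hr : 1 ≤ r)
    {N : ℕ} (hN : N ≤ r) {s R P S : ℝ} (hs : 0 < s) (hR : 0 ≤ R) (hP : 0 ≤ P) (hS : 0 ≤ S) :
    ∃ K : ℝ, 0 < K ∧ ∀ p : (Fin d → ℝ) → ℝ, InSmoothClass N s R P S p → ∀ n j : ℕ, 1 ≤ n →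
      MemLp (contrastEst (d := d) (n := n) φ j) 2 (sampleLaw n p) ∧
      quadRisk φ n p j (contrast φ p j)
        ≤ K * ((2 : ℝ) ^ (j * d) / n + ((2 : ℝ) ^ (j * d) / n) ^ 2) ∧
      quadRisk φ n p j 0 + depNorm p * quarticQ (Real.sqrt (contrast φ p j)) (depNorm p)
        ≤ K * ((2 : ℝ) ^ (-(4 * j * s)) + (2 : ℝ) ^ (j * d) / n + ((2 : ℝ) ^ (j * d) / n) ^ 2) := by
  have hcont := hφ.contDiff.continuous
  have hsupp := hφ.hasCompactSupport
  obtain ⟨C₀, hC₀, hov⟩ := exists_sum_scaled_sq_le hcont hsupp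
  obtain ⟨K₁, hK₁, hbias⟩ := hφ.exists_contrast_bias_le (d := d) hr hN hs hR hP hS
  set B2 : ℝ := 2 * P + 2 * ((2 * R) ^ (d - 1) * P) ^ d with hB2
  have hB20 : 0 ≤ B2 := by positivity
  set B : ℝ := Real.sqrt B2 with hB
  have hB0 : 0 ≤ B := Real.sqrt_nonneg _
  set W : ℝ := C₀ ^ d with hW
  have hW0 : 0 ≤ W := by positivity
  set K₂ : ℝ := 2048 * (d + 1) ^ 8 * W ^ 2 + 128 * B ^ 2 * (d + 1) ^ 4 * W with hK₂
  set K₃ : ℝ := (16 * (d + 1) ^ 4 + 4 * d ^ 2 * B) * W with hK₃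
  have hK₂0 : 0 ≤ K₂ := by positivity
  have hK₃0 : 0 ≤ K₃ := by positivity
  refine ⟨K₂ + 2 * B2 * K₃ + K₁ ^ 2 + 1, by positivity, fun p hp n j hn => ?_⟩
  have hn0 : (0 : ℝ) < n := by exact_mod_cast hn
  have hprob := hp.isDensity.isProbabilityMeasure
  obtain ⟨G, hGC, hGest⟩ := exists_contrast_eq_norm_sq hcont hsupp hp.isDensity
    hp.support_subset (j : ℤ)
  set v := waveletVector (d := d) φ (j : ℤ) (Fintype.piFinset fun _ => G) with hv
  have hvm : StronglyMeasurable v := (continuous_waveletVector hcont _ _).stronglyMeasurable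
  set u : ℝ := (2 : ℝ) ^ (j * d) / n with hu
  have hu0 : 0 ≤ u := by positivity
  -- the bound on `‖v‖`, taken at least `1` so that the bias of order `c / n` is at most `c² / n`
  set c : ℝ := Real.sqrt (W * (2 : ℝ) ^ (j * d)) with hc
  have hc2 : c ^ 2 = W * (2 : ℝ) ^ (j * d) := Real.sq_sqrt (by positivity)
  have hc1 : 1 ≤ c := by
    rw [hc]
    refine Real.one_le_sqrt.2 ?_
    exact one_le_mul_of_one_le_of_one_le (one_le_pow₀ hC₀) (one_le_pow₀ one_le_two)
  have hvc : ∀ x, ‖v x‖ ≤ c := fun x => by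
    rw [hc]
    refine Real.le_sqrt_of_sq_le ((norm_waveletVector_sq_le (hov (j : ℤ)) G x).trans (le_of_eq ?_))
    rw [mul_pow, zpow_natCast, ← pow_mul]
  obtain ⟨hCd, hbj⟩ := hbias p hp j
  have hdep : depNorm p ^ 2 ≤ B2 := hp.depNorm_sq_le hR
  have hdep0 : 0 ≤ depNorm p := ENNReal.toReal_nonneg
  have hθ : ‖popDiff (densityLaw p) v‖ ≤ B := by
    refine Real.le_sqrt_of_sq_le ?_
    rw [← hGC]
    exact hCd.trans hdep
  obtain ⟨hm2, hm1⟩ := empDiff_norm_sq_moments hn (densityLaw p) hvm hvc hc1 hθ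
  rw [← hGC, hc2, mul_div_assoc, ← hu, ← sampleLaw_eq] at hm2 hm1
  have hsl : IsProbabilityMeasure (sampleLaw n p) := by
    rw [sampleLaw_eq]; infer_instance
  have hTm : StronglyMeasurable fun X : Fin n → Fin d → ℝ => ‖empDiff v X‖ ^ 2 :=
    (stronglyMeasurable_empDiff hvm).norm.pow 2
  have hest := hGest n
  have hmem : MemLp (contrastEst (d := d) (n := n) φ j) 2 (sampleLaw n p) := by
    refine (MemLp.of_bound (p := 2) hTm.aestronglyMeasurable ((2 * c) ^ 2)
      (ae_of_all _ fun X => ?_)).ae_eq (hest.mono fun X hX => hX.symm)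
    rw [Real.norm_of_nonneg (by positivity)]
    exact pow_le_pow_left₀ (norm_nonneg _) (norm_empDiff_le hvc X) 2
  have hC0 : 0 ≤ contrast φ p j := by rw [hGC]; positivity
  have e1 : quadRisk φ n p j (contrast φ p j)
      = ∫ X, (‖empDiff v X‖ ^ 2 - contrast φ p j) ^ 2 ∂(sampleLaw n p) := by
    refine integral_congr_ae ?_
    filter_upwards [hest] with X hX
    rw [hX]
  have hV : quadRisk φ n p j (contrast φ p j) ≤ K₂ * (u + u ^ 2) := by
    rw [e1]
    refine hm2.trans ?_
    rw [hK₂]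
    have h1 : 0 ≤ 2048 * ((d : ℝ) + 1) ^ 8 * W ^ 2 * u := by positivity
    have h2 : 0 ≤ 128 * B ^ 2 * ((d : ℝ) + 1) ^ 4 * W * u ^ 2 := by positivity
    nlinarith
  -- `E Ĉ² = E (Ĉ - C)² + 2 C (E Ĉ - C) + C²`
  have e2 : quadRisk φ n p j 0 = quadRisk φ n p j (contrast φ p j)
      + 2 * contrast φ p j
        * ∫ X : Fin n → Fin d → ℝ, (‖empDiff v X‖ ^ 2 - contrast φ p j) ∂(sampleLaw n p)
      + contrast φ p j ^ 2 := by
    have e3 : ∫ X : Fin n → Fin d → ℝ, (‖empDiff v X‖ ^ 2 - contrast φ p j) ∂(sampleLaw n p)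
        = ∫ X : Fin n → Fin d → ℝ, (contrastEst φ j X - contrast φ p j) ∂(sampleLaw n p) := by
      refine integral_congr_ae ?_
      filter_upwards [hest] with X hX
      rw [hX]
    rw [e3]
    exact integral_sq_eq_add_bias hmem _
  clear_value u c B W B2
  generalize quadRisk φ n p j (contrast φ p j) = V at e2 hV ⊢
  refine ⟨hmem, hV.trans ?_, ?_⟩
  · refine mul_le_mul_of_nonneg_right ?_ (by positivity)
    have h5 : 0 ≤ 2 * B2 * K₃ := mul_nonneg (mul_nonneg two_pos.le hB20) hK₃0
    have h6 := sq_nonneg K₁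
    linarith only [h5, h6]
  · rw [e2]
    refine (add_mul_quarticQ_le hdep0 hC0 hCd).trans ?_
    have h1 : 2 * contrast φ p j
        * ∫ X : Fin n → Fin d → ℝ, (‖empDiff v X‖ ^ 2 - contrast φ p j) ∂(sampleLaw n p)
        ≤ 2 * B2 * (K₃ * u) := by
      refine (mul_le_mul_of_nonneg_left hm1 (by positivity)).trans ?_
      rw [hK₃]
      have h2 : contrast φ p j ≤ B2 := hCd.trans hdep
      have h3 : 0 ≤ (16 * ((d : ℝ) + 1) ^ 4 + 4 * d ^ 2 * B) * (W * u) := by positivity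
      have h4 := mul_le_mul_of_nonneg_right h2 h3
      linarith only [h4]
    have h4 : (depNorm p ^ 2 - contrast φ p j) ^ 2 ≤ K₁ ^ 2 * (2 : ℝ) ^ (-(4 * j * s)) := by
      refine (pow_le_pow_left₀ (sub_nonneg.2 hCd) hbj 2).trans (le_of_eq ?_)
      rw [mul_pow, ← Real.rpow_natCast ((2 : ℝ) ^ (-(2 * j * s))), ← Real.rpow_mul two_pos.le]
      congr 2
      push_cast
      ring
    set w : ℝ := (2 : ℝ) ^ (-(4 * j * s)) with hw
    have hw0 : 0 ≤ w := by positivity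
    have h5 : 0 ≤ B2 * K₃ := mul_nonneg hB20 hK₃0
    calc V + _ + _ ≤ K₂ * (u + u ^ 2) + 2 * B2 * (K₃ * u) + K₁ ^ 2 * w :=
          add_le_add (add_le_add hV h1) h4
      _ ≤ _ := by
        have : 0 ≤ K₂ * w + 2 * (B2 * K₃) * (w + u ^ 2) + K₁ ^ 2 * (u + u ^ 2)
            + (w + u + u ^ 2) := by positivity
        linarith only [this]

end WaveletICA

end Risk

/-! ### Mixed densities -/

section Mixing

namespace WaveletICA

variable {d : ℕ}

lemma map_mulVec_volume {B : Matrix (Fin d) (Fin d) ℝ} (hB : B.det ≠ 0) :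
    Measure.map B.mulVec (volume : Measure (Fin d → ℝ)) = ENNReal.ofReal |B.det⁻¹| • volume := by
  rw [← Real.map_matrix_volume_pi_eq_smul_volume_pi hB]
  rfl

lemma measurable_mulVec (B : Matrix (Fin d) (Fin d) ℝ) : Measurable B.mulVec :=
  (Continuous.matrix_mulVec continuous_const continuous_id).measurable

lemma integral_comp_mulVec {B : Matrix (Fin d) (Fin d) ℝ} (hB : B.det ≠ 0)
    {g : (Fin d → ℝ) → ℝ} (hg : Measurable g) :
    ∫ x, g (B.mulVec x) = |B.det|⁻¹ * ∫ x, g x := by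
  have h := integral_map (μ := volume) (measurable_mulVec B).aemeasurable
    (f := g) hg.aestronglyMeasurable
  rw [map_mulVec_volume hB, integral_smul_measure, ENNReal.toReal_ofReal (abs_nonneg _),
    smul_eq_mul, abs_inv] at h
  exact h.symm

lemma memLp_comp_mulVec {B : Matrix (Fin d) (Fin d) ℝ} (hB : B.det ≠ 0)
    {g : (Fin d → ℝ) → ℝ} (hg : Measurable g) {q : ℝ≥0∞} (h : MemLp g q volume) :
    MemLp (fun x => g (B.mulVec x)) q volume := by
  refine (memLp_map_measure_iff hg.aestronglyMeasurable (measurable_mulVec B).aemeasurable).1 ?_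
  rw [map_mulVec_volume hB]
  exact h.smul_measure ENNReal.ofReal_ne_top

lemma fwdDiff_iter_const_mul_comp_mulVec (B : Matrix (Fin d) (Fin d) ℝ) (c : ℝ)
    (f : (Fin d → ℝ) → ℝ) (v : Fin d → ℝ) (N : ℕ) :
    (fwdDiff v)^[N] (fun x => c * f (B.mulVec x))
      = fun x => c * ((fwdDiff (B.mulVec v))^[N] f) (B.mulVec x) := by
  induction N generalizing f with
  | zero => rfl
  | succ N ih =>
    have h : fwdDiff v (fun x => c * f (B.mulVec x))
        = fun x => c * fwdDiff (B.mulVec v) f (B.mulVec x) := by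
      funext x
      simp only [fwdDiff, Matrix.mulVec_add]
      ring
    simp only [Function.iterate_succ_apply, h, ih]

lemma _root_.HasCompactSupport.exists_abs_apply_le {f : (Fin d → ℝ) → ℝ} (hf : HasCompactSupport f) :
    ∃ R : ℝ, 0 ≤ R ∧ ∀ x, f x ≠ 0 → ∀ i, |x i| ≤ R := by
  obtain ⟨R, hR0, hR⟩ := hf.isCompact.isBounded.exists_pos_norm_le
  exact ⟨R, hR0.le, fun x hx i =>
    (norm_le_pi_norm x i).trans (hR x (subset_tsupport f (Function.mem_support.2 hx)))⟩

/-- The Besov seminorm controls the `L_2` norms of the differences. -/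
lemma MemBesov.integral_fwdDiff_sq_le {s : ℝ} {f : (Fin d → ℝ) → ℝ} (hf : MemBesov s f)
    {t : ℝ} (ht : 0 < t) {w : Fin d → ℝ} (hw : ‖WithLp.toLp 2 w‖ ≤ t) :
    ∫ x, ((fwdDiff w)^[⌊s⌋₊ + 1] f) x ^ 2 ≤ (besovSeminorm s f).toReal ^ 2 * t ^ (2 * s) := by
  have hL := memLp_fwdDiff_iter hf.1 w (⌊s⌋₊ + 1)
  rw [← norm_toLp_sq hL, Lp.norm_toLp]
  have h1 : ENNReal.ofReal (t ^ (-s)) * eLpNorm ((fwdDiff w)^[⌊s⌋₊ + 1] f) 2 volume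
      ≤ besovSeminorm s f := by
    refine le_trans ?_ (le_iSup₂_of_le t ht le_rfl)
    gcongr
    exact le_iSup₂_of_le (f := fun (h : Fin d → ℝ) (_ : ‖WithLp.toLp 2 h‖ ≤ t) =>
      eLpNorm ((fwdDiff h)^[⌊s⌋₊ + 1] f) 2 volume) w hw le_rfl
  have h2 := ENNReal.toReal_mono hf.2.ne h1
  rw [ENNReal.toReal_mul, ENNReal.toReal_ofReal (by positivity)] at h2
  set y := (eLpNorm ((fwdDiff w)^[⌊s⌋₊ + 1] f) 2 volume).toReal with hy
  have hts : t ^ s * t ^ (-s) = 1 := by rw [← Real.rpow_add ht]; simp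
  have h3 : y ≤ (besovSeminorm s f).toReal * t ^ s := by
    calc y = t ^ s * (t ^ (-s) * y) := by rw [← mul_assoc, hts, one_mul]
      _ ≤ t ^ s * (besovSeminorm s f).toReal := mul_le_mul_of_nonneg_left h2 (by positivity)
      _ = _ := mul_comm _ _
  refine (pow_le_pow_left₀ ENNReal.toReal_nonneg h3 2).trans (le_of_eq ?_)
  rw [mul_pow, ← Real.rpow_natCast (t ^ s), ← Real.rpow_mul ht.le]
  congr 2
  push_cast
  ring

lemma InvertibleBoundedBy.det_inv_ne_zero {M : ℝ} {A : Matrix (Fin d) (Fin d) ℝ}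
    (hA : InvertibleBoundedBy M A) : A⁻¹.det ≠ 0 := by
  rw [Matrix.det_nonsing_inv, Ring.inverse_eq_inv']
  exact inv_ne_zero hA.1

lemma IsDensity.mixed {f : (Fin d → ℝ) → ℝ} (hf : IsDensity f) {A : Matrix (Fin d) (Fin d) ℝ}
    (hA : A⁻¹.det ≠ 0) : IsDensity (mixed A f) where
  measurable := (hf.measurable.comp (measurable_mulVec _)).const_mul _
  nonneg x := mul_nonneg (abs_nonneg _) (hf.nonneg _)
  integrable := (memLp_one_iff_integrable.1 (memLp_comp_mulVec hA hf.measurable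
    (memLp_one_iff_integrable.2 hf.integrable))).const_mul _
  integral_eq_one := by
    simp only [WaveletICA.mixed]
    rw [integral_const_mul, integral_comp_mulVec hA hf.measurable, hf.integral_eq_one, mul_one,
      mul_inv_cancel₀ (abs_ne_zero.2 hA)]

lemma integral_sq_const_mul_comp_mulVec {B : Matrix (Fin d) (Fin d) ℝ} (hB : B.det ≠ 0)
    {g : (Fin d → ℝ) → ℝ} (hg : Measurable g) :
    ∫ x, (|B.det| * g (B.mulVec x)) ^ 2 = |B.det| * ∫ x, g x ^ 2 := by
  simp only [mul_pow]
  rw [integral_const_mul, integral_comp_mulVec hB (g := fun x => g x ^ 2) (hg.pow_const 2),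
    ← mul_assoc]
  congr 1
  have := abs_ne_zero.2 hB
  field_simp

/-- Mixing a compactly supported Besov density by matrices with bounded entries and inverses yields
densities in one smoothness class. -/
theorem exists_inSmoothClass_mixed {s : ℝ} {f : (Fin d → ℝ) → ℝ} (hf : IsDensity f)
    (hsupp : HasCompactSupport f) (hB : MemBesov s f) (M : ℝ) :
    ∃ R P S : ℝ, 0 ≤ R ∧ 0 ≤ P ∧ 0 ≤ S ∧ ∀ A : Matrix (Fin d) (Fin d) ℝ,
      InvertibleBoundedBy M A → InSmoothClass (⌊s⌋₊ + 1) s R P S (mixed A f) := by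
  obtain ⟨R, hR0, hR⟩ := hsupp.exists_abs_apply_le
  -- a positive bound on the entries, so that the radius `(d + 1) m h` below is positive
  set m : ℝ := |M| + 1 with hm
  have hm0 : 0 < m := by positivity
  have hMm : M ≤ m := (le_abs_self M).trans (by simp [hm])
  set D : ℝ := d.factorial * m ^ d with hD
  have hP0 : 0 ≤ ∫ x, f x ^ 2 := integral_nonneg fun _ => sq_nonneg _
  refine ⟨d * (m * R), D * ∫ x, f x ^ 2,
    D * ((besovSeminorm s f).toReal ^ 2 * ((d + 1) * m) ^ (2 * s)), by positivity, by positivity,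
    by positivity, fun A hA => ?_⟩
  have hdet := hA.det_inv_ne_zero
  have hdetD : |A⁻¹.det| ≤ D := by
    have := Matrix.det_le (abv := AbsoluteValue.abs) (A := A⁻¹) (x := m)
      fun i j => ((hA.2 i j).2.trans hMm)
    simpa [hD, nsmul_eq_mul] using this
  refine ⟨hf.mixed hdet, fun x hx i => ?_, ?_, ?_, fun a h h0 h1 => ?_⟩
  · have hfx : f (A⁻¹.mulVec x) ≠ 0 := fun h0 => hx (by rw [mixed, h0, mul_zero])
    have hx' : x = A.mulVec (A⁻¹.mulVec x) := by
      rw [Matrix.mulVec_mulVec, Matrix.mul_nonsing_inv _ (isUnit_iff_ne_zero.2 hA.1),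
        Matrix.one_mulVec]
    rw [hx', Matrix.mulVec, dotProduct]
    refine (Finset.abs_sum_le_sum_abs _ _).trans ?_
    refine (Finset.sum_le_card_nsmul _ _ (m * R) fun k _ => ?_).trans (by simp)
    rw [abs_mul]
    exact mul_le_mul ((hA.2 i k).1.trans hMm) (hR _ hfx k) (abs_nonneg _) hm0.le
  · exact (memLp_comp_mulVec hdet hf.measurable hB.1).const_mul _
  · refine (integral_sq_const_mul_comp_mulVec hdet hf.measurable).le.trans ?_
    exact mul_le_mul_of_nonneg_right hdetD hP0
  · have e : mixed A f = fun x => |A⁻¹.det| * f (A⁻¹.mulVec x) := rfl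
    rw [e, fwdDiff_iter_const_mul_comp_mulVec]
    refine (integral_sq_const_mul_comp_mulVec hdet
      (measurable_fwdDiff_iter hf.measurable _ _)).le.trans ?_
    have hw : ‖WithLp.toLp 2 (A⁻¹.mulVec (Pi.single a h))‖ ≤ (d + 1) * m * h := by
      refine le_of_sq_le_sq ?_ (by positivity)
      rw [EuclideanSpace.real_norm_sq_eq]
      have hle : ∀ i, (A⁻¹.mulVec (Pi.single a h)) i ^ 2 ≤ (m * h) ^ 2 := fun i => by
        rw [Matrix.mulVec_single, ← sq_abs]
        refine pow_le_pow_left₀ (abs_nonneg _) ?_ 2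
        simp only [Pi.smul_apply, Matrix.col_apply, MulOpposite.smul_eq_mul_unop,
          MulOpposite.unop_op, abs_mul, abs_of_pos h0]
        exact mul_le_mul_of_nonneg_right ((hA.2 i a).2.trans hMm) h0.le
      refine (Finset.sum_le_card_nsmul _ _ _ fun i _ => hle i).trans ?_
      rw [Finset.card_univ, Fintype.card_fin, nsmul_eq_mul]
      have : (d : ℝ) ≤ (d + 1) ^ 2 := by nlinarith [(Nat.cast_nonneg d : (0 : ℝ) ≤ d)]
      calc (d : ℝ) * (m * h) ^ 2 ≤ (d + 1) ^ 2 * (m * h) ^ 2 :=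
            mul_le_mul_of_nonneg_right this (sq_nonneg _)
        _ = _ := by ring
    have h2 := hB.integral_fwdDiff_sq_le (t := (d + 1) * m * h) (by positivity) hw
    rw [Real.mul_rpow (by positivity) h0.le, ← mul_assoc] at h2
    calc _ ≤ D * ((besovSeminorm s f).toReal ^ 2 * ((d + 1) * m) ^ (2 * s) * h ^ (2 * s)) :=
          mul_le_mul hdetD h2 (integral_nonneg fun _ => sq_nonneg _) (by positivity)
      _ = _ := by ring

end WaveletICA

end Mixing

/-! ### Choice of the resolution -/

section Resolution

namespace WaveletICA

variable {d n : ℕ} {a b s : ℝ}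

lemma two_rpow_neg_eq (s : ℝ) (j : ℕ) :
    (2 : ℝ) ^ (-(4 * j * s)) = ((2 : ℝ) ^ j) ^ (-(4 * s)) := by
  rw [← Real.rpow_natCast, ← Real.rpow_mul two_pos.le]
  congr 1
  ring

lemma riskBound_eq (a b s : ℝ) (d n j : ℕ) :
    riskBound a b s d n j = a * ((2 : ℝ) ^ j) ^ (-(4 * s)) + b * (((2 : ℝ) ^ j) ^ d / n) := by
  rw [riskBound, two_rpow_neg_eq, pow_mul, mul_div_assoc]

lemma exists_isMinimizingResolution (hd : 1 ≤ d) (hn : 1 ≤ n) (ha : 0 < a) (hb : 0 < b) :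
    ∃ j : ℕ, IsMinimizingResolution a b s d n j := by
  have hn0 : (0 : ℝ) < n := by exact_mod_cast hn
  obtain ⟨J, hJ⟩ := pow_unbounded_of_one_lt (riskBound a b s d n 0 * n / b) one_lt_two
  have hbig : ∀ i, J ≤ i → riskBound a b s d n 0 ≤ riskBound a b s d n i := fun i hi => by
    rw [div_lt_iff₀ hb] at hJ
    have h1 : (2 : ℝ) ^ J ≤ (2 : ℝ) ^ (i * d) :=
      pow_le_pow_right₀ one_le_two (hi.trans (Nat.le_mul_of_pos_right i hd))
    have h2 : riskBound a b s d n 0 ≤ b * (2 : ℝ) ^ (i * d) / n := by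
      rw [le_div_iff₀ hn0]
      nlinarith
    refine h2.trans ?_
    rw [riskBound]
    have : 0 ≤ a * (2 : ℝ) ^ (-(4 * i * s)) := by positivity
    linarith
  obtain ⟨j, -, hj⟩ := Finset.exists_min_image (Finset.range (J + 1)) (riskBound a b s d n)
    ⟨0, by simp⟩
  refine ⟨j, fun i => ?_⟩
  rcases le_or_gt J i with h | h
  · exact (hj 0 (by simp)).trans (hbig i h)
  · exact hj i (Finset.mem_range.2 (by omega))

/-- With `x = n^{1/(4s+d)}`, the bias and variance terms `x^{-4s}` and `x^d / n` balance. -/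
lemma rate_eq (hs : 0 < s) (hn : 1 ≤ n) :
    ((n : ℝ) ^ (1 / (4 * s + d))) ^ (-(4 * s)) = (n : ℝ) ^ (-(4 * s) / (4 * s + d)) ∧
      ((n : ℝ) ^ (1 / (4 * s + d))) ^ d / n = (n : ℝ) ^ (-(4 * s) / (4 * s + d)) := by
  have hn0 : (0 : ℝ) < n := by exact_mod_cast hn
  have hsd : 4 * s + d ≠ 0 := by positivity
  constructor
  · rw [← Real.rpow_mul hn0.le]
    congr 1
    ring
  · rw [← Real.rpow_natCast, ← Real.rpow_mul hn0.le]
    nth_rewrite 2 [← Real.rpow_one (n : ℝ)]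
    rw [← Real.rpow_sub hn0]
    congr 1
    field_simp
    ring

/-- With `y = 2^j`, `x = n^{1/(4s+d)}` and a constant `T`, a minimizer `j` satisfies
`a y^{-4s} ≤ T x^{-4s}` and `b y^d / n ≤ T x^{-4s}`, which bounds `y / x` from below and above. -/
lemma exists_isMinimizingResolution_bounds (hd : 1 ≤ d) (hs : 0 < s) (ha : 0 < a) (hb : 0 < b) :
    ∃ c₁ c₂ : ℝ, 0 < c₁ ∧ 0 < c₂ ∧ ∀ n j : ℕ, 1 ≤ n → IsMinimizingResolution a b s d n j →
      c₁ * (n : ℝ) ^ (1 / (4 * s + d)) ≤ (2 : ℝ) ^ j ∧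
      (2 : ℝ) ^ j ≤ c₂ * (n : ℝ) ^ (1 / (4 * s + d)) := by
  set T : ℝ := a * 2 ^ (4 * s) + b with hT
  have hT0 : 0 < T := by positivity
  have hd0 : (0 : ℝ) < d := by exact_mod_cast hd
  refine ⟨(a / T) ^ (1 / (4 * s)), (T / b) ^ (1 / (d : ℝ)), by positivity, by positivity,
    fun n j hn hj => ?_⟩
  have hn0 : (0 : ℝ) < n := by exact_mod_cast hn
  have hn1 : (1 : ℝ) ≤ n := by exact_mod_cast hn
  obtain ⟨hr1, hr2⟩ := rate_eq (d := d) hs hn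
  set x : ℝ := (n : ℝ) ^ (1 / (4 * s + d)) with hx
  set ρ : ℝ := (n : ℝ) ^ (-(4 * s) / (4 * s + d)) with hρ
  have hx1 : 1 ≤ x := Real.one_le_rpow hn1 (by positivity)
  have hx0 : 0 < x := by linarith
  -- compare with the largest dyadic number below `n^{1/(4s+d)}`
  obtain ⟨j₀, h1, h2⟩ := exists_nat_pow_near hx1 one_lt_two
  have hle : riskBound a b s d n j ≤ T * ρ := by
    refine (hj j₀).trans ?_
    rw [riskBound_eq]
    have h3 : ((2 : ℝ) ^ j₀) ^ (-(4 * s)) ≤ 2 ^ (4 * s) * ρ := by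
      have h4 : x / 2 ≤ (2 : ℝ) ^ j₀ := by rw [pow_succ] at h2; linarith
      refine (Real.rpow_le_rpow_of_nonpos (by positivity) h4 (by linarith)).trans (le_of_eq ?_)
      rw [Real.div_rpow hx0.le two_pos.le, hr1, Real.rpow_neg two_pos.le, div_inv_eq_mul, mul_comm]
    have h5 : ((2 : ℝ) ^ j₀) ^ d / n ≤ ρ := by
      rw [← hr2]
      exact div_le_div_of_nonneg_right (pow_le_pow_left₀ (by positivity) h1 d) hn0.le
    calc _ ≤ a * (2 ^ (4 * s) * ρ) + b * ρ :=
          add_le_add (mul_le_mul_of_nonneg_left h3 ha.le) (mul_le_mul_of_nonneg_left h5 hb.le)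
      _ = T * ρ := by rw [hT]; ring
  rw [riskBound_eq] at hle
  set y : ℝ := (2 : ℝ) ^ j with hy
  have hy0 : 0 < y := by positivity
  have hA : a * y ^ (-(4 * s)) ≤ T * x ^ (-(4 * s)) := by
    have : 0 ≤ b * (y ^ d / n) := by positivity
    rw [hr1]; linarith
  have hB : b * (y ^ d / n) ≤ T * (x ^ d / n) := by
    have : 0 ≤ a * y ^ (-(4 * s)) := by positivity
    rw [hr2]; linarith
  constructor
  · refine le_of_not_gt fun hlt => ?_
    have h3 := Real.rpow_lt_rpow hy0.le hlt (by positivity : 0 < 4 * s)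
    rw [Real.mul_rpow (by positivity) hx0.le, ← Real.rpow_mul (by positivity),
      one_div_mul_cancel (by positivity), Real.rpow_one] at h3
    rw [Real.rpow_neg hy0.le, Real.rpow_neg hx0.le, ← div_eq_mul_inv, ← div_eq_mul_inv,
      div_le_div_iff₀ (by positivity) (by positivity)] at hA
    rw [div_mul_eq_mul_div, lt_div_iff₀ hT0] at h3
    linarith
  · refine le_of_not_gt fun hlt => ?_
    have h3 := pow_lt_pow_left₀ hlt (by positivity) (by omega : d ≠ 0)
    rw [mul_pow, ← Real.rpow_natCast ((T / b) ^ (1 / (d : ℝ))), ← Real.rpow_mul (by positivity),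
      one_div_mul_cancel hd0.ne', Real.rpow_one, div_mul_eq_mul_div, div_lt_iff₀ hb] at h3
    rw [← mul_div_assoc, ← mul_div_assoc, div_le_div_iff_of_pos_right hn0] at hB
    linarith

lemma bias_variance_le_rate (hs : 0 < s) (hn : 1 ≤ n) {c₁ c₂ : ℝ} (hc₁ : 0 < c₁) (hc₂ : 0 < c₂)
    {j : ℕ} (h1 : c₁ * (n : ℝ) ^ (1 / (4 * s + d)) ≤ (2 : ℝ) ^ j)
    (h2 : (2 : ℝ) ^ j ≤ c₂ * (n : ℝ) ^ (1 / (4 * s + d))) :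
    (2 : ℝ) ^ (-(4 * j * s)) + (2 : ℝ) ^ (j * d) / n + ((2 : ℝ) ^ (j * d) / n) ^ 2
      ≤ (c₁ ^ (-(4 * s)) + c₂ ^ d + (c₂ ^ d) ^ 2) * (n : ℝ) ^ (-(4 * s) / (4 * s + d)) := by
  have hn0 : (0 : ℝ) < n := by exact_mod_cast hn
  have hn1 : (1 : ℝ) ≤ n := by exact_mod_cast hn
  obtain ⟨hr1, hr2⟩ := rate_eq (d := d) hs hn
  set x : ℝ := (n : ℝ) ^ (1 / (4 * s + d)) with hx
  set ρ : ℝ := (n : ℝ) ^ (-(4 * s) / (4 * s + d)) with hρ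
  have hx0 : 0 < x := by positivity
  have hρ0 : 0 ≤ ρ := by positivity
  have hρ1 : ρ ≤ 1 := Real.rpow_le_one_of_one_le_of_nonpos hn1
    (div_nonpos_of_nonpos_of_nonneg (by linarith) (by positivity))
  rw [two_rpow_neg_eq, pow_mul]
  have h3 : ((2 : ℝ) ^ j) ^ (-(4 * s)) ≤ c₁ ^ (-(4 * s)) * ρ := by
    rw [← hr1, ← Real.mul_rpow hc₁.le hx0.le]
    exact Real.rpow_le_rpow_of_nonpos (by positivity) h1 (by linarith)
  have h4 : ((2 : ℝ) ^ j) ^ d / n ≤ c₂ ^ d * ρ := by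
    rw [← hr2, ← mul_div_assoc, ← mul_pow]
    exact div_le_div_of_nonneg_right (pow_le_pow_left₀ (by positivity) h2 d) hn0.le
  have h5 : (((2 : ℝ) ^ j) ^ d / n) ^ 2 ≤ (c₂ ^ d) ^ 2 * ρ := by
    refine (pow_le_pow_left₀ (by positivity) h4 2).trans ?_
    rw [mul_pow]
    refine mul_le_mul_of_nonneg_left ?_ (by positivity)
    nlinarith
  linarith

lemma isLittleO_rate (hd : 1 ≤ d) (hs : 0 < s) :
    (fun n : ℕ => (n : ℝ) ^ (-(4 * s) / (4 * s + d)))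
      =o[atTop] (fun n : ℕ => (n : ℝ) ^ (-(2 * s) / (2 * s + d))) := by
  have hd0 : (0 : ℝ) < d := by exact_mod_cast hd
  have hlt : -(4 * s) / (4 * s + d) < -(2 * s) / (2 * s + d) := by
    rw [div_lt_div_iff₀ (by positivity) (by positivity)]
    nlinarith [mul_pos hs hd0]
  have hpos : ∀ᶠ n : ℕ in atTop, (0 : ℝ) < n :=
    (eventually_gt_atTop 0).mono fun n hn => by exact_mod_cast hn
  rw [isLittleO_iff_tendsto' (hpos.mono fun n hn h0 => absurd h0 (by positivity))]
  refine ((tendsto_rpow_neg_atTop (sub_pos.2 hlt)).comp tendsto_natCast_atTop_atTop).congr'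
    (hpos.mono fun n hn => ?_)
  rw [Function.comp_apply, neg_sub, Real.rpow_sub hn]

lemma depNorm_eq_zero {p : (Fin d → ℝ) → ℝ} (hp : Factorizes p) : depNorm p = 0 := by
  have h : (fun x => p x - marginalProd p x) =ᵐ[volume] 0 := by
    filter_upwards [hp] with x hx
    simp [hx]
  rw [depNorm, eLpNorm_congr_ae h, eLpNorm_zero, ENNReal.toReal_zero]

end WaveletICA

end Resolution

theorem proposition4p5 {d : ℕ} (hd : 2 ≤ d) {s : ℝ} (hs : 0 < s) {r : ℕ} (hr : s < r)
    (φ : ℝ → ℝ) (hφ : IsRegularScalingFunction r φ)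
    (f : (Fin d → ℝ) → ℝ) (hf : IsDensity f) (hprod : Factorizes f)
    (hsupp : HasCompactSupport f) (hB : MemBesov s f) :
    -- The risk bounds, for every mixing matrix, with constants that are locally uniform in it.
    (∀ M : ℝ, ∃ K : ℝ, 0 < K ∧ ∀ A : Matrix (Fin d) (Fin d) ℝ, InvertibleBoundedBy M A →
      ∀ n j : ℕ, 1 ≤ n →
        MemLp (contrastEst (d := d) (n := n) φ j) 2 (sampleLaw n (mixed A f)) ∧
        ((2 : ℝ) ^ (j * d) ≤ n →
          quadRisk φ n (mixed A f) j (contrast φ (mixed A f) j) ≤ K * (2 : ℝ) ^ (j * d) / n ∧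
          quadRisk φ n (mixed A f) j 0
            + depNorm (mixed A f)
              * quarticQ (Real.sqrt (contrast φ (mixed A f) j)) (depNorm (mixed A f))
            ≤ riskBound K K s d n j)) ∧
    -- The minimizing resolution exists and satisfies `2^j ≈ n^{1/(4s+d)}`.
    (∀ a b : ℝ, 0 < a → 0 < b →
      (∀ n : ℕ, 1 ≤ n → ∃ j : ℕ, IsMinimizingResolution a b s d n j) ∧
      ∃ c₁ c₂ : ℝ, 0 < c₁ ∧ 0 < c₂ ∧ ∀ n j : ℕ, 1 ≤ n → IsMinimizingResolution a b s d n j →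
        c₁ * (n : ℝ) ^ (1 / (4 * s + d)) ≤ (2 : ℝ) ^ j ∧
        (2 : ℝ) ^ j ≤ c₂ * (n : ℝ) ^ (1 / (4 * s + d))) ∧
    -- At such a resolution the quadratic risk has rate `n^{-4s/(4s+d)}`.
    (∀ M c₁ c₂ : ℝ, 0 < c₁ → 0 < c₂ → ∃ K : ℝ, 0 < K ∧
      ∀ A : Matrix (Fin d) (Fin d) ℝ, InvertibleBoundedBy M A → ∀ n j : ℕ, 1 ≤ n →
        c₁ * (n : ℝ) ^ (1 / (4 * s + d)) ≤ (2 : ℝ) ^ j →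
        (2 : ℝ) ^ j ≤ c₂ * (n : ℝ) ^ (1 / (4 * s + d)) →
          quadRisk φ n (mixed A f) j (contrast φ (mixed A f) j)
            ≤ K * (n : ℝ) ^ (-(4 * s) / (4 * s + d)) ∧
          quadRisk φ n (mixed A f) j 0
            + depNorm (mixed A f)
              * quarticQ (Real.sqrt (contrast φ (mixed A f) j)) (depNorm (mixed A f))
            ≤ K * (n : ℝ) ^ (-(4 * s) / (4 * s + d)) ∧
          (Factorizes (mixed A f) →
            quadRisk φ n (mixed A f) j 0 ≤ K * (n : ℝ) ^ (-(4 * s) / (4 * s + d)))) ∧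
    -- This rate is faster than the minimax rate `n^{-2s/(2s+d)}` of density estimation.
    (fun n : ℕ => (n : ℝ) ^ (-(4 * s) / (4 * s + d)))
      =o[atTop] (fun n : ℕ => (n : ℝ) ^ (-(2 * s) / (2 * s + d))) := by
  have hd1 : 1 ≤ d := by omega
  have hr0 : 1 ≤ r := by
    have : (0 : ℝ) < r := hs.trans hr
    exact_mod_cast this
  have hN : ⌊s⌋₊ + 1 ≤ r := (Nat.floor_lt hs.le).2 hr
  have hrisk : ∀ M : ℝ, ∃ K : ℝ, 0 < K ∧ ∀ A : Matrix (Fin d) (Fin d) ℝ, InvertibleBoundedBy M A →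
      ∀ n j : ℕ, 1 ≤ n →
        MemLp (contrastEst (d := d) (n := n) φ j) 2 (sampleLaw n (mixed A f)) ∧
        quadRisk φ n (mixed A f) j (contrast φ (mixed A f) j)
          ≤ K * ((2 : ℝ) ^ (j * d) / n + ((2 : ℝ) ^ (j * d) / n) ^ 2) ∧
        quadRisk φ n (mixed A f) j 0
          + depNorm (mixed A f)
            * quarticQ (Real.sqrt (contrast φ (mixed A f) j)) (depNorm (mixed A f))
          ≤ K * ((2 : ℝ) ^ (-(4 * j * s)) + (2 : ℝ) ^ (j * d) / n
            + ((2 : ℝ) ^ (j * d) / n) ^ 2) := fun M => by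
    obtain ⟨R, P, S, hR, hP, hS, hclass⟩ := exists_inSmoothClass_mixed hf hsupp hB M
    obtain ⟨K, hK, h⟩ := hφ.exists_risk_le (d := d) hr0 hN hs hR hP hS
    exact ⟨K, hK, fun A hA => h _ (hclass A hA)⟩
  refine ⟨fun M => ?_, fun a b ha hb => ⟨fun n hn => exists_isMinimizingResolution hd1 hn ha hb,
    exists_isMinimizingResolution_bounds hd1 hs ha hb⟩, fun M c₁ c₂ hc₁ hc₂ => ?_,
    isLittleO_rate hd1 hs⟩
  · obtain ⟨K, hK, h⟩ := hrisk M
    refine ⟨2 * K, by positivity, fun A hA n j hn => ?_⟩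
    obtain ⟨h0, h1, h2⟩ := h A hA n j hn
    have hn0 : (0 : ℝ) < n := by exact_mod_cast hn
    refine ⟨h0, fun hjn => ?_⟩
    have hu0 : 0 ≤ (2 : ℝ) ^ (j * d) / n := by positivity
    have hu : ((2 : ℝ) ^ (j * d) / n) ^ 2 ≤ (2 : ℝ) ^ (j * d) / n := by
      have : (2 : ℝ) ^ (j * d) / n ≤ 1 := (div_le_one hn0).2 hjn
      nlinarith
    have hw0 : 0 ≤ (2 : ℝ) ^ (-(4 * j * s)) := by positivity
    refine ⟨h1.trans ?_, h2.trans ?_⟩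
    · rw [mul_div_assoc, mul_comm 2 K, mul_assoc]
      refine mul_le_mul_of_nonneg_left ?_ hK.le
      linarith
    · rw [riskBound, mul_div_assoc, ← mul_add, mul_comm 2 K, mul_assoc K 2]
      refine mul_le_mul_of_nonneg_left ?_ hK.le
      linarith
  · obtain ⟨K, hK, h⟩ := hrisk M
    set E : ℝ := c₁ ^ (-(4 * s)) + c₂ ^ d + (c₂ ^ d) ^ 2 with hE
    refine ⟨K * E, by positivity, fun A hA n j hn hj1 hj2 => ?_⟩
    obtain ⟨-, h1, h2⟩ := h A hA n j hn
    have hbv := mul_le_mul_of_nonneg_left (bias_variance_le_rate hs hn hc₁ hc₂ hj1 hj2) hK.le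
    rw [← hE, ← mul_assoc] at hbv
    have h3 := h2.trans hbv
    refine ⟨(h1.trans ?_).trans hbv, h3, fun hfac => ?_⟩
    · refine mul_le_mul_of_nonneg_left ?_ hK.le
      have hw0 : 0 ≤ (2 : ℝ) ^ (-(4 * j * s)) := by positivity
      linarith
    · rwa [depNorm_eq_zero hfac, zero_mul, add_zero] at h3
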